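/- Let $G$ be a finite group, $A$ a normal subgroup of $G$, and $\alpha\colon G\times G\to\mathbb S^1$ a normalized 2-cocycle. For a subgroup $H\le G$ let $\widetilde H_\alpha=H\times\mathbb S^1$ with product $(g,z)(h,w)=(gh,\alpha(g,h)zw)$. A compact Hausdorff $G$-space $X$ is regarded as an $\widetilde H_\alpha$-space on which $\mathbb S^1$ acts trivially, and all $\widetilde H_\alpha$-equivariant complex vector bundles below are required to have $\mathbb S^1$ acting by scalar multiplication on the fibres. Let ${}^\alpha K_G^0(X)$ be the Grothendieck group of isomorphism classes of $\widetilde G_\alpha$-equivariant vector bundles over $X$, and for $n>0$ let ${}^\alpha K_G^n(X)={}^\alpha\tilde K_G^0(\Sigma^nX_+)$ be the kernel of restriction to the base point ${}^\alpha K_G^0(\Sigma^nX_+)\to{}^\alpha K_G^0(\mathrm{pt})$. Let $\mathrm{Irr}^\alpha(A)$ be the set of isomorphism classes of irreducible complex $\alpha$-representations of $A$ (finite dimensional, $\rho(1)=\mathrm{id}$, $\rho(a)\rho(b)=\alpha(a,b)\rho(ab)$), with the $G$-action induced by $(g\cdot\rho)(a)=\alpha(g^{-1}a,g)\,\alpha(g,g^{-1}a)^{-1}\rho(g^{-1}ag)$;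 write $\tilde\rho(a,z)=z\rho(a)$ for the corresponding representation of $\widetilde A_\alpha$. For $[\tau]\in\mathrm{Irr}^\alpha(A)$ let $G_{[\tau]}$ be its isotropy group, which contains $A$, and $(\widetilde G_{[\tau]})_\alpha$ its central extension. If $A$ acts trivially on $X$, a $((\widetilde G_{[\tau]})_\alpha,\tau)$-equivariant bundle is a $(\widetilde G_{[\tau]})_\alpha$-equivariant vector bundle $E$ over $X$ for which $\mathbb V_\tau\otimes\mathrm{Hom}_{\widetilde A_\alpha}(\mathbb V_\tau,E)\to E$, $v\otimes f\mapsto f(v)$, is an isomorphism, where $\mathbb V_\tau=X\times V_\tau$. Let $K^0_{(\widetilde G_{[\tau]})_\alpha,\tau}(X)$ be the Grothendieck group of isomorphism classes of such bundles and $K^n_{(\widetilde G_{[\tau]})_\alpha,\tau}(X)=\tilde K^0_{(\widetilde G_{[\tau]})_\alpha,\tau}(\Sigma^nX_+)$ for $n>0$. For $h\in G_{[\tau]}$ let $M_h\in \mathrm{GL}(V_\tau)$ satisfy $(h\cdot\tau)(a)=M_h^{-1}\tau(a)M_h$ for all $a\in A$ ($M_h$ is unique up to a scalar). If $E$ is a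 $\widetilde G_\alpha$-equivariant vector bundle over $X$, let $(\widetilde G_{[\tau]})_\alpha$ act on $\mathbb V_\tau\otimes\mathrm{Hom}_{\widetilde A_\alpha}(\mathbb V_\tau,E)$ by $(h,z)\star(v\otimes f)=M_hv\otimes\big(w\mapsto (h,z)f(M_h^{-1}w)\big)$. **Theorem.** Choose a representative $\tau$ of every orbit in $G\backslash\mathrm{Irr}^\alpha(A)$. Then for every compact Hausdorff $G$-space $X$ on which $A$ acts trivially and every $n\ge0$ there is an isomorphism of groups $$\Psi_X\colon {}^\alpha K_G^n(X)\longrightarrow\bigoplus_{[\tau]\in G\backslash\mathrm{Irr}^\alpha(A)}K^n_{(\widetilde G_{[\tau]})_\alpha,\tau}(X),\qquad [E]\longmapsto\bigoplus_{[\tau]}\big[\mathbb V_\tau\otimes\mathrm{Hom}_{\widetilde A_\alpha}(\mathbb V_\tau,E)\big]$$ (for $n>0$ the formula is applied to bundles over $\Sigma^nX_+$ and extended additively to differences of classes); in particular $\mathbb V_\tau\otimes\mathrm{Hom}_{\widetilde A_\alpha}(\mathbb V_\tau,E)$ is a $((\widetilde G_{[\tau]})_\alpha,\tau)$-equivariant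 vector bundle. These isomorphisms are natural: $\Psi_Y\circ f^*=f^*\circ\Psi_X$ for every continuous $G$-map $f\colon Y\to X$ of compact Hausdorff $G$-spaces on which $A$ acts trivially. -/

import Mathlib

open scoped TensorProduct DirectSum

universe u v

noncomputable section

namespace TwK

/-! ## Cocycles, central extensions and projective representations -/

/-- A normalized 2-cocycle on a group `G` with values in the circle. -/
structure Cocycle (G : Type*) [Group G] where
  toFun : G → G → Circle
  cocycle : ∀ g h k, toFun (g * h) k * toFun g h = toFun g (h * k) * toFun h k
  right_one : ∀ g, toFun g 1 = 1
  left_one : ∀ g, toFun 1 g = 1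

namespace Cocycle

instance {G : Type*} [Group G] : CoeFun (Cocycle G) (fun _ => G → G → Circle) := ⟨Cocycle.toFun⟩

/-- Restriction of a cocycle along a group homomorphism. -/
def comap {G K : Type*} [Group G] [Group K] (α : Cocycle G) (j : K →* G) : Cocycle K where
  toFun g h := α (j g) (j h)
  cocycle g h k := by simpa using α.cocycle (j g) (j h) (j k)
  right_one g := by simpa using α.right_one (j g)
  left_one g := by simpa using α.left_one (j g)

end Cocycle

/-- The central extension of `G` by the circle defined by the cocycle `α`: the set `G × 𝕊¹` with
product `(g₁, z₁) (g₂, z₂) = (g₁ g₂, α(g₁, g₂) z₁ z₂)`. -/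
@[ext] structure TwistedGroup {G : Type*} [Group G] (α : Cocycle G) where
  g : G
  z : Circle

namespace TwistedGroup

variable {G : Type*} [Group G] {α : Cocycle G}

instance : Mul (TwistedGroup α) := ⟨fun p q => ⟨p.g * q.g, α p.g q.g * p.z * q.z⟩⟩
instance : One (TwistedGroup α) := ⟨⟨1, 1⟩⟩
instance : Inv (TwistedGroup α) := ⟨fun p => ⟨p.g⁻¹, (α p.g⁻¹ p.g * p.z)⁻¹⟩⟩

@[simp] lemma mul_g (p q : TwistedGroup α) : (p * q).g = p.g * q.g := rfl
@[simp] lemma mul_z (p q : TwistedGroup α) : (p * q).z = α p.g q.g * p.z * q.z := rfl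
@[simp] lemma one_g : (1 : TwistedGroup α).g = 1 := rfl
@[simp] lemma one_z : (1 : TwistedGroup α).z = 1 := rfl
@[simp] lemma inv_g (p : TwistedGroup α) : p⁻¹.g = p.g⁻¹ := rfl
@[simp] lemma inv_z (p : TwistedGroup α) : p⁻¹.z = (α p.g⁻¹ p.g * p.z)⁻¹ := rfl

instance : Group (TwistedGroup α) :=
  Group.ofLeftAxioms
    (fun p q r => by
      ext1
      · simp [mul_assoc]
      · have h := α.cocycle p.g q.g r.g
        simp only [mul_g, mul_z]
        calc α (p.g * q.g) r.g * (α p.g q.g * p.z * q.z) * r.z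
            = (α (p.g * q.g) r.g * α p.g q.g) * (p.z * q.z * r.z) := by
              simp only [mul_assoc]
          _ = (α p.g (q.g * r.g) * α q.g r.g) * (p.z * q.z * r.z) := by rw [h]
          _ = α p.g (q.g * r.g) * p.z * (α q.g r.g * q.z * r.z) := by
              simp only [mul_assoc, mul_left_comm])
    (fun p => by ext1 <;> simp [α.left_one])
    (fun p => by
      ext1
      · simp
      · simp only [mul_z, inv_g, inv_z, one_z]
        rw [mul_inv_rev, mul_assoc, mul_assoc, mul_left_comm, ← mul_assoc, ← mul_assoc]
        simp)

/-- The topology of `G × 𝕊¹`, where `G` is discrete. -/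
instance : TopologicalSpace (TwistedGroup α) :=
  .induced (fun p => (p.g, p.z)) (@instTopologicalSpaceProd G Circle ⊥ _)

/-- The homomorphism of central extensions over a homomorphism `j : K → G`. -/
abbrev map {K : Type*} [Group K] (j : K →* G) (p : TwistedGroup (α.comap j)) : TwistedGroup α :=
  ⟨j p.g, p.z⟩

end TwistedGroup

/-- A finite dimensional complex `α`-representation of `G`:
`ρ(1) = id` and `ρ(g) ρ(h) = α(g, h) ρ(gh)`. Each `ρ(g)` is then automatically invertible. -/
structure ProjRep {G : Type*} [Group G] (α : Cocycle G) where
  V : Type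
  [addCommGroup : AddCommGroup V]
  [module : Module ℂ V]
  [finiteDimensional : FiniteDimensional ℂ V]
  ρ : G → Module.End ℂ V
  map_one : ρ 1 = 1
  map_mul : ∀ g h, ρ g * ρ h = (α g h : ℂ) • ρ (g * h)

namespace ProjRep

attribute [instance] addCommGroup module finiteDimensional

variable {G : Type*} [Group G] {α : Cocycle G}

/-- The representation `(g, z) ↦ z ρ(g)` of the central extension. -/
def tilde (ρ : ProjRep α) (p : TwistedGroup α) : Module.End ℂ ρ.V := (p.z : ℂ) • ρ.ρ p.g

lemma tilde_mul (ρ : ProjRep α) (p q : TwistedGroup α) :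
    ρ.tilde (p * q) = ρ.tilde p * ρ.tilde q := by
  simp only [tilde, TwistedGroup.mul_g, TwistedGroup.mul_z, smul_mul_smul_comm, ρ.map_mul,
    smul_smul, Circle.coe_mul]
  congr 1; ring

lemma tilde_one (ρ : ProjRep α) : ρ.tilde 1 = 1 := by
  simp [tilde, ρ.map_one]

/-- Linear equivalence of `α`-representations. -/
def Iso (ρ σ : ProjRep α) : Prop :=
  ∃ e : ρ.V ≃ₗ[ℂ] σ.V, ∀ g v, e (ρ.ρ g v) = σ.ρ g (e v)

/-- Irreducibility: nonzero, and without proper nonzero invariant subspaces. -/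
def IsIrreducible (ρ : ProjRep α) : Prop :=
  Nontrivial ρ.V ∧
    ∀ W : Submodule ℂ ρ.V, (∀ g, ∀ w ∈ W, ρ.ρ g w ∈ W) → W = ⊥ ∨ W = ⊤

end ProjRep

/-- Irreducible `α`-representations. -/
structure IrrRep {G : Type*} [Group G] (α : Cocycle G) extends ProjRep α where
  irr : toProjRep.IsIrreducible

instance IrrRep.setoid {G : Type*} [Group G] (α : Cocycle G) : Setoid (IrrRep α) where
  r ρ σ := ρ.toProjRep.Iso σ.toProjRep
  iseqv :=
    ⟨fun ρ => ⟨LinearEquiv.refl ℂ _, fun _ _ => rfl⟩,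
      fun ⟨e, he⟩ => ⟨e.symm, fun g v => by
        rw [LinearEquiv.symm_apply_eq, he, LinearEquiv.apply_symm_apply]⟩,
      fun ⟨e, he⟩ ⟨f, hf⟩ => ⟨e.trans f, fun g v => by
        simp only [LinearEquiv.trans_apply, he, hf]⟩⟩

/-- `Irr^α(G)`: isomorphism classes of irreducible `α`-representations of `G`. -/
def Irr {G : Type v} [Group G] (α : Cocycle G) : Type (max 1 v) := Quotient (IrrRep.setoid α)

/-- The class `[ρ]` in `Irr^α(G)`. -/
def IrrRep.cls {G : Type*} [Group G] {α : Cocycle G} (ρ : IrrRep α) : Irr α :=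
  Quotient.mk (IrrRep.setoid α) ρ

/-! ## The action of `G` on `Irr^α(A)` -/

section Action

variable {G : Type v} [Group G] (α : Cocycle G) (A : Subgroup G)

/-- The scalar `α(g⁻¹a, g) α(g, g⁻¹a)⁻¹`. -/
def kappa (g a : G) : Circle := α (g⁻¹ * a) g * (α g (g⁻¹ * a))⁻¹

lemma kappa_conj (g a : G) (w : Circle) :
    (⟨a, w⟩ : TwistedGroup α) * ⟨g, 1⟩ = ⟨g, 1⟩ * ⟨g⁻¹ * a * g, kappa α g a * w⟩ := by
  ext1
  · simp [mul_assoc]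
  · have h := α.cocycle g (g⁻¹ * a) g
    rw [mul_inv_cancel_left] at h
    simp only [TwistedGroup.mul_z, kappa, mul_one]
    rw [eq_mul_inv_of_mul_eq h]
    simp only [mul_assoc, mul_left_comm, mul_comm]

lemma kappa_conj' (g a : G) (w z : Circle) :
    (⟨a, w⟩ : TwistedGroup α) * ⟨g, z⟩ = ⟨g, z⟩ * ⟨g⁻¹ * a * g, kappa α g a * w⟩ := by
  have h := congrArg TwistedGroup.z (kappa_conj α g a w)
  simp only [TwistedGroup.mul_z, mul_one] at h
  ext1
  · simp [mul_assoc]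
  · simp only [TwistedGroup.mul_z]
    rw [h, mul_right_comm]

lemma kappa_mul (g a b : G) :
    kappa α g a * kappa α g b * α (g⁻¹ * a * g) (g⁻¹ * b * g) = α a b * kappa α g (a * b) := by
  have h1 := kappa_conj α g (a * b) (α a b)
  have h2 : (⟨a * b, α a b⟩ : TwistedGroup α) = ⟨a, 1⟩ * ⟨b, 1⟩ := by ext1 <;> simp
  rw [h2, mul_assoc, kappa_conj, ← mul_assoc, kappa_conj, mul_assoc] at h1
  have := congrArg TwistedGroup.z (mul_left_cancel h1)
  simp only [TwistedGroup.mul_z, mul_one] at this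
  rw [mul_comm (α a b), ← this, mul_comm (kappa α g a * _), ← mul_assoc]

lemma kappa_one (a : G) : kappa α 1 a = 1 := by
  simp [kappa, α.left_one, α.right_one]

lemma kappa_at_one (g : G) : kappa α g 1 = 1 := by
  have := congrArg TwistedGroup.z (kappa_conj α g 1 1)
  simpa [α.left_one, α.right_one] using this.symm

lemma kappa_comp (g h a : G) :
    kappa α g a * kappa α h (g⁻¹ * a * g) = kappa α (g * h) a := by
  have e : (⟨g, 1⟩ : TwistedGroup α) * ⟨h, 1⟩ = ⟨g * h, 1⟩ * ⟨1, α g h⟩ := by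
    ext1 <;> simp [α.right_one]
  have c : ∀ (x : G) (w : Circle), (⟨x, w⟩ : TwistedGroup α) * ⟨1, α g h⟩ =
      ⟨1, α g h⟩ * ⟨x, w⟩ := fun x w => by
    ext1 <;> simp [α.right_one, α.left_one, mul_comm]
  have h1 : (⟨a, 1⟩ : TwistedGroup α) * (⟨g, 1⟩ * ⟨h, 1⟩) =
      (⟨g, 1⟩ * ⟨h, 1⟩) * ⟨h⁻¹ * (g⁻¹ * a * g) * h,
        kappa α h (g⁻¹ * a * g) * (kappa α g a * 1)⟩ := by
    rw [← mul_assoc, kappa_conj α g a, mul_assoc (⟨g, 1⟩ : TwistedGroup α),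
      kappa_conj α h (g⁻¹ * a * g), ← mul_assoc]
  rw [e, ← mul_assoc, kappa_conj, mul_assoc (⟨g * h, 1⟩ : TwistedGroup α), c,
    mul_assoc (⟨g * h, 1⟩ : TwistedGroup α)] at h1
  have := congrArg TwistedGroup.z (mul_left_cancel (mul_left_cancel h1))
  simp only [mul_one] at this
  rw [this, mul_comm]

variable {α A} [A.Normal]

/-- The element `g⁻¹ a g` of the normal subgroup `A`. -/
def conjInv (g : G) (a : A) : A :=
  ⟨g⁻¹ * a * g, by simpa using Subgroup.Normal.conj_mem ‹A.Normal› (a : G) a.2 g⁻¹⟩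

/-- The `α`-representation `g · ρ` of `A`,
`(g · ρ)(a) = α(g⁻¹a, g) α(g, g⁻¹a)⁻¹ ρ(g⁻¹ a g)`. -/
def ProjRep.conj (g : G) (ρ : ProjRep (α.comap A.subtype)) : ProjRep (α.comap A.subtype) where
  V := ρ.V
  ρ a := (kappa α g a : ℂ) • ρ.ρ (conjInv g a)
  map_one := by
    have : conjInv g (1 : A) = 1 := by ext; simp [conjInv]
    rw [this, ρ.map_one]
    simp [kappa_at_one]
  map_mul a b := by
    have : conjInv g a * conjInv g b = conjInv g (a * b) := by
      ext; simp [conjInv, mul_assoc]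
    rw [smul_mul_smul_comm, ρ.map_mul, this, smul_smul, smul_smul]
    congr 1
    exact congrArg Circle.coeHom (kappa_mul α g a b)

lemma ProjRep.conj_irr (g : G) (ρ : ProjRep (α.comap A.subtype)) (h : ρ.IsIrreducible) :
    (ρ.conj g).IsIrreducible := by
  refine ⟨h.1, fun W hW => h.2 W fun a w hw => ?_⟩
  have h1 := hW (conjInv g⁻¹ a) w hw
  have h2 : conjInv g (conjInv g⁻¹ a) = a := by ext; simp [conjInv, mul_assoc]
  simp only [ProjRep.conj, h2] at h1
  exact (W.smul_mem_iff (Circle.coe_ne_zero _)).1 h1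

/-- `g · ρ` for irreducible `ρ`. -/
def IrrRep.conj (g : G) (ρ : IrrRep (α.comap A.subtype)) : IrrRep (α.comap A.subtype) :=
  ⟨ρ.toProjRep.conj g, ρ.toProjRep.conj_irr g ρ.irr⟩

/-- The action of `G` on `Irr^α(A)`. -/
instance : MulAction G (Irr (α.comap A.subtype)) where
  smul g := Quotient.map (sa := IrrRep.setoid _) (sb := IrrRep.setoid _) (IrrRep.conj g)
    fun _ _ ⟨e, he⟩ => ⟨e, fun a v => by
      change e ((kappa α g a : ℂ) • _) = (kappa α g a : ℂ) • _
      exact (map_smul e _ _).trans (congrArg _ (he _ _))⟩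
  one_smul c := by
    refine Quotient.inductionOn (s := IrrRep.setoid _) c fun ρ => ?_
    refine Quotient.sound (s := IrrRep.setoid _) ⟨LinearEquiv.refl ℂ _, fun a v => ?_⟩
    change ((kappa α 1 a : ℂ) • ρ.ρ (conjInv 1 a)) v = ρ.ρ a v
    have : conjInv 1 a = a := by ext; simp [conjInv]
    rw [this, kappa_one]; simp
  mul_smul g h c := by
    refine Quotient.inductionOn (s := IrrRep.setoid _) c fun ρ => ?_
    refine Quotient.sound (s := IrrRep.setoid _) ⟨LinearEquiv.refl ℂ _, fun a v => ?_⟩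
    change ((kappa α (g * h) a : ℂ) • ρ.ρ (conjInv (g * h) a)) v =
      ((kappa α g a : ℂ) • (kappa α h (conjInv g a) : ℂ) • ρ.ρ (conjInv h (conjInv g a))) v
    have : conjInv h (conjInv g a) = conjInv (g * h) a := by ext; simp [conjInv, mul_assoc]
    rw [this, smul_smul, ← kappa_comp]; rfl

/-- The isotropy subgroup `G_[τ]`. -/
abbrev isotropy (τ : IrrRep (α.comap A.subtype)) : Subgroup G := MulAction.stabilizer G τ.cls

lemma le_isotropy (τ : IrrRep (α.comap A.subtype)) : A ≤ isotropy τ := by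
  intro b hb
  rw [MulAction.mem_stabilizer_iff]
  refine Quotient.sound (s := IrrRep.setoid _) (a := τ.conj b) ?_
  set b' : A := ⟨b, hb⟩
  have hinv : ∀ p : TwistedGroup (α.comap A.subtype),
      τ.tilde p * τ.tilde p⁻¹ = 1 ∧ τ.tilde p⁻¹ * τ.tilde p = 1 := fun p => by
    rw [← τ.tilde_mul, ← τ.tilde_mul]; simp [τ.tilde_one]
  let p : TwistedGroup (α.comap A.subtype) := ⟨b', 1⟩
  refine ⟨LinearEquiv.ofLinearMap (τ.tilde p) (τ.tilde p⁻¹) (hinv p).1 (hinv p).2, fun a v => ?_⟩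
  change (τ.tilde p * τ.tilde ⟨conjInv b a, kappa α b a⟩) v = (τ.ρ a * τ.tilde p) v
  congr 1
  have h1 : τ.ρ a = τ.tilde ⟨a, 1⟩ := by simp [ProjRep.tilde]
  rw [h1, ← τ.tilde_mul, ← τ.tilde_mul]
  have h2 := kappa_conj α b a 1
  rw [mul_one] at h2
  congr 1
  ext1
  · exact Subtype.ext (congrArg TwistedGroup.g h2).symm
  · exact (congrArg TwistedGroup.z h2).symm

/-- The inclusion of `A` in `G_[τ]`. -/
abbrev inclIsotropy (τ : IrrRep (α.comap A.subtype)) : A →* isotropy τ :=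
  Subgroup.inclusion (le_isotropy τ)

lemma exists_intertwiner (τ : IrrRep (α.comap A.subtype)) (h : isotropy τ) :
    ∃ M : τ.V ≃ₗ[ℂ] τ.V, ∀ (a : A) (v : τ.V),
      M ((kappa α h a : ℂ) • τ.ρ (conjInv (h : G) a) v) = τ.ρ a (M v) :=
  Quotient.exact (s := IrrRep.setoid _) (a := τ.conj (h : G)) (MulAction.mem_stabilizer_iff.1 h.2)

/-- For `h ∈ G_[τ]`, a linear automorphism `M_h` of `V_τ` with `(h · τ)(a) = M_h⁻¹ τ(a) M_h`
for all `a ∈ A`. By Schur's lemma it is unique up to a nonzero scalar, and only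
expressions in which this scalar cancels are used below. -/
def intertwiner (τ : IrrRep (α.comap A.subtype)) (h : isotropy τ) : τ.V ≃ₗ[ℂ] τ.V :=
  (exists_intertwiner τ h).choose

end Action

/-! ## Equivariant vector bundles -/

section Bundles

variable {H : Type v} [Group H]

/-- The disjoint union of a family of fibres. -/
@[ext] structure FamTot {X : Type u} (fib : X → Type) : Type u where
  base : X
  vec : fib base

/-- A family of complex vector spaces over `X` with a topology on its total space and linear maps
`p : E_x → E_{p x}` for `p` in the central extension `H̃_α`. Here `H̃_α` acts on `X` through `H`,
that is, with trivial action of the circle. No axioms are imposed at this stage. -/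
structure EqFamily (α : Cocycle H) (X : Type u) [MulAction H X] where
  fib : X → Type
  [addCommGroup : ∀ x, AddCommGroup (fib x)]
  [module : ∀ x, Module ℂ (fib x)]
  top : TopologicalSpace (FamTot fib)
  act : ∀ (p : TwistedGroup α) {x y : X}, p.g • x = y → (fib x →ₗ[ℂ] fib y)

namespace EqFamily

attribute [instance] addCommGroup module

variable {α : Cocycle H} {X : Type u} [MulAction H X]

/-- The total space. -/
abbrev Tot (E : EqFamily α X) : Type u := FamTot E.fib

instance (E : EqFamily α X) : TopologicalSpace E.Tot := E.top

/-- The action on the total space. -/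
def smul (E : EqFamily α X) (p : TwistedGroup α) (t : E.Tot) : E.Tot :=
  ⟨p.g • t.base, E.act p rfl t.vec⟩

lemma tot_ext {E : EqFamily α X} {p : TwistedGroup α} {x y : X} (h : p.g • x = y)
    (e : E.fib x) : (⟨p.g • x, E.act p rfl e⟩ : E.Tot) = ⟨y, E.act p h e⟩ := by
  subst h; rfl

lemma act_congr (E : EqFamily α X) {p q : TwistedGroup α} (hpq : p = q) {x y : X}
    (h : p.g • x = y) (h' : q.g • x = y) (e : E.fib x) : E.act p h e = E.act q h' e := by
  subst hpq; rfl

/-- The family is an `H̃_α`-equivariant complex vector bundle (locally trivial of finite, locally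
constant rank) on which the circle acts by multiplication by scalars. -/
structure IsBundle [TopologicalSpace X] (E : EqFamily α X) : Prop where
  continuous_proj : Continuous fun t : E.Tot => t.base
  loc_triv : ∀ x₀ : X, ∃ U : Set X, IsOpen U ∧ x₀ ∈ U ∧
    ∃ (ι : Type) (_ : Finite ι) (e : ∀ x : U, E.fib x ≃ₗ[ℂ] (ι → ℂ)),
      Continuous (fun t : {t : E.Tot // t.base ∈ U} => e ⟨t.1.base, t.2⟩ t.1.vec) ∧
      Continuous (fun q : U × (ι → ℂ) => (⟨q.1, (e q.1).symm q.2⟩ : E.Tot))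
  act_one : ∀ (x : X) (h : (1 : TwistedGroup α).g • x = x) (e : E.fib x), E.act 1 h e = e
  act_mul : ∀ (p q : TwistedGroup α) (x y z : X) (hq : q.g • x = y) (hp : p.g • y = z)
    (hpq : (p * q).g • x = z) (e : E.fib x), E.act (p * q) hpq e = E.act p hp (E.act q hq e)
  act_circle : ∀ (z : Circle) (x : X) (h : (⟨1, z⟩ : TwistedGroup α).g • x = x) (e : E.fib x),
    E.act ⟨1, z⟩ h e = (z : ℂ) • e
  continuous_act : Continuous fun q : TwistedGroup α × E.Tot => E.smul q.1 q.2

/-- Isomorphism: a homeomorphism of total spaces over `X` that is linear on fibres and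
equivariant. -/
def Iso (E F : EqFamily α X) : Prop :=
  ∃ e : ∀ x, E.fib x ≃ₗ[ℂ] F.fib x,
    Continuous (fun t : E.Tot => (⟨t.base, e t.base t.vec⟩ : F.Tot)) ∧
    Continuous (fun t : F.Tot => (⟨t.base, (e t.base).symm t.vec⟩ : E.Tot)) ∧
    ∀ (p : TwistedGroup α) (x y : X) (h : p.g • x = y) (v : E.fib x),
      e y (E.act p h v) = F.act p h (e x v)

lemma Iso.refl (E : EqFamily α X) : E.Iso E :=
  ⟨fun _ => LinearEquiv.refl ℂ _, continuous_id, continuous_id, fun _ _ _ _ _ => rfl⟩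

lemma Iso.symm {E F : EqFamily α X} : E.Iso F → F.Iso E := fun ⟨e, h1, h2, h3⟩ =>
  ⟨fun x => (e x).symm, h2, h1, fun p x y h v => by
    rw [LinearEquiv.symm_apply_eq, h3, LinearEquiv.apply_symm_apply]⟩

lemma Iso.trans {E F K : EqFamily α X} : E.Iso F → F.Iso K → E.Iso K :=
  fun ⟨e, h1, h2, h3⟩ ⟨f, k1, k2, k3⟩ =>
    ⟨fun x => (e x).trans (f x), k1.comp h1, h2.comp k2, fun p x y h v => by
      simp only [LinearEquiv.trans_apply, h3, k3]⟩

/-- Direct sum. -/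
def sum (E F : EqFamily α X) : EqFamily α X where
  fib x := E.fib x × F.fib x
  top := .induced (fun t => ((⟨t.base, t.vec.1⟩ : E.Tot), (⟨t.base, t.vec.2⟩ : F.Tot))) inferInstance
  act p _ _ h := (E.act p h).prodMap (F.act p h)

/-- The family with all fibres zero. -/
def zero (α : Cocycle H) (X : Type u) [MulAction H X] [TopologicalSpace X] : EqFamily α X where
  fib _ := PUnit
  top := .induced FamTot.base inferInstance
  act _ _ _ _ := 0

lemma zero_proj (α : Cocycle H) (X : Type u) [MulAction H X] [TopologicalSpace X] :
    Continuous fun t : (zero α X).Tot => t.base := continuous_induced_dom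

lemma zero_mk {T : Type*} [TopologicalSpace X] [TopologicalSpace T] {g : T → (zero α X).Tot}
    (h : Continuous fun t => (g t).base) : Continuous g := continuous_induced_rng.2 h

lemma sum_fst (E F : EqFamily α X) :
    Continuous fun t : (E.sum F).Tot => (⟨t.base, t.vec.1⟩ : E.Tot) := by
  have h : Continuous fun t : (E.sum F).Tot =>
    ((⟨t.base, t.vec.1⟩ : E.Tot), (⟨t.base, t.vec.2⟩ : F.Tot)) := continuous_induced_dom
  exact continuous_fst.comp h

lemma sum_snd (E F : EqFamily α X) :
    Continuous fun t : (E.sum F).Tot => (⟨t.base, t.vec.2⟩ : F.Tot) := by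
  have h : Continuous fun t : (E.sum F).Tot =>
    ((⟨t.base, t.vec.1⟩ : E.Tot), (⟨t.base, t.vec.2⟩ : F.Tot)) := continuous_induced_dom
  exact continuous_snd.comp h

lemma sum_mk {E F : EqFamily α X} {T : Type*} [TopologicalSpace T] {g : T → (E.sum F).Tot}
    (he : Continuous fun t => (⟨(g t).base, (g t).vec.1⟩ : E.Tot))
    (hf : Continuous fun t => (⟨(g t).base, (g t).vec.2⟩ : F.Tot)) : Continuous g :=
  continuous_induced_rng.2 (he.prodMk hf)

lemma IsBundle.sum [TopologicalSpace X] {E F : EqFamily α X} (hE : E.IsBundle) (hF : F.IsBundle) :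
    (E.sum F).IsBundle where
  continuous_proj := hE.continuous_proj.comp (sum_fst E F)
  loc_triv x₀ := by
    obtain ⟨U, hU, hxU, ι, _, e, he1, he2⟩ := hE.loc_triv x₀
    obtain ⟨U', hU', hxU', ι', _, e', he1', he2'⟩ := hF.loc_triv x₀
    refine ⟨U ∩ U', hU.inter hU', ⟨hxU, hxU'⟩, ι ⊕ ι', inferInstance,
      fun x => ((e ⟨x, x.2.1⟩).prodCongr (e' ⟨x, x.2.2⟩)).trans
        (LinearEquiv.sumArrowLequivProdArrow ι ι' ℂ ℂ).symm, ?_, ?_⟩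
    · refine continuous_pi fun i => ?_
      cases i with
      | inl i =>
        have hc : Continuous fun t : {t : (E.sum F).Tot // t.base ∈ U ∩ U'} =>
            (⟨⟨t.1.base, t.1.vec.1⟩, t.2.1⟩ : {t : E.Tot // t.base ∈ U}) :=
          ((sum_fst E F).comp continuous_subtype_val).subtype_mk _
        exact (continuous_apply i).comp (he1.comp hc)
      | inr i =>
        have hc : Continuous fun t : {t : (E.sum F).Tot // t.base ∈ U ∩ U'} =>
            (⟨⟨t.1.base, t.1.vec.2⟩, t.2.2⟩ : {t : F.Tot // t.base ∈ U'}) :=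
          ((sum_snd E F).comp continuous_subtype_val).subtype_mk _
        exact (continuous_apply i).comp (he1'.comp hc)
    · refine sum_mk ?_ ?_
      · have hc : Continuous fun q : ↥(U ∩ U') × (ι ⊕ ι' → ℂ) =>
            ((⟨q.1, q.1.2.1⟩ : U), fun i => q.2 (Sum.inl i)) := by fun_prop
        exact he2.comp hc
      · have hc : Continuous fun q : ↥(U ∩ U') × (ι ⊕ ι' → ℂ) =>
            ((⟨q.1, q.1.2.2⟩ : U'), fun i => q.2 (Sum.inr i)) := by fun_prop
        exact he2'.comp hc
  act_one x h e := Prod.ext (hE.act_one x h e.1) (hF.act_one x h e.2)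
  act_mul p q x y z hq hp hpq e :=
    Prod.ext (hE.act_mul p q x y z hq hp hpq e.1) (hF.act_mul p q x y z hq hp hpq e.2)
  act_circle z x h e := Prod.ext (hE.act_circle z x h e.1) (hF.act_circle z x h e.2)
  continuous_act := sum_mk
    (hE.continuous_act.comp (continuous_fst.prodMk ((sum_fst E F).comp continuous_snd)))
    (hF.continuous_act.comp (continuous_fst.prodMk ((sum_snd E F).comp continuous_snd)))

lemma continuous_base_act [TopologicalSpace X] [ContinuousConstSMul H X] :
    Continuous fun q : TwistedGroup α × X => q.1.g • q.2 := by
  let _ : TopologicalSpace H := ⊥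
  have : DiscreteTopology H := ⟨rfl⟩
  have h1 : Continuous fun q : H × X => q.1 • q.2 :=
    continuous_prod_of_discrete_left.2 fun g => continuous_const_smul g
  have h2 : Continuous fun p : TwistedGroup α => p.g :=
    have h : Continuous fun p : TwistedGroup α => (p.g, p.z) := continuous_induced_dom
    continuous_fst.comp h
  exact h1.comp ((h2.comp continuous_fst).prodMk continuous_snd)

lemma isBundle_zero [TopologicalSpace X] [ContinuousConstSMul H X] :
    (zero α X).IsBundle where
  continuous_proj := zero_proj α X
  loc_triv x₀ := by
    refine ⟨Set.univ, isOpen_univ, trivial, PEmpty, inferInstance,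
      fun x => ⟨⟨⟨fun _ => 0, fun _ _ => by simp⟩, fun _ _ => by simp⟩, fun _ => 0,
        fun _ => rfl, fun _ => Subsingleton.elim _ _⟩, continuous_const, ?_⟩
    exact zero_mk (continuous_subtype_val.comp continuous_fst)
  act_one _ _ _ := rfl
  act_mul _ _ _ _ _ _ _ _ _ := rfl
  act_circle _ _ _ _ := rfl
  continuous_act := zero_mk <| continuous_base_act.comp
    (continuous_fst.prodMk ((zero_proj α X).comp continuous_snd))

lemma Iso.sum {E E' F F' : EqFamily α X} : E.Iso E' → F.Iso F' → (E.sum F).Iso (E'.sum F') :=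
  fun ⟨e, h1, h2, h3⟩ ⟨f, k1, k2, k3⟩ =>
    ⟨fun x => (e x).prodCongr (f x),
      sum_mk (h1.comp (sum_fst E F)) (k1.comp (sum_snd E F)),
      sum_mk (h2.comp (sum_fst E' F')) (k2.comp (sum_snd E' F')),
      fun p x y h v => Prod.ext (h3 p x y h v.1) (k3 p x y h v.2)⟩

lemma sum_comm_iso (E F : EqFamily α X) : (E.sum F).Iso (F.sum E) :=
  ⟨fun _ => LinearEquiv.prodComm ℂ _ _, sum_mk (sum_snd E F) (sum_fst E F),
    sum_mk (sum_snd F E) (sum_fst F E), fun _ _ _ _ _ => rfl⟩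

lemma sum_assoc_iso (E F K : EqFamily α X) : ((E.sum F).sum K).Iso (E.sum (F.sum K)) :=
  ⟨fun _ => LinearEquiv.prodAssoc ℂ _ _ _,
    sum_mk ((sum_fst E F).comp (sum_fst _ K))
      (sum_mk ((sum_snd E F).comp (sum_fst _ K)) (sum_snd _ K)),
    sum_mk (sum_mk (sum_fst E _) ((sum_fst F K).comp (sum_snd E _)))
      ((sum_snd F K).comp (sum_snd E _)), fun _ _ _ _ _ => rfl⟩

lemma zero_sum_iso [TopologicalSpace X] (E : EqFamily α X)
    (hE : Continuous fun t : E.Tot => t.base) : ((zero α X).sum E).Iso E :=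
  ⟨fun _ => ⟨⟨⟨Prod.snd, fun _ _ => rfl⟩, fun _ _ => rfl⟩, fun v => (PUnit.unit, v),
      fun _ => rfl, fun _ => rfl⟩,
    sum_snd _ E, sum_mk (zero_mk hE) continuous_id, fun _ _ _ _ _ => rfl⟩

end EqFamily

/-- `H̃_α`-equivariant complex vector bundles over `X` on which the circle acts by multiplication
by scalars on the fibres. -/
structure EqBundle (α : Cocycle H) (X : Type u) [TopologicalSpace X] [MulAction H X]
    extends EqFamily α X where
  isBundle : toEqFamily.IsBundle

section Vect

variable (α : Cocycle H) (X : Type u) [TopologicalSpace X] [MulAction H X]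

/-- Isomorphism of equivariant vector bundles. -/
instance EqBundle.setoid : Setoid (EqBundle α X) where
  r E F := E.toEqFamily.Iso F.toEqFamily
  iseqv := ⟨fun _ => .refl _, .symm, .trans⟩

/-- The set of isomorphism classes of `H̃_α`-equivariant vector bundles over `X` on which the
circle acts by scalars. -/
def Vect : Type _ := Quotient (EqBundle.setoid α X)

variable {α X}

/-- The isomorphism class of a bundle. -/
def EqBundle.cls (E : EqBundle α X) : Vect α X := Quotient.mk (EqBundle.setoid α X) E

/-- Direct sum of bundles. -/
def EqBundle.sum (E F : EqBundle α X) : EqBundle α X :=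
  ⟨E.toEqFamily.sum F.toEqFamily, E.isBundle.sum F.isBundle⟩

instance : Add (Vect α X) :=
  ⟨Quotient.map₂ (sa := EqBundle.setoid α X) (sb := EqBundle.setoid α X)
    (sc := EqBundle.setoid α X) EqBundle.sum fun _ _ h _ _ k => EqFamily.Iso.sum h k⟩

instance [ContinuousConstSMul H X] : Zero (Vect α X) :=
  ⟨EqBundle.cls ⟨EqFamily.zero α X, EqFamily.isBundle_zero⟩⟩

lemma EqBundle.cls_eq {E F : EqBundle α X} (h : E.toEqFamily.Iso F.toEqFamily) :
    E.cls = F.cls := Quotient.sound (s := EqBundle.setoid α X) h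

lemma Vect.ind {P : Vect α X → Prop} (h : ∀ E : EqBundle α X, P E.cls) (c : Vect α X) : P c :=
  Quotient.inductionOn (s := EqBundle.setoid α X) c h

lemma Vect.cls_add (E F : EqBundle α X) : E.cls + F.cls = (E.sum F).cls := rfl

lemma Vect.zero_add [ContinuousConstSMul H X] (a : Vect α X) : 0 + a = a := by
  induction a using Vect.ind with | _ E =>
  exact EqBundle.cls_eq (EqFamily.zero_sum_iso _ E.isBundle.continuous_proj)

lemma Vect.add_comm (a b : Vect α X) : a + b = b + a := by
  induction a using Vect.ind with | _ E =>
  induction b using Vect.ind with | _ F =>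
  exact EqBundle.cls_eq (EqFamily.sum_comm_iso _ _)

/-- Isomorphism classes form a commutative monoid under direct sum. -/
instance [ContinuousConstSMul H X] : AddCommMonoid (Vect α X) where
  add_assoc a b c := by
    induction a using Vect.ind with | _ E =>
    induction b using Vect.ind with | _ F =>
    induction c using Vect.ind with | _ K =>
    exact EqBundle.cls_eq (EqFamily.sum_assoc_iso _ _ _)
  zero_add := Vect.zero_add
  add_zero a := (Vect.add_comm a 0).trans (Vect.zero_add a)
  add_comm := Vect.add_comm
  nsmul := nsmulRec

end Vect

/-! ### Pullbacks -/

/-- Continuous equivariant maps. -/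
structure EqMap (H : Type v) [Group H] (Y X : Type u) [TopologicalSpace Y] [TopologicalSpace X]
    [MulAction H Y] [MulAction H X] where
  toFun : Y → X
  continuous : Continuous toFun
  map_smul : ∀ (h : H) (y : Y), toFun (h • y) = h • toFun y

section Pullback

variable {α : Cocycle H} {X Y : Type u} [TopologicalSpace X] [TopologicalSpace Y]
  [MulAction H X] [MulAction H Y]

/-- The pullback `f^* E`, with fibre `E_{f(y)}` at `y` and the topology of a subspace of
`Y × E`. -/
def EqFamily.pull (f : EqMap H Y X) (E : EqFamily α X) : EqFamily α Y where
  fib y := E.fib (f.toFun y)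
  top := .induced (fun t => (t.base, (⟨f.toFun t.base, t.vec⟩ : E.Tot))) inferInstance
  act p y y' h := E.act p (x := f.toFun y) (y := f.toFun y') (by rw [← h, f.map_smul])

lemma EqFamily.pull_fst (f : EqMap H Y X) (E : EqFamily α X) :
    Continuous fun t : (E.pull f).Tot => t.base := by
  have h : Continuous fun t : (E.pull f).Tot => (t.base, (⟨f.toFun t.base, t.vec⟩ : E.Tot)) :=
    continuous_induced_dom
  exact continuous_fst.comp h

lemma EqFamily.pull_snd (f : EqMap H Y X) (E : EqFamily α X) :
    Continuous fun t : (E.pull f).Tot => (⟨f.toFun t.base, t.vec⟩ : E.Tot) := by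
  have h : Continuous fun t : (E.pull f).Tot => (t.base, (⟨f.toFun t.base, t.vec⟩ : E.Tot)) :=
    continuous_induced_dom
  exact continuous_snd.comp h

lemma EqFamily.pull_mk {f : EqMap H Y X} {E : EqFamily α X} {T : Type*} [TopologicalSpace T]
    {g : T → (E.pull f).Tot} (hb : Continuous fun t => (g t).base)
    (he : Continuous fun t => (⟨f.toFun (g t).base, (g t).vec⟩ : E.Tot)) : Continuous g :=
  continuous_induced_rng.2 (hb.prodMk he)

lemma EqFamily.IsBundle.pull [ContinuousConstSMul H Y] (f : EqMap H Y X) {E : EqFamily α X}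
    (hE : E.IsBundle) : (E.pull f).IsBundle where
  continuous_proj := E.pull_fst f
  loc_triv y₀ := by
    obtain ⟨U, hU, hxU, ι, _, e, he1, he2⟩ := hE.loc_triv (f.toFun y₀)
    refine ⟨f.toFun ⁻¹' U, hU.preimage f.continuous, hxU, ι, ‹_›,
      fun y => e ⟨f.toFun y, y.2⟩, ?_, ?_⟩
    · have hc : Continuous fun t : {t : (E.pull f).Tot // t.base ∈ f.toFun ⁻¹' U} =>
          (⟨⟨f.toFun t.1.base, t.1.vec⟩, t.2⟩ : {t : E.Tot // t.base ∈ U}) :=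
        ((E.pull_snd f).comp continuous_subtype_val).subtype_mk _
      exact he1.comp hc
    · refine EqFamily.pull_mk (continuous_subtype_val.comp continuous_fst) ?_
      have hc : Continuous fun q : ↥(f.toFun ⁻¹' U) × (ι → ℂ) =>
          ((⟨f.toFun q.1, q.1.2⟩ : U), q.2) :=
        ((f.continuous.comp (continuous_subtype_val.comp continuous_fst)).subtype_mk _).prodMk
          continuous_snd
      exact he2.comp hc
  act_one y _ e := hE.act_one _ _ e
  act_mul p q _ _ _ _ _ _ e := hE.act_mul p q _ _ _ _ _ _ e
  act_circle z _ _ e := hE.act_circle z _ _ e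
  continuous_act := by
    refine EqFamily.pull_mk
      (continuous_base_act.comp (continuous_fst.prodMk ((E.pull_fst f).comp continuous_snd))) ?_
    refine (hE.continuous_act.comp
      (continuous_fst.prodMk ((E.pull_snd f).comp continuous_snd))).congr fun q => ?_
    exact EqFamily.tot_ext _ _

/-- The pullback of a bundle. -/
def EqBundle.pull [ContinuousConstSMul H Y] (f : EqMap H Y X) (E : EqBundle α X) : EqBundle α Y :=
  ⟨E.toEqFamily.pull f, E.isBundle.pull f⟩

lemma EqFamily.Iso.pull (f : EqMap H Y X) {E F : EqFamily α X} :
    E.Iso F → (E.pull f).Iso (F.pull f) := fun ⟨e, h1, h2, h3⟩ =>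
  ⟨fun y => e (f.toFun y), pull_mk (E.pull_fst f) (h1.comp (E.pull_snd f)),
    pull_mk (F.pull_fst f) (h2.comp (F.pull_snd f)), fun p _ _ _ v => h3 p _ _ _ v⟩

lemma EqFamily.pull_sum_iso (f : EqMap H Y X) (E F : EqFamily α X) :
    ((E.sum F).pull f).Iso ((E.pull f).sum (F.pull f)) :=
  ⟨fun _ => LinearEquiv.refl ℂ _,
    sum_mk (pull_mk (pull_fst _ _) ((sum_fst E F).comp (pull_snd _ _)))
      (pull_mk (pull_fst _ _) ((sum_snd E F).comp (pull_snd _ _))),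
    pull_mk ((pull_fst f E).comp (sum_fst _ _))
      (sum_mk ((pull_snd f E).comp (sum_fst (E.pull f) (F.pull f)))
        ((pull_snd f F).comp (sum_snd (E.pull f) (F.pull f)))),
    fun _ _ _ _ _ => rfl⟩

lemma EqFamily.pull_zero_iso (f : EqMap H Y X) :
    ((EqFamily.zero α X).pull f).Iso (EqFamily.zero α Y) :=
  ⟨fun _ => LinearEquiv.refl ℂ _, zero_mk (pull_fst f _),
    pull_mk (zero_proj α Y) (zero_mk (f.continuous.comp (zero_proj α Y))),
    fun _ _ _ _ _ => rfl⟩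

variable [ContinuousConstSMul H X] [ContinuousConstSMul H Y]

/-- Pullback of isomorphism classes. -/
def Vect.pull (f : EqMap H Y X) : Vect α X →+ Vect α Y where
  toFun := Quotient.map (sa := EqBundle.setoid α X) (sb := EqBundle.setoid α Y)
    (EqBundle.pull f) fun _ _ h => EqFamily.Iso.pull f h
  map_zero' := EqBundle.cls_eq (EqFamily.pull_zero_iso f)
  map_add' a b := by
    induction a using Vect.ind with | _ E =>
    induction b using Vect.ind with | _ F =>
    exact EqBundle.cls_eq (EqFamily.pull_sum_iso f E.toEqFamily F.toEqFamily)

end Pullback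

/-! ### Equivariant K-theory in degree zero -/

/-- The homomorphism of Grothendieck groups induced by a homomorphism of monoids. -/
def grMap {M N : Type*} [AddCommMonoid M] [AddCommMonoid N] (φ : M →+ N) :
    Algebra.GrothendieckAddGroup M →+ Algebra.GrothendieckAddGroup N :=
  Algebra.GrothendieckAddGroup.lift (Algebra.GrothendieckAddGroup.of.comp φ)

lemma grMap_of {M N : Type*} [AddCommMonoid M] [AddCommMonoid N] (φ : M →+ N) (m : M) :
    grMap φ (Algebra.GrothendieckAddGroup.of m) = Algebra.GrothendieckAddGroup.of (φ m) :=
  DFunLike.congr_fun (Algebra.GrothendieckAddGroup.lift.symm_apply_apply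
    (Algebra.GrothendieckAddGroup.of.comp φ)) m

lemma grMap_comp {M N P : Type*} [AddCommMonoid M] [AddCommMonoid N] [AddCommMonoid P]
    (φ : M →+ N) (ψ : N →+ P) (χ : M →+ P) (h : ∀ m, ψ (φ m) = χ m)
    (c : Algebra.GrothendieckAddGroup M) : grMap ψ (grMap φ c) = grMap χ c := by
  suffices (grMap ψ).comp (grMap φ) = grMap χ from DFunLike.congr_fun this c
  apply Algebra.GrothendieckAddGroup.lift.symm.injective
  ext m
  change grMap ψ (grMap φ (Algebra.GrothendieckAddGroup.of m)) =
    grMap χ (Algebra.GrothendieckAddGroup.of m)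
  rw [grMap_of, grMap_of, grMap_of, h]

/-- Composition of equivariant maps. -/
def EqMap.comp {X Y Z : Type u} [TopologicalSpace X] [TopologicalSpace Y] [TopologicalSpace Z]
    [MulAction H X] [MulAction H Y] [MulAction H Z] (f : EqMap H Y X) (g : EqMap H Z Y) :
    EqMap H Z X where
  toFun := f.toFun ∘ g.toFun
  continuous := f.continuous.comp g.continuous
  map_smul h z := by simp [g.map_smul, f.map_smul]

/-- The map `f`, regarded as equivariant for a subgroup only. -/
def EqMap.res {X Y : Type u} [TopologicalSpace X] [TopologicalSpace Y]
    [MulAction H X] [MulAction H Y] (f : EqMap H Y X) (S : Subgroup H) : EqMap S Y X where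
  toFun := f.toFun
  continuous := f.continuous
  map_smul h y := f.map_smul h y

lemma Vect.pull_comp {α : Cocycle H} {X Y Z : Type u} [TopologicalSpace X] [TopologicalSpace Y]
    [TopologicalSpace Z] [MulAction H X] [MulAction H Y] [MulAction H Z]
    [ContinuousConstSMul H X] [ContinuousConstSMul H Y] [ContinuousConstSMul H Z]
    (f : EqMap H Y X) (g : EqMap H Z Y) (c : Vect α X) :
    Vect.pull g (Vect.pull f c) = Vect.pull (f.comp g) c := by
  induction c using Vect.ind with | _ E =>
  refine EqBundle.cls_eq ⟨fun _ => LinearEquiv.refl ℂ _, ?_, ?_, fun _ _ _ _ _ => rfl⟩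
  · exact EqFamily.pull_mk (EqFamily.pull_fst g _)
      ((EqFamily.pull_snd f E.toEqFamily).comp (EqFamily.pull_snd g _))
  · exact EqFamily.pull_mk (EqFamily.pull_fst (f.comp g) _)
      (EqFamily.pull_mk (g.continuous.comp (EqFamily.pull_fst (f.comp g) _))
        (EqFamily.pull_snd (f.comp g) E.toEqFamily))

/-- `^αK_H^0(X)`: the Grothendieck group of the monoid of isomorphism classes of
`H̃_α`-equivariant vector bundles over `X` on which the circle acts by scalars. -/
abbrev K0 (α : Cocycle H) (X : Type u) [TopologicalSpace X] [MulAction H X]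
    [ContinuousConstSMul H X] : Type _ := Algebra.GrothendieckAddGroup (Vect α X)

/-- The class `[E]` in K-theory. -/
def K0.cls {α : Cocycle H} {X : Type u} [TopologicalSpace X] [MulAction H X]
    [ContinuousConstSMul H X] (E : EqBundle α X) : K0 α X :=
  Algebra.GrothendieckAddGroup.of E.cls

/-! ### Isotypic bundles -/

section Isotypic

variable {N : Type*} [Group N] {α : Cocycle H} (j : N →* H) (ρ : ProjRep (α.comap j))
  {X : Type u} [MulAction H X] (hX : ∀ (n : N) (x : X), j n • x = x)

/-- The space `Hom_{Ñ_α}(V_ρ, E_x)` of `Ñ_α`-equivariant linear maps from `V_ρ` to the fibre of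
`E` at `x`. Here `N` maps to `H` by `j` and acts trivially on `X`. -/
def HomSub (E : EqFamily α X) (x : X) : Submodule ℂ (ρ.V →ₗ[ℂ] E.fib x) where
  carrier := {f | ∀ (p : TwistedGroup (α.comap j)) (v : ρ.V),
    E.act (p.map j) (hX p.g x) (f v) = f (ρ.tilde p v)}
  add_mem' hf hg p v := by simp [hf p v, hg p v]
  zero_mem' p v := by simp
  smul_mem' c f hf p v := by simp [hf p v]

/-- The map `γ : V_ρ ⊗ Hom_{Ñ_α}(V_ρ, E_x) → E_x`, `v ⊗ f ↦ f(v)`. -/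
def gamma (E : EqFamily α X) (x : X) : ρ.V ⊗[ℂ] HomSub j ρ hX E x →ₗ[ℂ] E.fib x :=
  TensorProduct.lift (LinearMap.flip (HomSub j ρ hX E x).subtype)

/-- The condition for `E` to be an `(H̃_α, ρ)`-equivariant bundle: `γ` is an isomorphism. (A map
of vector bundles is an isomorphism as soon as it is bijective on each fibre.) -/
def IsIsotypic (E : EqFamily α X) : Prop :=
  ∀ x, Function.Bijective (gamma j ρ hX E x)

lemma gamma_tmul (E : EqFamily α X) (x : X) (v : ρ.V) (f : HomSub j ρ hX E x) :
    gamma j ρ hX E x (v ⊗ₜ f) = f.1 v := rfl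

lemma IsIsotypic.zero [TopologicalSpace X] : IsIsotypic j ρ hX (EqFamily.zero α X) := by
  intro x
  have hs : Subsingleton (HomSub j ρ hX (EqFamily.zero α X) x) :=
    ⟨fun f g => Subtype.ext (LinearMap.ext fun v => rfl)⟩
  refine ⟨fun s t _ => ?_, fun e => ⟨0, rfl⟩⟩
  have h0 : ∀ s : ρ.V ⊗[ℂ] HomSub j ρ hX (EqFamily.zero α X) x, s = 0 := fun s => by
    induction s with
    | zero => rfl
    | tmul v f => rw [Subsingleton.elim f 0, TensorProduct.tmul_zero]
    | add a b ha hb => rw [ha, hb, add_zero]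
  rw [h0 s, h0 t]

lemma IsIsotypic.sum {E F : EqFamily α X} (hE : IsIsotypic j ρ hX E) (hF : IsIsotypic j ρ hX F) :
    IsIsotypic j ρ hX (E.sum F) := by
  intro x
  let p₁ : HomSub j ρ hX (E.sum F) x →ₗ[ℂ] HomSub j ρ hX E x :=
    { toFun := fun f => ⟨LinearMap.fst ℂ _ _ ∘ₗ f.1, fun p v => congrArg Prod.fst (f.2 p v)⟩
      map_add' := fun _ _ => rfl
      map_smul' := fun _ _ => rfl }
  let p₂ : HomSub j ρ hX (E.sum F) x →ₗ[ℂ] HomSub j ρ hX F x :=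
    { toFun := fun f => ⟨LinearMap.snd ℂ _ _ ∘ₗ f.1, fun p v => congrArg Prod.snd (f.2 p v)⟩
      map_add' := fun _ _ => rfl
      map_smul' := fun _ _ => rfl }
  let i₁ : HomSub j ρ hX E x →ₗ[ℂ] HomSub j ρ hX (E.sum F) x :=
    { toFun := fun f => ⟨LinearMap.inl ℂ _ _ ∘ₗ f.1,
        fun p v => Prod.ext (f.2 p v) (map_zero (F.act (p.map j) (hX p.g x)))⟩
      map_add' := fun f g => Subtype.ext (LinearMap.comp_add _ _ _)
      map_smul' := fun c f => Subtype.ext (LinearMap.comp_smul _ _ _) }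
  let i₂ : HomSub j ρ hX F x →ₗ[ℂ] HomSub j ρ hX (E.sum F) x :=
    { toFun := fun f => ⟨LinearMap.inr ℂ _ _ ∘ₗ f.1,
        fun p v => Prod.ext (map_zero (E.act (p.map j) (hX p.g x))) (f.2 p v)⟩
      map_add' := fun f g => Subtype.ext (LinearMap.comp_add _ _ _)
      map_smul' := fun c f => Subtype.ext (LinearMap.comp_smul _ _ _) }
  have hi : ∀ f, i₁ (p₁ f) + i₂ (p₂ f) = f := fun f =>
    Subtype.ext (LinearMap.ext fun v => Prod.ext (add_zero _) (zero_add _))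
  have hp₁ : ∀ s, gamma j ρ hX E x (p₁.lTensor ρ.V s) = (gamma j ρ hX (E.sum F) x s).1 :=
    fun s => by
      induction s with
      | zero => simp; rfl
      | tmul v f => rfl
      | add a b ha hb => rw [map_add, map_add, map_add, ha, hb]; rfl
  have hp₂ : ∀ s, gamma j ρ hX F x (p₂.lTensor ρ.V s) = (gamma j ρ hX (E.sum F) x s).2 :=
    fun s => by
      induction s with
      | zero => simp; rfl
      | tmul v f => rfl
      | add a b ha hb => rw [map_add, map_add, map_add, ha, hb]; rfl
  have hs : ∀ s, i₁.lTensor ρ.V (p₁.lTensor ρ.V s) + i₂.lTensor ρ.V (p₂.lTensor ρ.V s) = s :=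
    fun s => by
      induction s with
      | zero => simp
      | tmul v f => rw [LinearMap.lTensor_tmul, LinearMap.lTensor_tmul, LinearMap.lTensor_tmul,
          LinearMap.lTensor_tmul, ← TensorProduct.tmul_add, hi]
      | add a b ha hb =>
        conv_rhs => rw [← ha, ← hb]
        simp only [map_add]; abel
  have hi₁ : ∀ s, gamma j ρ hX (E.sum F) x (i₁.lTensor ρ.V s) = (gamma j ρ hX E x s, 0) :=
    fun s => by
      induction s with
      | zero => simp; rfl
      | tmul v f => rfl
      | add a b ha hb => rw [map_add, map_add, map_add, ha, hb]; exact Prod.ext rfl (add_zero _)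
  have hi₂ : ∀ s, gamma j ρ hX (E.sum F) x (i₂.lTensor ρ.V s) = (0, gamma j ρ hX F x s) :=
    fun s => by
      induction s with
      | zero => simp; rfl
      | tmul v f => rfl
      | add a b ha hb => rw [map_add, map_add, map_add, ha, hb]; exact Prod.ext (add_zero _) rfl
  refine ⟨fun s t hst => ?_, fun e => ?_⟩
  · rw [← hs s, ← hs t, (hE x).1 ((hp₁ s).trans ((congrArg Prod.fst hst).trans (hp₁ t).symm)),
      (hF x).1 ((hp₂ s).trans ((congrArg Prod.snd hst).trans (hp₂ t).symm))]
  · obtain ⟨s, hs⟩ := (hE x).2 e.1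
    obtain ⟨t, ht⟩ := (hF x).2 e.2
    refine ⟨i₁.lTensor ρ.V s + i₂.lTensor ρ.V t, ?_⟩
    rw [map_add, hi₁, hi₂, hs, ht]
    exact Prod.ext (add_zero _) (zero_add _)

/-- The monoid `Vect_{H̃_α, ρ}(X)` of isomorphism classes of `(H̃_α, ρ)`-equivariant vector
bundles. -/
def VectIso (X : Type u) [TopologicalSpace X] [MulAction H X] [ContinuousConstSMul H X]
    (hX : ∀ (n : N) (x : X), j n • x = x) : AddSubmonoid (Vect α X) where
  carrier := {c | ∃ E : EqBundle α X, IsIsotypic j ρ hX E.toEqFamily ∧ E.cls = c}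
  add_mem' := by
    rintro _ _ ⟨E, hE, rfl⟩ ⟨F, hF, rfl⟩
    exact ⟨E.sum F, hE.sum j ρ hX hF, rfl⟩
  zero_mem' := ⟨⟨EqFamily.zero α X, EqFamily.isBundle_zero⟩, .zero j ρ hX, rfl⟩

/-- Pullback of isomorphism classes of `(H̃_α, ρ)`-equivariant bundles. -/
def VectIso.pull {X Y : Type u} [TopologicalSpace X] [MulAction H X] [ContinuousConstSMul H X]
    [TopologicalSpace Y] [MulAction H Y] [ContinuousConstSMul H Y]
    (hX : ∀ (n : N) (x : X), j n • x = x) (hY : ∀ (n : N) (y : Y), j n • y = y)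
    (f : EqMap H Y X) : VectIso j ρ X hX →+ VectIso j ρ Y hY :=
  ((Vect.pull f).comp (VectIso j ρ X hX).subtype).codRestrict (VectIso j ρ Y hY) <| by
    rintro ⟨_, E, hE, rfl⟩
    exact ⟨E.pull f, fun y => hE (f.toFun y), rfl⟩

end Isotypic

end Bundles

/-! ## Spaces, suspensions and the graded K-groups -/

/-- A topological space with an action of the discrete group `G` by homeomorphisms such that the
subgroup `A` acts trivially. -/
structure GSpace (G : Type v) [Group G] (A : Subgroup G) where
  carrier : Type u
  [top : TopologicalSpace carrier]
  [action : MulAction G carrier]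
  [cont : ContinuousConstSMul G carrier]
  triv : ∀ a ∈ A, ∀ x : carrier, a • x = x

namespace GSpace

attribute [instance] top action cont

instance {G : Type v} [Group G] {A : Subgroup G} : CoeSort (GSpace.{u, v} G A) (Type u) :=
  ⟨GSpace.carrier⟩

variable {G : Type v} [Group G] {A : Subgroup G}

/-- The one-point space. -/
def pt (G : Type v) [Group G] (A : Subgroup G) : GSpace.{u, v} G A where
  carrier := PUnit
  triv _ _ _ := rfl

/-- The relation on `X₊ × Iⁿ` which collapses `X₊ × ∂Iⁿ ∪ {+} × Iⁿ` to a point. Here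
`X₊ = X ⊔ {+}`. -/
def suspSetoid (X : Type u) (n : ℕ) : Setoid ((X ⊕ PUnit.{u + 1}) × (Fin n → unitInterval)) where
  r p q := p = q ∨ ((p.1 = Sum.inr PUnit.unit ∨ p.2 ∈ Cube.boundary (Fin n)) ∧
    (q.1 = Sum.inr PUnit.unit ∨ q.2 ∈ Cube.boundary (Fin n)))
  iseqv := ⟨fun _ => Or.inl rfl, by
      rintro p q (h | h)
      · exact Or.inl h.symm
      · exact Or.inr ⟨h.2, h.1⟩, by
      rintro p q r (rfl | h) (rfl | k)
      · exact Or.inl rfl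
      · exact Or.inr k
      · exact Or.inr h
      · exact Or.inr ⟨h.1, k.2⟩⟩

/-- The `n`-fold reduced suspension `Σⁿ X₊` of `X₊`, as the quotient of `X₊ × Iⁿ` by
`X₊ × ∂Iⁿ ∪ {+} × Iⁿ`. -/
def Susp (X : Type u) (n : ℕ) : Type u := Quotient (suspSetoid X n)

instance (X : Type u) [TopologicalSpace X] (n : ℕ) : TopologicalSpace (Susp X n) :=
  inferInstanceAs (TopologicalSpace (Quotient (suspSetoid X n)))

/-- The map of suspensions induced by a map of spaces. -/
def Susp.map {X Y : Type u} (n : ℕ) (f : Y → X) : Susp Y n → Susp X n :=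
  Quotient.map (sa := suspSetoid Y n) (sb := suspSetoid X n)
    (fun p => (Sum.map f id p.1, p.2)) <| by
    rintro p q (rfl | h)
    · exact Or.inl rfl
    · refine Or.inr ⟨h.1.imp (fun h => ?_) id, h.2.imp (fun h => ?_) id⟩ <;> simp [h]

lemma Susp.ind {X : Type u} {n : ℕ} {P : Susp X n → Prop}
    (h : ∀ p, P (Quotient.mk (suspSetoid X n) p)) (s : Susp X n) : P s :=
  Quotient.inductionOn (s := suspSetoid X n) s h

lemma Susp.map_map {X Y Z : Type u} (n : ℕ) (f : Y → X) (g : Z → Y) (s : Susp Z n) :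
    Susp.map n f (Susp.map n g s) = Susp.map n (f ∘ g) s := by
  induction s using Susp.ind with | _ p =>
  obtain ⟨x | x, t⟩ := p <;> rfl

lemma Susp.map_id {X : Type u} (n : ℕ) (s : Susp X n) : Susp.map n id s = s := by
  induction s using Susp.ind with | _ p =>
  obtain ⟨x | x, t⟩ := p <;> rfl

lemma Susp.continuous_map {X Y : Type u} [TopologicalSpace X] [TopologicalSpace Y] (n : ℕ)
    {f : Y → X} (hf : Continuous f) : Continuous (Susp.map n f) :=
  continuous_quot_mk.comp
    (((hf.sumMap continuous_id).comp continuous_fst).prodMk continuous_snd) |>.quotient_lift _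

instance suspAction (X : GSpace.{u, v} G A) (n : ℕ) : MulAction G (Susp X n) where
  smul := fun g => Susp.map n (g • ·)
  one_smul := fun s => by
    change Susp.map n _ s = s
    have : (fun x : X => (1 : G) • x) = id := funext fun x => one_smul G x
    rw [this, Susp.map_id]
  mul_smul := fun g h s => by
    change Susp.map n _ s = Susp.map n _ (Susp.map n _ s)
    rw [Susp.map_map]
    congr 1
    exact funext fun x => mul_smul g h x

/-- `Σⁿ X₊` as a `G`-space. -/
def susp (X : GSpace.{u, v} G A) (n : ℕ) : GSpace.{u, v} G A where
  carrier := Susp X n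
  action := suspAction X n
  cont := ⟨fun g => Susp.continuous_map n (continuous_const_smul g)⟩
  triv a ha s := by
    change Susp.map n _ s = s
    have : (fun x : X => a • x) = id := funext fun x => X.triv a ha x
    rw [this, Susp.map_id]

/-- The inclusion of the base point of `Σⁿ X₊`. -/
def base (X : GSpace.{u, v} G A) (n : ℕ) : EqMap G (pt.{u} G A) (X.susp n) where
  toFun _ := Quotient.mk (suspSetoid X n) (Sum.inr PUnit.unit, 0)
  continuous := continuous_const
  map_smul _ _ := rfl

/-- The map `Σⁿ f₊`. -/
def suspMap {X Y : GSpace.{u, v} G A} (f : EqMap G Y X) (n : ℕ) :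
    EqMap G (Y.susp n) (X.susp n) where
  toFun := Susp.map n f.toFun
  continuous := Susp.continuous_map n f.continuous
  map_smul g s := by
    change Susp.map n _ (Susp.map n _ s) = Susp.map n _ (Susp.map n _ s)
    refine (Susp.map_map n _ _ s).trans (Eq.trans ?_ (Susp.map_map n _ _ s).symm)
    congr 1
    exact funext fun y => f.map_smul g y

/-- The space whose (reduced, if `n > 0`) K-group of degree zero is the K-group of `X` in degree
`n`: it is `X` for `n = 0`, and `Σⁿ X₊` for `n > 0`. -/
def deg (X : GSpace.{u, v} G A) : ℕ → GSpace.{u, v} G A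
  | 0 => X
  | n + 1 => X.susp (n + 1)

/-- The map induced by `f` on the spaces `deg`. -/
def degMap {X Y : GSpace.{u, v} G A} (f : EqMap G Y X) : ∀ n : ℕ, EqMap G (Y.deg n) (X.deg n)
  | 0 => f
  | n + 1 => suspMap f (n + 1)

lemma suspMap_base {X Y : GSpace.{u, v} G A} (f : EqMap G Y X) (n : ℕ) :
    (suspMap f n).comp (Y.base n) = X.base n := rfl

end GSpace

section KGroups

variable {G : Type v} [Group G] {A : Subgroup G}

/-- Pullback in K-theory. -/
def K0.pull (α : Cocycle G) {X Y : GSpace.{u, v} G A} (f : EqMap G Y X) : K0 α X →+ K0 α Y :=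
  grMap (Vect.pull f)

/-- `^αK_G^n(X)` for `n ≥ 0`: this is `^αK_G^0(X)` if `n = 0`. If `n > 0` it is the reduced group
of `Σⁿ X₊`, that is, the kernel of the restriction from `^αK_G^0(Σⁿ X₊)` to the base point. -/
def KGroup (α : Cocycle G) (X : GSpace.{u, v} G A) : ∀ n : ℕ, AddSubgroup (K0 α (X.deg n))
  | 0 => ⊤
  | n + 1 => (K0.pull α (X.base (n + 1))).ker

/-- The homomorphism `f^* : ^αK_G^n(X) → ^αK_G^n(Y)`. -/
def KGroup.map (α : Cocycle G) {X Y : GSpace.{u, v} G A} (f : EqMap G Y X) (n : ℕ) :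
    KGroup α X n →+ KGroup α Y n :=
  ((K0.pull α (GSpace.degMap f n)).comp (KGroup α X n).subtype).codRestrict (KGroup α Y n) <| by
    rintro ⟨c, hc⟩
    cases n with
    | zero => trivial
    | succ n =>
      refine AddMonoidHom.mem_ker.2 (Eq.trans ?_ (AddMonoidHom.mem_ker.1 hc))
      exact grMap_comp _ _ _ (fun m => Vect.pull_comp _ _ m) c

lemma triv_subtype (X : GSpace.{u, v} G A) (a : A) (x : X) : A.subtype a • x = x :=
  X.triv a a.2 x

instance (X : GSpace.{u, v} G A) (S : Subgroup G) : ContinuousConstSMul S X :=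
  ⟨fun s => continuous_const_smul (s : G)⟩

variable [A.Normal] {α : Cocycle G} (τ : IrrRep (α.comap A.subtype))

lemma isotropy_triv (X : GSpace.{u, v} G A) (a : A) (x : X) : inclIsotropy τ a • x = x :=
  X.triv a a.2 x

/-- `((G̃_[τ])_α, τ)`-equivariant vector bundles over `X`. -/
structure IsotypicBundle (X : GSpace.{u, v} G A) extends
    EqBundle (α.comap (isotropy τ).subtype) X where
  isotypic : IsIsotypic (α := α.comap (isotropy τ).subtype) (inclIsotropy τ) τ.toProjRep (isotropy_triv τ X) toEqFamily

/-- The monoid of isomorphism classes of `((G̃_[τ])_α, τ)`-equivariant vector bundles. -/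
abbrev VectT (X : GSpace.{u, v} G A) : AddSubmonoid (Vect (α.comap (isotropy τ).subtype) X) :=
  VectIso (α := α.comap (isotropy τ).subtype) (inclIsotropy τ) τ.toProjRep X (isotropy_triv τ X)

/-- `K^0_{(G̃_[τ])_α, τ}(X)`. -/
abbrev KT0 (X : GSpace.{u, v} G A) : Type _ := Algebra.GrothendieckAddGroup (VectT τ X)

/-- The class of a `((G̃_[τ])_α, τ)`-equivariant vector bundle in K-theory. -/
def KT0.cls {τ : IrrRep (α.comap A.subtype)} {X : GSpace.{u, v} G A} (F : IsotypicBundle τ X) :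
    KT0 τ X :=
  Algebra.GrothendieckAddGroup.of ⟨F.toEqBundle.cls, F.toEqBundle, F.isotypic, rfl⟩

/-- Pullback in K-theory. -/
def KT0.pull {X Y : GSpace.{u, v} G A} (f : EqMap G Y X) : KT0 τ X →+ KT0 τ Y :=
  grMap (VectIso.pull (α := α.comap (isotropy τ).subtype) (inclIsotropy τ) τ.toProjRep (isotropy_triv τ X) (isotropy_triv τ Y)
    (f.res (isotropy τ)))

/-- `K^n_{(G̃_[τ])_α, τ}(X)` for `n ≥ 0`: this is `K^0_{(G̃_[τ])_α, τ}(X)` if `n = 0`, and the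
reduced group of `Σⁿ X₊` if `n > 0`. -/
def KTGroup (X : GSpace.{u, v} G A) : ∀ n : ℕ, AddSubgroup (KT0 τ (X.deg n))
  | 0 => ⊤
  | n + 1 => (KT0.pull τ (X.base (n + 1))).ker

/-- The homomorphism `f^*` in `((G̃_[τ])_α, τ)`-equivariant K-theory. -/
def KTGroup.map {X Y : GSpace.{u, v} G A} (f : EqMap G Y X) (n : ℕ) :
    KTGroup τ X n →+ KTGroup τ Y n :=
  ((KT0.pull τ (GSpace.degMap f n)).comp (KTGroup τ X n).subtype).codRestrict (KTGroup τ Y n) <| by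
    rintro ⟨c, hc⟩
    cases n with
    | zero => trivial
    | succ n =>
      refine AddMonoidHom.mem_ker.2 (Eq.trans ?_ (AddMonoidHom.mem_ker.1 hc))
      exact grMap_comp _ _ _ (fun m => Subtype.ext (Vect.pull_comp _ _ m.1)) c

/-! ## The bundle `V_τ ⊗ Hom(V_τ, E)` -/

/-- The space `Hom_{Ã_α}(V_τ, E_x)`. -/
abbrev HomA {X : GSpace.{u, v} G A} (E : EqBundle α X) (x : X) :
    Submodule ℂ (τ.V →ₗ[ℂ] E.fib x) :=
  HomSub A.subtype τ.toProjRep (triv_subtype X) E.toEqFamily x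

/-- The action of `p = (h, z)` in `(G̃_[τ])_α` on the spaces `Hom_{Ã_α}(V_τ, E_x)`:
`(p • f)(w) = p f(M_h⁻¹ w)`. -/
def homAct {X : GSpace.{u, v} G A} (E : EqBundle α X)
    (p : TwistedGroup (α.comap (isotropy τ).subtype)) {x y : X} (h : p.g • x = y) :
    HomA τ E x →ₗ[ℂ] HomA τ E y where
  toFun f := ⟨E.act (p.map (isotropy τ).subtype) h ∘ₗ f.1 ∘ₗ (intertwiner τ p.g).symm.toLinearMap,
    fun q v => by
      set M := intertwiner τ p.g with hM
      let q' : TwistedGroup (α.comap A.subtype) :=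
        ⟨conjInv (p.g : G) q.g, kappa α (p.g : G) q.g * q.z⟩
      have e1 : q.map A.subtype * p.map (isotropy τ).subtype =
          p.map (isotropy τ).subtype * q'.map A.subtype :=
        kappa_conj' α (p.g : G) (q.g : G) q.z p.z
      have hxy : (p.g : G) • x = y := h
      have e2 : M.symm (τ.tilde q v) = τ.tilde q' (M.symm v) := by
        rw [LinearEquiv.symm_apply_eq]
        have := (exists_intertwiner τ p.g).choose_spec q.g (M.symm v)
        change M _ = τ.ρ q.g (M (M.symm v)) at this
        rw [LinearEquiv.apply_symm_apply] at this
        change (q.z : ℂ) • τ.ρ q.g v =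
          M (((kappa α (p.g : G) q.g * q.z : Circle) : ℂ) • τ.ρ (conjInv (p.g : G) q.g) (M.symm v))
        rw [← this, ← map_smul, smul_smul, Circle.coe_mul, mul_comm]
      have hq : (q.map A.subtype * p.map (isotropy τ).subtype).g • x = y := by
        rw [TwistedGroup.mul_g, mul_smul]
        exact (congrArg _ hxy).trans (X.triv _ q.g.2 y)
      have hp : (p.map (isotropy τ).subtype * q'.map A.subtype).g • x = y := e1 ▸ hq
      change E.act (q.map A.subtype) _ (E.act (p.map (isotropy τ).subtype) h (f.1 (M.symm v))) =
        E.act (p.map (isotropy τ).subtype) h (f.1 (M.symm (τ.tilde q v)))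
      rw [e2, ← f.2 q' (M.symm v)]
      exact (E.isBundle.act_mul _ _ _ _ _ _ _ hq _).symm.trans
        ((E.act_congr e1 hq hp _).trans (E.isBundle.act_mul _ _ _ _ _ _ _ hp _))⟩
  map_add' f g := Subtype.ext (LinearMap.ext fun v => by simp)
  map_smul' c f := Subtype.ext (LinearMap.ext fun v => by simp)

/-- The family `V_τ ⊗ Hom_{Ã_α}(V_τ, E)` with the action
`(h, z) ⋆ (v ⊗ f) = M_h v ⊗ (h, z) • f` of `(G̃_[τ])_α`. Its topology, that of a subbundle of the
bundle `V_τ ⊗ Hom(V_τ, E)`, is the coarsest one for which all the maps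
`v' ⊗ f ↦ φ(v') f(v)` to `E` with `φ ∈ V_τ^*` and `v ∈ V_τ` are continuous. -/
def tensorHom {X : GSpace.{u, v} G A} (E : EqBundle α X) :
    EqFamily (α.comap (isotropy τ).subtype) X where
  fib x := τ.V ⊗[ℂ] HomA τ E x
  top := .induced (fun (t : FamTot fun x => τ.V ⊗[ℂ] HomA τ E x)
      (a : Module.Dual ℂ τ.V × τ.V) =>
    (⟨t.base, (TensorProduct.lid ℂ _ (a.1.rTensor _ t.vec) : HomA τ E t.base).1 a.2⟩ : E.Tot))
    inferInstance
  act p _ _ h := TensorProduct.map (intertwiner τ p.g).toLinearMap (homAct τ E p h)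

end KGroups

end TwK

end

/-! On each fibre of `E` the finite group `A` acts by an `α`-representation, so the fibre is the sum
of its isotypic components. The component of a class `c` is cut out by `isoProj c`, a linear
combination of the operators of `A` whose coefficients `Irr.coef` (a multiple of the traces of the
inverse operators) depend neither on the bundle nor on the point. Hence these projectors vary
continuously, commute with bundle maps (`Intertwines.proj`), are orthogonal (`proj_comp_proj`) and
sum to the identity (`IsRep.sum_proj`). An element `g` of `G` carries the component of `c` to that
of `g • c` (`act_isoProj`).

The evaluation `gamma` identifies `V_τ ⊗ Hom(V_τ, E_x)` with the component of `[τ]`; `delta` gives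
the inverse. In other words `tensorHom τ E` is a direct summand of `E` with projector `isoProj
τ.cls` (`tensorSplit`, `tensorSplit_idem`). A summand of a bundle is a bundle
(`Splitting.isBundle`), and a summand is determined up to isomorphism by its projector
(`Splitting.iso`). This makes `tensorHom` a bundle, isotypic, invariant under isomorphism, additive
and compatible with pullback: in each case only two projectors have to be compared.

Since `G` permutes the components, `E` can be recovered from the components of one representative
`τ` per orbit, each with the action of the extension of its isotropy group. Isomorphisms of these
components extend to an isomorphism of the bundles by averaging conjugates over `G` (`glue`,
`iso_of_tensorHom_iso`). Conversely, the bundle induced from an isotypic bundle `F` has `F` as its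
component of `[τ]` and vanishing components outside the orbit of `[τ]` (`tensorMap_ind`,
`tensorMap_ind_of_ne`). So the monoid of `G`-bundles is the product of the monoids of isotypic
bundles (`bijective_tensorMap`).

Passing to Grothendieck groups preserves finite products (`bijective_grMap_pi`), and the orbits are
finite in number because the `Irr.coef` are linearly independent. In positive degree, naturality for
the base point matches the kernels. -/

noncomputable section

namespace TwK

/-! ### Schur orthogonality and isotypic projectors for projective representations -/

section ProjectiveRepresentations

variable {N : Type v} [Group N] {β : Cocycle N}
  {W W' : Type*} [AddCommGroup W] [Module ℂ W] [AddCommGroup W'] [Module ℂ W']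

/-- The operators `r a` form a `β`-representation on `W` (of arbitrary dimension). -/
structure IsRep (β : Cocycle N) (r : N → Module.End ℂ W) : Prop where
  map_one : r 1 = 1
  map_mul : ∀ a b, r a * r b = (β a b : ℂ) • r (a * b)

lemma ProjRep.isRep (σ : ProjRep β) : IsRep β σ.ρ := ⟨σ.map_one, σ.map_mul⟩

/-- Linear maps commuting with the operators of two families. -/
def Intertwines (r : N → Module.End ℂ W) (r' : N → Module.End ℂ W') (f : W →ₗ[ℂ] W') : Prop :=
  ∀ a w, f (r a w) = r' a (f w)

lemma ProjRep.tilde_inv_self (σ : ProjRep β) (p : TwistedGroup β) (v : σ.V) :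
    σ.tilde p⁻¹ (σ.tilde p v) = v := by
  rw [← Module.End.mul_apply, ← σ.tilde_mul, inv_mul_cancel, σ.tilde_one, Module.End.one_apply]

lemma ProjRep.tilde_self_inv (σ : ProjRep β) (p : TwistedGroup β) (v : σ.V) :
    σ.tilde p (σ.tilde p⁻¹ v) = v := by
  simpa using σ.tilde_inv_self p⁻¹ v

lemma ProjRep.tilde_of_one (σ : ProjRep β) (a : N) : σ.tilde ⟨a, 1⟩ = σ.ρ a := by
  simp [ProjRep.tilde]

/-- The inverse of `σ(a)`. -/
def ProjRep.inv (σ : ProjRep β) (a : N) : Module.End ℂ σ.V := σ.tilde (⟨a, 1⟩ : TwistedGroup β)⁻¹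

lemma ProjRep.inv_self (σ : ProjRep β) (a : N) (v : σ.V) : σ.inv a (σ.ρ a v) = v := by
  rw [← σ.tilde_of_one]; exact σ.tilde_inv_self _ v

lemma ProjRep.self_inv (σ : ProjRep β) (a : N) (v : σ.V) : σ.ρ a (σ.inv a v) = v := by
  rw [← σ.tilde_of_one]; exact σ.tilde_self_inv _ v

lemma ProjRep.self_mul_inv (σ : ProjRep β) (a : N) : σ.ρ a * σ.inv a = 1 :=
  LinearMap.ext (σ.self_inv a)

lemma ProjRep.inv_mul_self (σ : ProjRep β) (a : N) : σ.inv a * σ.ρ a = 1 :=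
  LinearMap.ext (σ.inv_self a)

lemma ProjRep.inv_eq (σ : ProjRep β) (a : N) {B : Module.End ℂ σ.V} (h : B * σ.ρ a = 1) :
    σ.inv a = B := by
  rw [← one_mul (σ.inv a), ← h, mul_assoc, σ.self_mul_inv, mul_one]

/-- The factor is `β a b` itself, not its inverse: `σ(ab)` equals `σ(a) σ(b)` divided by `β a b`.
This makes the factors match in every reindexing of a sum over the group. -/
lemma ProjRep.inv_mul (σ : ProjRep β) (a b : N) :
    σ.inv (a * b) = (β a b : ℂ) • (σ.inv b * σ.inv a) := by
  refine σ.inv_eq _ ?_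
  rw [smul_mul_assoc, ← mul_smul_comm, ← σ.map_mul, mul_assoc, ← mul_assoc (σ.inv a),
    σ.inv_mul_self, one_mul, σ.inv_mul_self]

/-- Schur's lemma: intertwiners of irreducible representations vanish or are invertible. -/
lemma IrrRep.schur {σ τ : IrrRep β} (f : σ.V →ₗ[ℂ] τ.V) (hf : Intertwines σ.ρ τ.ρ f)
    (h : ¬ σ.toProjRep.Iso τ.toProjRep) : f = 0 := by
  by_contra h0
  apply h
  have hk := σ.irr.2 (LinearMap.ker f) fun g w hw => by
    rw [LinearMap.mem_ker] at hw ⊢; rw [hf, hw, map_zero]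
  have hr := τ.irr.2 (LinearMap.range f) fun g w ⟨v, hv⟩ => ⟨σ.ρ g v, by rw [hf, hv]⟩
  have hk' : LinearMap.ker f = ⊥ := hk.resolve_right fun e => h0 (LinearMap.ker_eq_top.1 e)
  have hr' : LinearMap.range f = ⊤ := hr.resolve_left fun e => h0 (LinearMap.range_eq_bot.1 e)
  exact ⟨LinearEquiv.ofBijective f ⟨LinearMap.ker_eq_bot.1 hk', LinearMap.range_eq_top.1 hr'⟩,
    fun g v => hf g v⟩

/-- Schur's lemma: endomorphisms of an irreducible representation are scalars. -/
lemma IrrRep.schur_scalar (σ : IrrRep β) (f : Module.End ℂ σ.V) (hf : Intertwines σ.ρ σ.ρ f) :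
    ∃ c : ℂ, f = c • 1 := by
  have := σ.irr.1
  obtain ⟨c, hc⟩ := Module.End.exists_eigenvalue f
  refine ⟨c, ?_⟩
  have h := σ.irr.2 (LinearMap.ker (f - c • 1)) fun g w hw => by
    simp only [LinearMap.mem_ker, LinearMap.sub_apply, LinearMap.smul_apply, Module.End.one_apply]
      at hw ⊢
    rw [hf, ← map_smul, ← map_sub, hw, map_zero]
  rcases h with h | h
  · obtain ⟨v, hv, hv0⟩ := hc.exists_hasEigenvector
    refine absurd ?_ hv0
    have : v ∈ LinearMap.ker (f - c • 1) := by
      simp [Module.End.mem_eigenspace_iff.1 hv]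
    rwa [h, Submodule.mem_bot] at this
  · exact sub_eq_zero.1 (LinearMap.ker_eq_top.1 h)

lemma IrrRep.cls_eq_iff {σ τ : IrrRep β} : σ.cls = τ.cls ↔ σ.toProjRep.Iso τ.toProjRep :=
  ⟨fun h => Quotient.exact (s := IrrRep.setoid β) h,
    fun h => Quotient.sound (s := IrrRep.setoid β) h⟩

lemma Irr.exists_rep (c : Irr β) : ∃ σ : IrrRep β, σ.cls = c := Quotient.exists_rep c

variable [Fintype N]

/-- The factor `dim V_σ / |N|`. -/
def ProjRep.factor (σ : ProjRep β) : ℂ := Module.finrank ℂ σ.V / Fintype.card N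

/-- The average of the rank one map `u ↦ φ(u) w`, normalized. -/
def ProjRep.avg (σ : ProjRep β) (r : N → Module.End ℂ W) (φ : Module.Dual ℂ σ.V) (w : W) :
    σ.V →ₗ[ℂ] W :=
  σ.factor • ∑ a, r a ∘ₗ φ.smulRight w ∘ₗ σ.inv a

lemma ProjRep.avg_apply (σ : ProjRep β) (r : N → Module.End ℂ W) (φ : Module.Dual ℂ σ.V) (w : W)
    (u : σ.V) : σ.avg r φ w u = σ.factor • ∑ a, φ (σ.inv a u) • r a w := by
  simp [ProjRep.avg]

/-- Substituting `ba` for `a` in the sum applied to `σ(b) v`, the inverse of `σ(ba)` contributes `β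
b a`; on the other side the same factor comes from `r b * r a`. -/
lemma ProjRep.intertwines_sum (σ : ProjRep β) {r : N → Module.End ℂ W} (hr : IsRep β r)
    (T : σ.V →ₗ[ℂ] W) : Intertwines σ.ρ r (∑ a, r a ∘ₗ T ∘ₗ σ.inv a) := by
  intro b v
  simp only [LinearMap.sum_apply, LinearMap.comp_apply, map_sum]
  rw [← Equiv.sum_comp (Equiv.mulLeft b)]
  refine Finset.sum_congr rfl fun a _ => ?_
  have h1 : ∀ w, r b (r a w) = (β b a : ℂ) • r (b * a) w := fun w => by
    rw [← Module.End.mul_apply, hr.map_mul]; rfl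
  rw [h1, Equiv.coe_mulLeft, σ.inv_mul b a]
  simp only [LinearMap.smul_apply, map_smul, Module.End.mul_apply, σ.inv_self]

lemma ProjRep.intertwines_avg (σ : ProjRep β) {r : N → Module.End ℂ W} (hr : IsRep β r)
    (φ : Module.Dual ℂ σ.V) (w : W) : Intertwines σ.ρ r (σ.avg r φ w) := fun b v => by
  simp only [ProjRep.avg, LinearMap.smul_apply, σ.intertwines_sum hr _ b v, map_smul]

/-- Schur orthogonality within one irreducible representation. -/
lemma IrrRep.avg_self (σ : IrrRep β) (φ : Module.Dual ℂ σ.V) (w u : σ.V) :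
    σ.avg σ.ρ φ w u = φ w • u := by
  have := σ.irr.1
  have hN : (Fintype.card N : ℂ) ≠ 0 := Nat.cast_ne_zero.2 Fintype.card_ne_zero
  have hd : (Module.finrank ℂ σ.V : ℂ) ≠ 0 := Nat.cast_ne_zero.2 Module.finrank_pos.ne'
  obtain ⟨c, hc⟩ := σ.schur_scalar _ (σ.intertwines_avg σ.isRep φ w)
  -- The scalar is read off from traces: each of the `|N|` summands has trace `φ w`, so the
  -- normalized average has trace `dim V_σ · φ w`, against `c · dim V_σ`.
  have ht := congrArg (LinearMap.trace ℂ σ.V) hc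
  have h1 : ∀ a, LinearMap.trace ℂ σ.V (σ.ρ a ∘ₗ φ.smulRight w ∘ₗ σ.inv a) = φ w := fun a => by
    rw [← LinearMap.comp_assoc, LinearMap.trace_comp_comm', ← LinearMap.comp_assoc]
    have : σ.inv a ∘ₗ σ.ρ a = LinearMap.id := σ.inv_mul_self a
    rw [this, LinearMap.id_comp, LinearMap.trace_smulRight]
  rw [ProjRep.avg, map_smul, map_sum, Finset.sum_congr rfl fun a _ => h1 a, map_smul,
    LinearMap.trace_one, Finset.sum_const, Finset.card_univ, ProjRep.factor, smul_eq_mul,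
    smul_eq_mul, nsmul_eq_mul] at ht
  have : c = φ w := by
    field_simp at ht
    exact ht.symm
  rw [hc, this]; simp

/-- Schur orthogonality for two different irreducible representations. -/
lemma IrrRep.avg_ne {σ τ : IrrRep β} (h : ¬ σ.toProjRep.Iso τ.toProjRep)
    (φ : Module.Dual ℂ σ.V) (w : τ.V) : σ.avg τ.ρ φ w = 0 :=
  IrrRep.schur _ (σ.intertwines_avg τ.isRep φ w) h

/-- The coefficients of the isotypic projector. -/
def ProjRep.coef (σ : ProjRep β) (a : N) : ℂ := σ.factor * LinearMap.trace ℂ σ.V (σ.inv a)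

/-- The isotypic projector with given coefficients. -/
def proj (c : N → ℂ) (r : N → Module.End ℂ W) : Module.End ℂ W := ∑ a, c a • r a

omit [Group N] in
lemma proj_apply (c : N → ℂ) (r : N → Module.End ℂ W) (w : W) :
    proj c r w = ∑ a, c a • r a w := by simp [proj]

omit [Group N] in
lemma Intertwines.proj {r : N → Module.End ℂ W} {r' : N → Module.End ℂ W'} {f : W →ₗ[ℂ] W'}
    (hf : Intertwines r r' f) (c : N → ℂ) (w : W) : f (proj c r w) = TwK.proj c r' (f w) := by
  simp only [proj_apply, map_sum, map_smul, hf _ _]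

/-- Expanding the trace of `σ.inv a` in a basis turns the projector into a sum of rank one averages,
which are intertwiners and to which Schur orthogonality applies. -/
lemma ProjRep.proj_eq_sum (σ : ProjRep β) (r : N → Module.End ℂ W) {ι : Type*} [Fintype ι]
    (e : Module.Basis ι ℂ σ.V) (w : W) :
    proj σ.coef r w = ∑ i, σ.avg r (e.coord i) w (e i) := by
  classical
  simp only [proj_apply, ProjRep.avg_apply, ProjRep.coef, LinearMap.trace_eq_matrix_trace ℂ e,
    Matrix.trace, Matrix.diag, LinearMap.toMatrix_apply, Module.Basis.coord_apply]
  rw [← Finset.smul_sum, Finset.sum_comm, Finset.smul_sum]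
  refine Finset.sum_congr rfl fun a _ => ?_
  rw [mul_smul, Finset.sum_smul]

lemma IrrRep.proj_self (σ : IrrRep β) : proj σ.coef σ.ρ = 1 := by
  ext w
  let e := Module.finBasis ℂ σ.V
  rw [σ.proj_eq_sum σ.ρ e, Finset.sum_congr rfl fun i _ => σ.avg_self _ _ _]
  exact e.sum_repr w

lemma IrrRep.proj_ne {σ τ : IrrRep β} (h : ¬ σ.toProjRep.Iso τ.toProjRep) :
    proj σ.coef τ.ρ = 0 := by
  ext w
  rw [σ.proj_eq_sum τ.ρ (Module.finBasis ℂ σ.V)]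
  exact Finset.sum_eq_zero fun i _ => by rw [IrrRep.avg_ne h]; rfl

lemma ProjRep.Iso.coef_eq {σ τ : ProjRep β} (h : σ.Iso τ) : σ.coef = τ.coef := by
  obtain ⟨e, he⟩ := h
  ext a
  have h1 : τ.inv a = e.conj (σ.inv a) := by
    refine τ.inv_eq a (LinearMap.ext fun v => ?_)
    change e (σ.inv a (e.symm (τ.ρ a v))) = v
    have : e.symm (τ.ρ a v) = σ.ρ a (e.symm v) := by
      rw [LinearEquiv.symm_apply_eq, he, LinearEquiv.apply_symm_apply]
    rw [this, σ.inv_self, LinearEquiv.apply_symm_apply]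
  rw [ProjRep.coef, ProjRep.coef, h1, LinearMap.trace_conj', ProjRep.factor, ProjRep.factor,
    e.finrank_eq]

/-- The coefficients of the isotypic projector of an isomorphism class. -/
def Irr.coef (c : Irr β) : N → ℂ :=
  Quotient.lift (s := IrrRep.setoid β) (fun σ => σ.toProjRep.coef)
    (fun _ _ h => ProjRep.Iso.coef_eq h) c

lemma IrrRep.coef_cls (σ : IrrRep β) : σ.cls.coef = σ.toProjRep.coef := rfl

lemma IrrRep.proj_coef (σ : IrrRep β) [DecidableEq (Irr β)] (c : Irr β) :
    proj c.coef σ.ρ = if c = σ.cls then 1 else 0 := by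
  obtain ⟨τ, rfl⟩ := c.exists_rep
  split_ifs with h
  · rw [h, IrrRep.coef_cls, σ.proj_self]
  · exact IrrRep.proj_ne fun h' => h (IrrRep.cls_eq_iff.2 h')

/-- On an irreducible `σ` the projector of `σ.cls` is the identity and all others vanish, so letting
a linear relation act on a nonzero vector of each `σ` isolates one coefficient. Finiteness of `Irr
β` follows, since functions on `N` form a finite dimensional space. -/
lemma Irr.linearIndependent_coef : LinearIndependent ℂ (Irr.coef : Irr β → N → ℂ) := by
  classical
  rw [linearIndependent_iff']
  intro s g hg c hc
  obtain ⟨σ, rfl⟩ := c.exists_rep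
  have := σ.irr.1
  obtain ⟨v, hv⟩ := exists_ne (0 : σ.V)
  let L : (N → ℂ) →ₗ[ℂ] σ.V := ∑ a, (LinearMap.proj a).smulRight (σ.ρ a v)
  have hL : ∀ c : N → ℂ, L c = TwK.proj c σ.ρ v := fun c => by simp [L, proj_apply]
  have h := congrArg L hg
  rw [map_sum, map_zero, Finset.sum_eq_single σ.cls] at h
  · rw [map_smul, hL, σ.proj_coef, if_pos rfl, Module.End.one_apply] at h
    exact (smul_eq_zero.1 h).resolve_right hv
  · intro b _ hb
    rw [map_smul, hL, σ.proj_coef, if_neg hb, LinearMap.zero_apply, smul_zero]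
  · exact fun h => absurd hc h

instance Irr.finite : Finite (Irr β) := Irr.linearIndependent_coef.finite

/-- The inner projection is a sum of vectors in the images of intertwiners from an irreducible of
class `d`. The outer projector passes through these and acts on that irreducible as `0` or `1`. -/
lemma proj_comp_proj {r : N → Module.End ℂ W} (hr : IsRep β r) [DecidableEq (Irr β)] (c d : Irr β)
    (w : W) : proj c.coef r (proj d.coef r w) = if c = d then proj d.coef r w else 0 := by
  obtain ⟨σ, rfl⟩ := d.exists_rep
  rw [IrrRep.coef_cls, σ.proj_eq_sum r (Module.finBasis ℂ σ.V), map_sum,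
    Finset.sum_congr rfl fun i _ => ((σ.intertwines_avg hr _ _).proj c.coef _).symm, σ.proj_coef]
  split_ifs <;> simp

/-- In the twisted setting the coefficients are not class functions. Instead both products are
brought to the common form with coefficients the traces of `σ.ρ b * σ.inv g`, putting `g = ab` on
one side and `g = ba`, with cyclicity of the trace, on the other. -/
lemma ProjRep.proj_comm (σ : ProjRep β) {r : N → Module.End ℂ W} (hr : IsRep β r) (b : N) :
    proj σ.coef r * r b = r b * proj σ.coef r := by
  have h1 : proj σ.coef r * r b =
      σ.factor • ∑ g, LinearMap.trace ℂ σ.V (σ.ρ b * σ.inv g) • r g := by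
    rw [proj, Finset.sum_mul, Finset.smul_sum]
    conv_rhs => rw [← Equiv.sum_comp (Equiv.mulRight b)]
    refine Finset.sum_congr rfl fun a _ => ?_
    rw [Equiv.coe_mulRight, σ.inv_mul, mul_smul_comm, ← mul_assoc, σ.self_mul_inv, one_mul,
      map_smul, smul_mul_assoc, hr.map_mul, ProjRep.coef, mul_smul, smul_eq_mul, mul_smul,
      smul_comm (LinearMap.trace ℂ σ.V (σ.inv a))]
  have h2 : r b * proj σ.coef r =
      σ.factor • ∑ g, LinearMap.trace ℂ σ.V (σ.ρ b * σ.inv g) • r g := by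
    rw [proj, Finset.mul_sum, Finset.smul_sum]
    conv_rhs => rw [← Equiv.sum_comp (Equiv.mulLeft b)]
    refine Finset.sum_congr rfl fun a _ => ?_
    rw [Equiv.coe_mulLeft, σ.inv_mul, LinearMap.trace_mul_comm, smul_mul_assoc, mul_assoc,
      σ.inv_mul_self, mul_one, map_smul, mul_smul_comm, hr.map_mul, ProjRep.coef, mul_smul,
      smul_eq_mul, mul_smul, smul_comm (LinearMap.trace ℂ σ.V (σ.inv a))]
  rw [h1, h2]

lemma Irr.proj_comm (c : Irr β) {r : N → Module.End ℂ W} (hr : IsRep β r) (b : N) (w : W) :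
    proj c.coef r (r b w) = r b (proj c.coef r w) := by
  obtain ⟨σ, rfl⟩ := c.exists_rep
  exact LinearMap.congr_fun (σ.toProjRep.proj_comm hr b) w

omit [Fintype N] in
/-- A nonzero finite dimensional representation contains an irreducible one. -/
lemma IsRep.exists_irr {V : Type} [AddCommGroup V] [Module ℂ V] [FiniteDimensional ℂ V]
    {r : N → Module.End ℂ V} (hr : IsRep β r) (S : Submodule ℂ V)
    (hS : ∀ a, ∀ w ∈ S, r a w ∈ S) (h0 : S ≠ ⊥) :
    ∃ (σ : IrrRep β) (f : σ.V →ₗ[ℂ] V), Intertwines σ.ρ r f ∧ Function.Injective f ∧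
      ∀ v, f v ∈ S := by
  classical
  -- A nonzero invariant subspace of least dimension inside `S` is irreducible.
  have hex : ∃ n, ∃ T : Submodule ℂ V, T ≤ S ∧ T ≠ ⊥ ∧ (∀ a, ∀ w ∈ T, r a w ∈ T) ∧
    Module.finrank ℂ T = n := ⟨_, S, le_rfl, h0, hS, rfl⟩
  obtain ⟨T, hTS, hT0, hT, hn⟩ := Nat.find_spec hex
  let σ : ProjRep β :=
    { V := T
      ρ := fun a => (r a).restrict (hT a)
      map_one := by ext v; simp [hr.map_one]
      map_mul := fun a b => LinearMap.ext fun v => Subtype.ext (by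
        have := LinearMap.congr_fun (hr.map_mul a b) v.1
        simpa using this) }
  refine ⟨⟨σ, ?_, ?_⟩, T.subtype, fun a w => rfl, T.injective_subtype, fun v => hTS v.2⟩
  · exact (Submodule.nontrivial_iff_ne_bot).2 hT0
  · intro R hR
    by_contra! hcon
    have hlt : Module.finrank ℂ R < Module.finrank ℂ T := Submodule.finrank_lt hcon.2
    have hm : Module.finrank ℂ (R.map T.subtype) = Module.finrank ℂ R :=
      Submodule.finrank_map_subtype_eq T R
    refine Nat.find_min hex (hn ▸ hm ▸ hlt) ⟨R.map T.subtype, ?_, ?_, ?_, rfl⟩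
    · exact (Submodule.map_subtype_le T R).trans hTS
    · exact fun h => hcon.1 (Submodule.map_injective_of_injective T.injective_subtype
        (h.trans (Submodule.map_bot _).symm))
    · rintro a _ ⟨w, hw, rfl⟩
      exact ⟨_, hR a w hw, rfl⟩

/-- A finite dimensional representation is the sum of its isotypic components. -/
lemma IsRep.sum_proj {V : Type} [AddCommGroup V] [Module ℂ V] [FiniteDimensional ℂ V]
    {r : N → Module.End ℂ V} (hr : IsRep β r) [Fintype (Irr β)] (w : V) :
    ∑ c : Irr β, proj c.coef r w = w := by
  classical
  -- The common kernel of all projectors is invariant. If it were nonzero it would contain an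
  -- irreducible, on which its own projector is both zero and the identity. The defect of the
  -- asserted identity lies in `S` by orthogonality.
  let S : Submodule ℂ V := ⨅ c : Irr β, LinearMap.ker (proj c.coef r)
  have hmem : ∀ v, v ∈ S ↔ ∀ c : Irr β, proj c.coef r v = 0 := fun v => by simp [S]
  have hbot : S = ⊥ := by
    by_contra h0
    obtain ⟨σ, f, hf, hinj, hfS⟩ := hr.exists_irr S (fun a v hv => by
      rw [hmem] at hv ⊢
      intro c
      rw [c.proj_comm hr, hv, map_zero]) h0
    have := σ.irr.1
    obtain ⟨v, hv⟩ := exists_ne (0 : σ.V)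
    have h1 := (hmem _).1 (hfS v) σ.cls
    rw [← hf.proj, σ.proj_coef, if_pos rfl, Module.End.one_apply] at h1
    exact hv (hinj (h1.trans (map_zero f).symm))
  have hw : w - ∑ c : Irr β, proj c.coef r w ∈ S := by
    rw [hmem]
    intro c
    rw [map_sub, map_sum, Finset.sum_congr rfl fun d _ => proj_comp_proj hr c d w,
      Finset.sum_ite_eq, if_pos (Finset.mem_univ _), sub_self]
  rw [hbot, Submodule.mem_bot] at hw
  exact (sub_eq_zero.1 hw).symm

end ProjectiveRepresentations

/-! ### Isotypic projectors under conjugation by elements of `G` -/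

section Conjugation

variable {G : Type v} [Group G] {α : Cocycle G} {A : Subgroup G} [A.Normal]
  {W : Type*} [AddCommGroup W] [Module ℂ W]

/-- The conjugate `a ↦ α(g⁻¹a, g) α(g, g⁻¹a)⁻¹ r(g⁻¹ a g)` of a family of operators. -/
def conjOp (α : Cocycle G) (g : G) (r : A → Module.End ℂ W) (a : A) : Module.End ℂ W :=
  (kappa α g a : ℂ) • r (conjInv g a)

/-- Conjugation by `g⁻¹` as a permutation of `A`. -/
def conjPerm (A : Subgroup G) [A.Normal] (g : G) : A ≃ A where
  toFun := conjInv g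
  invFun := conjInv g⁻¹
  left_inv a := by ext; simp [conjInv, mul_assoc]
  right_inv a := by ext; simp [conjInv, mul_assoc]

lemma IrrRep.smul_cls (g : G) (σ : IrrRep (α.comap A.subtype)) : g • σ.cls = (σ.conj g).cls := rfl

/-- The coefficient of `g • σ` at `a` is that of `σ` at `g⁻¹ a g` divided by `kappa α g a`, and
`conjOp` multiplies the operator by the same scalar. What remains is a permutation of `A`. -/
lemma Irr.proj_smul [Fintype A] (g : G) (c : Irr (α.comap A.subtype)) (r : A → Module.End ℂ W) :
    proj (g • c).coef (conjOp α g r) = proj c.coef r := by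
  obtain ⟨σ, rfl⟩ := c.exists_rep
  rw [IrrRep.smul_cls, IrrRep.coef_cls, IrrRep.coef_cls]
  simp only [proj]
  conv_rhs => rw [← Equiv.sum_comp (conjPerm A g)]
  refine Finset.sum_congr rfl fun a _ => ?_
  have h : (σ.conj g).inv a = (kappa α g a : ℂ)⁻¹ • σ.inv (conjInv g a) := by
    refine ProjRep.inv_eq _ _ ?_
    change ((kappa α g a : ℂ)⁻¹ • σ.inv (conjInv g a)) *
      ((kappa α g a : ℂ) • σ.ρ (conjInv g a)) = 1
    rw [smul_mul_smul_comm, inv_mul_cancel₀ (Circle.coe_ne_zero _), one_smul, σ.inv_mul_self]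
  have hc : (σ.conj g).coef a = (kappa α g a : ℂ)⁻¹ * σ.coef (conjInv g a) := by
    rw [ProjRep.coef, h]
    exact (congrArg (σ.factor * ·) (map_smul (LinearMap.trace ℂ σ.V) _ _)).trans
      (mul_left_comm _ _ _)
  rw [hc, conjOp, smul_smul, mul_right_comm, inv_mul_cancel₀ (Circle.coe_ne_zero _), one_mul]
  rfl

end Conjugation

/-! ### The action on fibres, and `V_σ ⊗ Hom(V_σ, E_x)` as an isotypic component -/

section Fibres

variable {H : Type v} [Group H] {N : Type*} [Group N] {α : Cocycle H} {X : Type u} [MulAction H X]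

/-- The operators on the fibres of a family given by a group acting trivially on the base. -/
def EqFamily.fibOp (j : N →* H) (hX : ∀ (n : N) (x : X), j n • x = x) (E : EqFamily α X) (x : X)
    (a : N) : Module.End ℂ (E.fib x) :=
  E.act ⟨j a, 1⟩ (hX a x)

variable [TopologicalSpace X] {E : EqFamily α X}

lemma EqFamily.IsBundle.act_eq_smul (hE : E.IsBundle) (g : H) (z : Circle) {x y : X}
    (h : g • x = y) (e : E.fib x) :
    E.act (⟨g, z⟩ : TwistedGroup α) h e = (z : ℂ) • E.act (⟨g, 1⟩ : TwistedGroup α) h e := by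
  have e1 : (⟨g, z⟩ : TwistedGroup α) = ⟨1, z⟩ * ⟨g, 1⟩ := by ext1 <;> simp [α.left_one]
  have h1 : (⟨1, z⟩ * ⟨g, 1⟩ : TwistedGroup α).g • x = y := e1 ▸ h
  rw [E.act_congr e1 h h1, hE.act_mul _ _ x y y h (one_smul H y) h1, hE.act_circle]

/-- Multiplicativity of the action in terms of elements of the group `H` itself. -/
lemma EqFamily.IsBundle.act_act (hE : E.IsBundle) (g h : H) {x y z : X} (hg : h • x = y)
    (hh : g • y = z) (hgh : (g * h) • x = z) (e : E.fib x) :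
    E.act (⟨g, 1⟩ : TwistedGroup α) hh (E.act (⟨h, 1⟩ : TwistedGroup α) hg e) =
      (α g h : ℂ) • E.act (⟨g * h, 1⟩ : TwistedGroup α) hgh e := by
  rw [← hE.act_eq_smul (g * h) (α g h) hgh, ← hE.act_mul _ _ x y z hg hh hgh]
  exact E.act_congr (by ext1 <;> simp) _ _ _

variable (j : N →* H) (hX : ∀ (n : N) (x : X), j n • x = x)

lemma EqFamily.IsBundle.isRep_fibOp (hE : E.IsBundle) (x : X) :
    IsRep (α.comap j) (E.fibOp j hX x) where
  map_one := LinearMap.ext fun e => by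
    have h1 : (⟨j 1, 1⟩ : TwistedGroup α) = 1 := by ext1 <;> simp
    exact (E.act_congr h1 (hX 1 x) (one_smul H x) e).trans (hE.act_one x _ e)
  map_mul a b := LinearMap.ext fun e => by
    have h1 : (j a * j b) • x = x := by rw [← map_mul]; exact hX _ x
    refine (hE.act_act (j a) (j b) (hX b x) (hX a x) h1 e).trans ?_
    have h2 : (⟨j a * j b, 1⟩ : TwistedGroup α) = ⟨j (a * b), 1⟩ := by rw [map_mul]
    exact congrArg ((α (j a) (j b) : ℂ) • ·) (E.act_congr h2 h1 (hX _ x) e)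

/-- The circle acts by scalars on both sides, so only the elements with circle coordinate `1` impose
a condition. -/
lemma EqFamily.IsBundle.mem_homSub (hE : E.IsBundle) (ρ : ProjRep (α.comap j)) (x : X)
    {f : ρ.V →ₗ[ℂ] E.fib x} :
    f ∈ HomSub j ρ hX E x ↔ Intertwines ρ.ρ (E.fibOp j hX x) f := by
  constructor
  · intro hf a w
    have := hf ⟨a, 1⟩ w
    rw [ρ.tilde_of_one] at this
    exact this.symm
  · rintro hf ⟨a, z⟩ w
    refine (hE.act_eq_smul (j a) z (hX a x) (f w)).trans ?_
    change (z : ℂ) • E.fibOp j hX x a (f w) = f ((z : ℂ) • ρ.ρ a w)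
    rw [map_smul, hf]

variable [Fintype N]

/-- The map `w ↦ ∑ eᵢ ⊗ f_{eᵢ^*, w}` from the fibre to `V_σ ⊗ Hom(V_σ, E_x)`. -/
def delta (hE : E.IsBundle) (σ : IrrRep (α.comap j)) (x : X) :
    E.fib x →ₗ[ℂ] σ.V ⊗[ℂ] HomSub j σ.toProjRep hX E x where
  toFun w := ∑ i, Module.finBasis ℂ σ.V i ⊗ₜ
    ⟨σ.avg (E.fibOp j hX x) ((Module.finBasis ℂ σ.V).coord i) w,
      (hE.mem_homSub j hX _ x).2 (σ.intertwines_avg (hE.isRep_fibOp j hX x) _ _)⟩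
  map_add' w w' := by
    rw [← Finset.sum_add_distrib]
    refine Finset.sum_congr rfl fun i _ => ?_
    rw [← TensorProduct.tmul_add]
    congr 1
    ext u
    simp [ProjRep.avg_apply, Finset.sum_add_distrib]
  map_smul' c w := by
    rw [RingHom.id_apply, Finset.smul_sum]
    refine Finset.sum_congr rfl fun i _ => ?_
    rw [← TensorProduct.tmul_smul]
    congr 1
    ext u
    simp only [ProjRep.avg_apply, map_smul, Submodule.coe_smul, LinearMap.smul_apply,
      Finset.smul_sum, smul_comm c]

/-- Together with `delta_gamma` this shows that `gamma` is injective with image the isotypic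
component of `σ`. -/
lemma gamma_delta (hE : E.IsBundle) (σ : IrrRep (α.comap j)) (x : X) (w : E.fib x) :
    gamma j σ.toProjRep hX E x (delta j hX hE σ x w) = proj σ.coef (E.fibOp j hX x) w := by
  rw [σ.proj_eq_sum _ (Module.finBasis ℂ σ.V)]
  simp only [delta, LinearMap.coe_mk, AddHom.coe_mk, map_sum, gamma_tmul]

/-- An intertwiner commutes with averaging, so this is Schur orthogonality in `σ` transported along
`f`. -/
lemma ProjRep.avg_intertwiner {β : Cocycle N} {σ : IrrRep β} {W : Type*}
    [AddCommGroup W] [Module ℂ W]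
    {r : N → Module.End ℂ W} {f : σ.V →ₗ[ℂ] W} (hf : Intertwines σ.ρ r f)
    (φ : Module.Dual ℂ σ.V) (v : σ.V) : σ.avg r φ (f v) = φ v • f := by
  ext u
  rw [LinearMap.smul_apply, ← map_smul, ← σ.avg_self, ProjRep.avg_apply, ProjRep.avg_apply,
    map_smul, map_sum]
  simp only [map_smul, hf _ _]

lemma delta_gamma (hE : E.IsBundle) (σ : IrrRep (α.comap j)) (x : X)
    (t : σ.V ⊗[ℂ] HomSub j σ.toProjRep hX E x) :
    delta j hX hE σ x (gamma j σ.toProjRep hX E x t) = t := by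
  induction t with
  | zero => simp
  | add a b ha hb => rw [map_add, map_add, ha, hb]
  | tmul v f =>
    rw [gamma_tmul]
    have hf := (hE.mem_homSub j hX σ.toProjRep x).1 f.2
    have h1 : ∀ i, (⟨σ.avg (E.fibOp j hX x) ((Module.finBasis ℂ σ.V).coord i) (f.1 v),
        (hE.mem_homSub j hX _ x).2 (σ.intertwines_avg (hE.isRep_fibOp j hX x) _ _)⟩ :
          HomSub j σ.toProjRep hX E x) = (Module.finBasis ℂ σ.V).coord i v • f := fun i =>
      Subtype.ext (ProjRep.avg_intertwiner hf _ v)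
    change ∑ i, Module.finBasis ℂ σ.V i ⊗ₜ _ = _
    rw [Finset.sum_congr rfl fun i _ => congrArg _ (h1 i)]
    simp only [← TensorProduct.smul_tmul]
    rw [← TensorProduct.sum_tmul]
    congr 1
    exact (Module.finBasis ℂ σ.V).sum_repr v

/-- A bundle is isotypic if and only if the isotypic projector is the identity. -/
lemma isIsotypic_iff (hE : E.IsBundle) (σ : IrrRep (α.comap j)) :
    IsIsotypic j σ.toProjRep hX E ↔ ∀ x w, proj σ.coef (E.fibOp j hX x) w = w := by
  constructor
  · intro h x w
    obtain ⟨t, rfl⟩ := (h x).2 w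
    rw [← gamma_delta j hX hE, delta_gamma]
  · exact fun h x => ⟨Function.LeftInverse.injective (delta_gamma j hX hE σ x),
      fun w => ⟨_, (gamma_delta j hX hE σ x w).trans (h x w)⟩⟩

end Fibres

/-! ### Continuity of sections and of the action -/

section Continuity

variable {H : Type v} [Group H] {α : Cocycle H} {X : Type u} [MulAction H X] [TopologicalSpace X]
  {E : EqFamily α X}

lemma EqFamily.IsBundle.finiteDimensional (hE : E.IsBundle) (x : X) :
    FiniteDimensional ℂ (E.fib x) := by
  obtain ⟨U, _, hx, ι, _, e, _⟩ := hE.loc_triv x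
  exact (e ⟨x, hx⟩).symm.finiteDimensional

/-- Linear combinations of continuous sections are continuous. -/
lemma EqFamily.IsBundle.continuous_sum (hE : E.IsBundle) {T ι : Type*} [TopologicalSpace T]
    (s : Finset ι) {b : T → X} (hb : Continuous b) {c : ι → T → ℂ} (hc : ∀ i, Continuous (c i))
    {f : ι → ∀ t, E.fib (b t)} (hf : ∀ i, Continuous fun t => (⟨b t, f i t⟩ : E.Tot)) :
    Continuous fun t => (⟨b t, ∑ i ∈ s, c i t • f i t⟩ : E.Tot) := by
  -- The claim is local in `t`; in a trivialization around `b t₀` it concerns a sum of functions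
  -- with values in a fixed vector space.
  refine continuous_iff_continuousAt.2 fun t₀ => ?_
  obtain ⟨U, hU, hx, κ, _, e, he1, he2⟩ := hE.loc_triv (b t₀)
  have hV : IsOpen (b ⁻¹' U) := hU.preimage hb
  refine ContinuousOn.continuousAt (s := b ⁻¹' U) ?_ (hV.mem_nhds hx)
  rw [continuousOn_iff_continuous_domRestrict]
  have h1 : ∀ i, Continuous fun t : b ⁻¹' U => e ⟨b t, t.2⟩ (f i t) := fun i => by
    have hg : Continuous fun t : b ⁻¹' U =>
        (⟨⟨b t, f i t⟩, t.2⟩ : {t : E.Tot // t.base ∈ U}) :=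
      ((hf i).comp continuous_subtype_val).subtype_mk _
    exact he1.comp hg
  have h2 : Continuous fun t : b ⁻¹' U => ∑ i ∈ s, c i t • e ⟨b t, t.2⟩ (f i t) :=
    continuous_finsetSum _ fun i _ => ((hc i).comp continuous_subtype_val).smul (h1 i)
  refine (he2.comp (((hb.comp continuous_subtype_val).subtype_mk (fun t => t.2)).prodMk h2)).congr
    fun t => ?_
  change (⟨b t, (e ⟨b t, t.2⟩).symm _⟩ : E.Tot) = ⟨b t, _⟩
  congr 1
  rw [LinearEquiv.symm_apply_eq, map_sum]
  simp only [map_smul]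

/-- Keeping the end point `b' t` separate from `p.g • b t` allows `b' = b` when `p.g` fixes the
base, without transport between fibres. -/
lemma EqFamily.IsBundle.continuous_act_const (hE : E.IsBundle) (p : TwistedGroup α) {T : Type*}
    [TopologicalSpace T] {b b' : T → X} (h : ∀ t, p.g • b t = b' t) {f : ∀ t, E.fib (b t)}
    (hf : Continuous fun t => (⟨b t, f t⟩ : E.Tot)) :
    Continuous fun t => (⟨b' t, E.act p (h t) (f t)⟩ : E.Tot) :=
  (hE.continuous_act.comp (continuous_const.prodMk hf)).congr fun t => EqFamily.tot_ext (h t) _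

lemma TwistedGroup.continuous_mk (g : H) : Continuous fun z => (⟨g, z⟩ : TwistedGroup α) := by
  let _ : TopologicalSpace H := ⊥
  exact continuous_induced_rng.2 (continuous_const.prodMk continuous_id)

/-- Continuity of a map out of `H̃_α × T` can be tested on the components of `H̃_α`. -/
lemma TwistedGroup.continuous_prod {T Z : Type*} [TopologicalSpace T] [TopologicalSpace Z]
    {f : TwistedGroup α × T → Z}
    (hf : ∀ g : H, Continuous fun q : Circle × T => f (⟨g, q.1⟩, q.2)) :
    Continuous f := by
  let _ : TopologicalSpace H := ⊥
  have : DiscreteTopology H := ⟨rfl⟩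
  have h1 : Continuous fun q : H × (Circle × T) => f (⟨q.1, q.2.1⟩, q.2.2) :=
    continuous_prod_of_discrete_left.2 hf
  have h2 : Continuous fun p : TwistedGroup α => (p.g, p.z) := continuous_induced_dom
  exact h1.comp ((continuous_fst.comp (h2.comp continuous_fst)).prodMk
    ((continuous_snd.comp (h2.comp continuous_fst)).prodMk continuous_snd))

end Continuity

/-! ### Direct summands of equivariant bundles -/

section Splitting

variable {G : Type v} [Group G] {α : Cocycle G} {X : Type u} [MulAction G X]
  {S : Subgroup G}

/-- A splitting of the family `F` with an action of `S̃_α` off the family `E` with an action of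
`G̃_α`. -/
structure Splitting (F : EqFamily (α.comap S.subtype) X) (E : EqFamily α X) where
  incl : ∀ x, F.fib x →ₗ[ℂ] E.fib x
  ret : ∀ x, E.fib x →ₗ[ℂ] F.fib x
  ret_incl : ∀ x v, ret x (incl x v) = v
  continuous_incl : Continuous fun t : F.Tot => (⟨t.base, incl t.base t.vec⟩ : E.Tot)
  continuous_ret : Continuous fun t : E.Tot => (⟨t.base, ret t.base t.vec⟩ : F.Tot)
  incl_act : ∀ (p : TwistedGroup (α.comap S.subtype)) {x y : X} (h : p.g • x = y) (v : F.fib x),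
    incl y (F.act p h v) = E.act (p.map S.subtype) h (incl x v)

namespace Splitting

variable {F F' : EqFamily (α.comap S.subtype) X} {E E' : EqFamily α X}

lemma injective (s : Splitting F E) (x : X) : Function.Injective (s.incl x) :=
  Function.LeftInverse.injective (s.ret_incl x)

/-- The projector onto the split family. -/
def idem (s : Splitting F E) (x : X) : Module.End ℂ (E.fib x) := s.incl x ∘ₗ s.ret x

lemma idem_apply (s : Splitting F E) (x : X) (w : E.fib x) :
    s.idem x w = s.incl x (s.ret x w) := rfl

lemma idem_incl (s : Splitting F E) (x : X) (v : F.fib x) :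
    s.idem x (s.incl x v) = s.incl x v := by
  rw [idem_apply, ret_incl]

lemma ret_idem (s : Splitting F E) (x : X) (w : E.fib x) : s.ret x (s.idem x w) = s.ret x w := by
  rw [idem_apply, ret_incl]

lemma idem_idem (s : Splitting F E) (x : X) (w : E.fib x) :
    s.idem x (s.idem x w) = s.idem x w := by
  rw [idem_apply s x w, idem_incl]

/-- The continuous retraction `ret` recovers `g` from its composite with `incl`: `F` carries the
topology of a subspace of `E`. -/
lemma continuous_mk (s : Splitting F E) {T : Type*} [TopologicalSpace T] {g : T → F.Tot}
    (hg : Continuous fun t => (⟨(g t).base, s.incl _ (g t).vec⟩ : E.Tot)) : Continuous g :=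
  (s.continuous_ret.comp hg).congr fun t => by
    change (⟨(g t).base, s.ret _ (s.incl _ (g t).vec)⟩ : F.Tot) = g t
    rw [s.ret_incl]

lemma continuous_idem (s : Splitting F E) :
    Continuous fun t : E.Tot => (⟨t.base, s.idem t.base t.vec⟩ : E.Tot) :=
  s.continuous_incl.comp s.continuous_ret

/-- Two families splitting off with the same projector are isomorphic. -/
lemma iso (s : Splitting F E) (s' : Splitting F' E) (h : ∀ x w, s.idem x w = s'.idem x w) :
    F.Iso F' := by
  refine ⟨fun x => LinearEquiv.ofLinearMap (s'.ret x ∘ₗ s.incl x) (s.ret x ∘ₗ s'.incl x)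
    (LinearMap.ext fun v => ?_) (LinearMap.ext fun v => ?_),
    s'.continuous_ret.comp s.continuous_incl, s.continuous_ret.comp s'.continuous_incl,
    fun p x y hp v => s'.injective y ?_⟩
  · change s'.ret x (s.idem x (s'.incl x v)) = v
    rw [h, s'.ret_idem, s'.ret_incl]
  · change s.ret x (s'.idem x (s.incl x v)) = v
    rw [← h, s.ret_idem, s.ret_incl]
  -- A splitting does not require `ret` to be equivariant, so equivariance is checked after the
  -- injective map `s'.incl`, where equality of the projectors removes both retractions.
  · change s'.idem y (s.incl y (F.act p hp v)) = s'.incl y (F'.act p hp (s'.ret x (s.incl x v)))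
    rw [← h, s.idem_incl, s.incl_act, s'.incl_act, ← s'.idem_apply, ← h, s.idem_incl]

/-- Transport of a splitting along an isomorphism of the ambient family. -/
def congr (s : Splitting F E) (e : ∀ x, E.fib x ≃ₗ[ℂ] E'.fib x)
    (h1 : Continuous (fun t : E.Tot => (⟨t.base, e t.base t.vec⟩ : E'.Tot)))
    (h2 : Continuous (fun t : E'.Tot => (⟨t.base, (e t.base).symm t.vec⟩ : E.Tot)))
    (h3 : ∀ (p : TwistedGroup α) (x y : X) (h : p.g • x = y) (v : E.fib x),
      e y (E.act p h v) = E'.act p h (e x v)) : Splitting F E' where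
  incl x := (e x).toLinearMap ∘ₗ s.incl x
  ret x := s.ret x ∘ₗ (e x).symm.toLinearMap
  ret_incl x v := by simp [s.ret_incl]
  continuous_incl := h1.comp s.continuous_incl
  continuous_ret := s.continuous_ret.comp h2
  incl_act p x y h v := (congrArg (e y) (s.incl_act p h v)).trans (h3 _ x y h _)

/-- The direct sum of two splittings. -/
def sum (s : Splitting F E) (s' : Splitting F' E') : Splitting (F.sum F') (E.sum E') where
  incl x := (s.incl x).prodMap (s'.incl x)
  ret x := (s.ret x).prodMap (s'.ret x)
  ret_incl x v := Prod.ext (s.ret_incl x v.1) (s'.ret_incl x v.2)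
  continuous_incl := EqFamily.sum_mk (s.continuous_incl.comp (EqFamily.sum_fst F F'))
    (s'.continuous_incl.comp (EqFamily.sum_snd F F'))
  continuous_ret := EqFamily.sum_mk (s.continuous_ret.comp (EqFamily.sum_fst E E'))
    (s'.continuous_ret.comp (EqFamily.sum_snd E E'))
  incl_act p _ _ h v := Prod.ext (s.incl_act p h v.1) (s'.incl_act p h v.2)

variable [TopologicalSpace X]

/-- The pullback of a splitting. -/
def pull {Y : Type u} [MulAction G Y] [TopologicalSpace Y] (f : EqMap G Y X)
    (s : Splitting F E) : Splitting (F.pull (f.res S)) (E.pull f) where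
  incl y := s.incl (f.toFun y)
  ret y := s.ret (f.toFun y)
  ret_incl y v := s.ret_incl _ v
  continuous_incl := EqFamily.pull_mk (EqFamily.pull_fst (f.res S) F)
    (s.continuous_incl.comp (EqFamily.pull_snd (f.res S) F))
  continuous_ret := EqFamily.pull_mk (f := f.res S) (EqFamily.pull_fst f E)
    (s.continuous_ret.comp (EqFamily.pull_snd f E))
  incl_act p _ _ h v := s.incl_act p (by rw [← h]; exact (f.map_smul _ _).symm) v

lemma continuous_base (s : Splitting F E) (hE : E.IsBundle) :
    Continuous fun t : F.Tot => t.base :=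
  hE.continuous_proj.comp s.continuous_incl

/-- Near a point, the image of a continuous projector on a trivial bundle is trivialized by
`P_x P_{x₀} + (1 - P_x) (1 - P_{x₀})`. -/
lemma loc_triv (s : Splitting F E) (hE : E.IsBundle) (x₀ : X) :
    ∃ U : Set X, IsOpen U ∧ x₀ ∈ U ∧
    ∃ (ι : Type) (_ : Finite ι) (e : ∀ x : U, F.fib x ≃ₗ[ℂ] (ι → ℂ)),
      Continuous (fun t : {t : F.Tot // t.base ∈ U} => e ⟨t.1.base, t.2⟩ t.1.vec) ∧
      Continuous (fun q : U × (ι → ℂ) => (⟨q.1, (e q.1).symm q.2⟩ : F.Tot)) := by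
  classical
  obtain ⟨U, hU, hx₀, ι, hι, e, he1, he2⟩ := hE.loc_triv x₀
  cases nonempty_fintype ι
  let P : U → Matrix ι ι ℂ := fun x =>
    LinearMap.toMatrix' ((e x).toLinearMap ∘ₗ s.idem x ∘ₗ (e x).symm.toLinearMap)
  have hP : ∀ x w, (P x).mulVec w = e x (s.idem x ((e x).symm w)) := fun x w => by
    rw [← Matrix.toLin'_apply, Matrix.toLin'_toMatrix']; rfl
  have hPP : ∀ x, P x * P x = P x := fun x => by
    apply Matrix.toLin'.injective
    refine LinearMap.ext fun w => ?_
    rw [Matrix.toLin'_mul, LinearMap.comp_apply, Matrix.toLin'_apply, Matrix.toLin'_apply, hP, hP,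
      LinearEquiv.symm_apply_apply, s.idem_idem]
  have hPc : Continuous P := by
    refine continuous_matrix fun i k => ?_
    have h1 : Continuous fun x : U => e x (s.idem x ((e x).symm (Pi.single k 1))) := by
      have h2 : Continuous fun x : U =>
          (⟨⟨x, s.idem x ((e x).symm (Pi.single k 1))⟩, x.2⟩ : {t : E.Tot // t.base ∈ U}) :=
        (s.continuous_idem.comp (he2.comp (continuous_id.prodMk continuous_const))).subtype_mk _
      exact he1.comp h2
    refine ((continuous_apply i).comp h1).congr fun x => ?_
    simp [P, LinearMap.toMatrix'_apply]
  let P₀ := P ⟨x₀, hx₀⟩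
  let T : U → Matrix ι ι ℂ := fun x => P x * P₀ + (1 - P x) * (1 - P₀)
  have hTc : Continuous T := by fun_prop
  -- With `hTP` this gives `P x * T x = T x * P₀`: wherever `T x` is invertible it maps the image of
  -- `P₀` isomorphically onto the image of `P x`.
  have hPT : ∀ x, P x * T x = P x * P₀ := fun x => by
    simp only [T, mul_add, ← mul_assoc, mul_sub, hPP, mul_one, sub_self, zero_mul, add_zero]
  have hTP : ∀ x, T x * P₀ = P x * P₀ := fun x => by
    simp only [T, add_mul, mul_assoc, sub_mul, hPP, one_mul, sub_self, mul_zero, add_zero, P₀]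
  -- An open condition, satisfied at `x₀` because `T` is the identity there.
  let V' : Set U := {x | (T x).det ≠ 0}
  have hV' : IsOpen V' := isOpen_ne_fun hTc.matrix_det continuous_const
  let V : Set X := Subtype.val '' V'
  have hVU : ∀ x : V, (x : X) ∈ U := by rintro ⟨_, x, _, rfl⟩; exact x.2
  have hVdet : ∀ x : V, IsUnit (T ⟨x, hVU x⟩).det := by
    rintro ⟨_, x, hx, rfl⟩; exact isUnit_iff_ne_zero.2 hx
  -- The image of `P₀` is the model fibre; `fwd` is given by the inverse of `T x` and `bwd` by `T x`
  -- followed by `ret`.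
  let K : Submodule ℂ (ι → ℂ) := LinearMap.range P₀.mulVecLin
  have hK : ∀ k : K, P₀.mulVec k = k := by
    rintro ⟨_, w, rfl⟩
    simp only [Matrix.mulVecLin_apply, Matrix.mulVec_mulVec, P₀, hPP]
  let b : K ≃ₗ[ℂ] (Fin (Module.finrank ℂ K) → ℂ) := (Module.finBasis ℂ K).equivFun
  have hincl : ∀ (x : U) (v : F.fib x),
      (P x).mulVec (e x (s.incl x v)) = e x (s.incl x v) := fun x v => by
    rw [hP, LinearEquiv.symm_apply_apply, s.idem_incl]
  -- This says that the inverse of `T x` maps the image of `P x` into `K`, as needed for the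
  -- codomain of `fwd`.
  have hTinv : ∀ x : V, P₀ * (T ⟨x, hVU x⟩)⁻¹ * P ⟨x, hVU x⟩ = (T ⟨x, hVU x⟩)⁻¹ * P ⟨x, hVU x⟩ :=
    fun x => by
    set y : U := ⟨x, hVU x⟩
    have hd := hVdet x
    have h1 : P y * T y = T y * P₀ := by rw [hPT, hTP]
    have h2 : P₀ * (T y)⁻¹ = (T y)⁻¹ * P y := by
      calc P₀ * (T y)⁻¹ = (T y)⁻¹ * (T y * P₀) * (T y)⁻¹ := by
            rw [← mul_assoc, Matrix.nonsing_inv_mul _ hd, one_mul]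
        _ = (T y)⁻¹ * P y := by
            rw [← h1, mul_assoc, mul_assoc, Matrix.mul_nonsing_inv _ hd, mul_one]
    rw [h2, mul_assoc, hPP]
  let fwd : ∀ x : V, F.fib x →ₗ[ℂ] K := fun x =>
    LinearMap.codRestrict K ((T ⟨x, hVU x⟩)⁻¹.mulVecLin ∘ₗ (e ⟨x, hVU x⟩).toLinearMap ∘ₗ s.incl x)
      fun v => by
        refine ⟨(T ⟨x, hVU x⟩)⁻¹.mulVec (e ⟨x, hVU x⟩ (s.incl x v)), ?_⟩
        change P₀.mulVec ((T ⟨x, hVU x⟩)⁻¹.mulVec (e ⟨x, hVU x⟩ (s.incl x v))) =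
          (T ⟨x, hVU x⟩)⁻¹.mulVec (e ⟨x, hVU x⟩ (s.incl x v))
        rw [← hincl ⟨x, hVU x⟩ v, Matrix.mulVec_mulVec, Matrix.mulVec_mulVec,
          Matrix.mulVec_mulVec, hTinv]
  let bwd : ∀ x : V, K →ₗ[ℂ] F.fib x := fun x =>
    s.ret x ∘ₗ (e ⟨x, hVU x⟩).symm.toLinearMap ∘ₗ (T ⟨x, hVU x⟩).mulVecLin ∘ₗ K.subtype
  have hfb : ∀ x, fwd x ∘ₗ bwd x = LinearMap.id := fun x => LinearMap.ext fun k => Subtype.ext <| by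
    change (T ⟨x, hVU x⟩)⁻¹.mulVec (e ⟨x, hVU x⟩ (s.idem x ((e ⟨x, hVU x⟩).symm
      ((T ⟨x, hVU x⟩).mulVec k)))) = k
    rw [← hP, Matrix.mulVec_mulVec, Matrix.mulVec_mulVec, mul_assoc, hPT, ← hTP, ← mul_assoc,
      Matrix.nonsing_inv_mul _ (hVdet x), one_mul, hK]
  have hbf : ∀ x, bwd x ∘ₗ fwd x = LinearMap.id := fun x => LinearMap.ext fun v => by
    change s.ret x ((e ⟨x, hVU x⟩).symm ((T ⟨x, hVU x⟩).mulVec ((T ⟨x, hVU x⟩)⁻¹.mulVec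
      (e ⟨x, hVU x⟩ (s.incl x v))))) = v
    rw [Matrix.mulVec_mulVec, Matrix.mul_nonsing_inv _ (hVdet x), Matrix.one_mulVec,
      LinearEquiv.symm_apply_apply, s.ret_incl]
  have hTinvc : Continuous fun x : V => (T ⟨x, hVU x⟩)⁻¹ := by
    have hTV : Continuous fun x : V => T ⟨x, hVU x⟩ :=
      hTc.comp (continuous_subtype_val.subtype_mk _)
    simp only [Matrix.inv_def, Ring.inverse_eq_inv']
    exact (hTV.matrix_det.inv₀ fun x => (hVdet x).ne_zero).smul hTV.matrix_adjugate
  let toK : ∀ x : V, F.fib x ≃ₗ[ℂ] K := fun x =>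
    LinearEquiv.ofLinearMap (fwd x) (bwd x) (hfb x) (hbf x)
  refine ⟨V, hU.isOpenEmbedding_subtypeVal.isOpenMap _ hV', ⟨⟨x₀, hx₀⟩, ?_, rfl⟩, _, inferInstance,
    fun x => (toK x).trans b, ?_, ?_⟩
  · have : T ⟨x₀, hx₀⟩ = 1 := by
      simp only [T, P₀, mul_sub, sub_mul, hPP, mul_one, one_mul]; abel
    simp [V', this]
  · have hb : Continuous fun t : {t : F.Tot // t.base ∈ V} => (⟨t.1.base, t.2⟩ : V) :=
      ((s.continuous_base hE).comp continuous_subtype_val).subtype_mk _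
    have hi : Continuous fun t : {t : F.Tot // t.base ∈ V} =>
        (⟨⟨t.1.base, s.incl _ t.1.vec⟩, hVU ⟨t.1.base, t.2⟩⟩ : {t : E.Tot // t.base ∈ U}) :=
      (s.continuous_incl.comp continuous_subtype_val).subtype_mk _
    exact (LinearMap.continuous_of_finiteDimensional b.toLinearMap).comp
      (Continuous.subtype_mk ((hTinvc.comp hb).matrix_mulVec (he1.comp hi)) _)
  · have hx : Continuous fun q : V × (Fin (Module.finrank ℂ K) → ℂ) =>
        (⟨q.1, hVU q.1⟩ : U) := (continuous_subtype_val.comp continuous_fst).subtype_mk _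
    have hk : Continuous fun q : V × (Fin (Module.finrank ℂ K) → ℂ) => (b.symm q.2 : ι → ℂ) :=
      continuous_subtype_val.comp
        ((LinearMap.continuous_of_finiteDimensional b.symm.toLinearMap).comp continuous_snd)
    exact s.continuous_ret.comp (he2.comp (hx.prodMk ((hTc.comp hx).matrix_mulVec hk)))

/-- A family that splits off a bundle is a bundle. -/
lemma isBundle (s : Splitting F E) (hE : E.IsBundle) : F.IsBundle where
  continuous_proj := s.continuous_base hE
  loc_triv := s.loc_triv hE
  act_one x h e := s.injective x ((s.incl_act _ _ _).trans (hE.act_one x _ _))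
  act_mul p q x y z hq hp hpq e := s.injective z <| by
    rw [s.incl_act, s.incl_act, s.incl_act]
    exact hE.act_mul (p.map S.subtype) (q.map S.subtype) x y z hq hp hpq _
  act_circle c x h e := s.injective x <| by
    rw [s.incl_act, map_smul]
    exact hE.act_circle c x _ _
  continuous_act := s.continuous_mk <| by
    have hm : Continuous fun p : TwistedGroup (α.comap S.subtype) => p.map S.subtype := by
      let _ : TopologicalSpace G := ⊥
      let _ : TopologicalSpace S := ⊥
      have : DiscreteTopology S := ⟨rfl⟩
      have h2 : Continuous fun p : TwistedGroup (α.comap S.subtype) => (p.g, p.z) :=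
        continuous_induced_dom
      have h3 : Continuous fun g : S => (g : G) := continuous_of_discreteTopology
      exact continuous_induced_rng.2 ((h3.comp (continuous_fst.comp h2)).prodMk
        (continuous_snd.comp h2))
    refine (hE.continuous_act.comp ((hm.comp continuous_fst).prodMk
      (s.continuous_incl.comp continuous_snd))).congr fun q => ?_
    change (⟨_, _⟩ : E.Tot) = ⟨_, s.incl _ (F.act q.1 rfl q.2.vec)⟩
    rw [s.incl_act]
    rfl

end Splitting
end Splitting

/-! ### The bundle `V_τ ⊗ Hom(V_τ, E)` as the isotypic summand of `E` -/

section TensorHom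

variable {G : Type v} [Group G] {A : Subgroup G} [A.Normal] {α : Cocycle G} [Fintype A]
  (τ : IrrRep (α.comap A.subtype)) {X Y : GSpace.{u, v} G A}

/-- The operators of `A` on the fibres of a family over a space on which `A` acts trivially. -/
abbrev opA (E : EqFamily α X) (x : X) (a : A) : Module.End ℂ (E.fib x) :=
  E.fibOp A.subtype (triv_subtype X) x a

/-- The isotypic projector on the fibres of a bundle. -/
abbrev isoProj (c : Irr (α.comap A.subtype)) (E : EqFamily α X) (x : X) : Module.End ℂ (E.fib x) :=
  proj c.coef (opA E x)

/-- The operators of `A` on the fibres of a family with an action of the extension of the isotropy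
group of `[τ]`. -/
abbrev opI (F : EqFamily (α.comap (isotropy τ).subtype) X) (x : X) (a : A) :
    Module.End ℂ (F.fib x) :=
  F.fibOp (inclIsotropy τ) (isotropy_triv τ X) x a

variable {τ}

omit [Fintype A] in
lemma Splitting.intertwines {F : EqFamily (α.comap (isotropy τ).subtype) X} {E : EqFamily α X}
    (s : Splitting F E) (x : X) : Intertwines (opI τ F x) (opA E x) (s.incl x) :=
  fun _ w => s.incl_act _ _ w

variable (τ)

omit [A.Normal] in
lemma continuous_isoProj (c : Irr (α.comap A.subtype)) {E : EqFamily α X} (hE : E.IsBundle) :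
    Continuous fun t : E.Tot => (⟨t.base, isoProj c E t.base t.vec⟩ : E.Tot) := by
  simp only [proj_apply]
  exact hE.continuous_sum _ hE.continuous_proj (fun _ => continuous_const) fun a =>
    hE.continuous_act_const _ _ continuous_id

omit [A.Normal] in
/-- The coefficients of an element of `V_τ ⊗ Hom(V_τ, E_x)` are averages of its image in `E_x`. -/
lemma lid_rTensor_eq_avg (E : EqBundle α X) (x : X) (φ : Module.Dual ℂ τ.V) (v : τ.V)
    (t : τ.V ⊗[ℂ] HomA τ E x) :
    (TensorProduct.lid ℂ _ (φ.rTensor _ t) : HomA τ E x).1 v =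
      τ.avg (opA E.toEqFamily x) φ
        (gamma A.subtype τ.toProjRep (triv_subtype X) E.toEqFamily x t) v := by
  induction t with
  | zero => simp [ProjRep.avg_apply]
  | add a b ha hb =>
    rw [map_add, map_add, Submodule.coe_add, LinearMap.add_apply, ha, hb, map_add]
    simp [ProjRep.avg_apply, Finset.sum_add_distrib]
  | tmul w f =>
    have hf := (E.isBundle.mem_homSub A.subtype (triv_subtype X) τ.toProjRep x).1 f.2
    rw [gamma_tmul, ProjRep.avg_intertwiner hf]
    rfl

omit [A.Normal] in
-- This writes `gamma` as a finite sum of the functions that define the topology of `tensorHom`,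
-- which makes it continuous. It holds because the sum of the averages is the isotypic projector,
-- which fixes the image of `gamma`.
lemma sum_lid_rTensor (E : EqBundle α X) (x : X) (t : τ.V ⊗[ℂ] HomA τ E x) :
    ∑ i, (TensorProduct.lid ℂ _ (((Module.finBasis ℂ τ.V).coord i).rTensor _ t) :
        HomA τ E x).1 (Module.finBasis ℂ τ.V i) =
      gamma A.subtype τ.toProjRep (triv_subtype X) E.toEqFamily x t := by
  simp only [lid_rTensor_eq_avg]
  rw [← τ.proj_eq_sum, ← gamma_delta A.subtype (triv_subtype X) E.isBundle, delta_gamma]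

omit [A.Normal] in
-- The functions defining the topology of `tensorHom`, composed with `delta`, are combinations of
-- the operators of `A` with constant coefficients applied to the isotypic projection. This gives
-- continuity of `delta`.
lemma lid_rTensor_delta (E : EqBundle α X) (x : X) (φ : Module.Dual ℂ τ.V) (v : τ.V)
    (w : E.fib x) :
    (TensorProduct.lid ℂ _ (φ.rTensor _ (delta A.subtype (triv_subtype X) E.isBundle τ x w)) :
      HomA τ E x).1 v =
      ∑ a, (τ.factor * φ (τ.inv a v)) •
        opA E.toEqFamily x a (isoProj τ.cls E.toEqFamily x w) := by
  rw [lid_rTensor_eq_avg, gamma_delta, ProjRep.avg_apply, Finset.smul_sum]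
  exact Finset.sum_congr rfl fun a _ => (mul_smul _ _ _).symm

omit [Fintype A] in
-- Evaluation cancels `M_h⁻¹` in the action on homomorphisms against `M_h` in the action on `V_τ`.
-- The choice of `M_h`, which is not multiplicative in `h`, therefore disappears, and the axioms of
-- an action are inherited from `E`.
lemma gamma_act (E : EqBundle α X) (p : TwistedGroup (α.comap (isotropy τ).subtype)) {x y : X}
    (h : p.g • x = y) :
    gamma A.subtype τ.toProjRep (triv_subtype X) E.toEqFamily y ∘ₗ
        TensorProduct.map (intertwiner τ p.g).toLinearMap (homAct τ E p h) =
      E.act (p.map (isotropy τ).subtype) h ∘ₗ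
        gamma A.subtype τ.toProjRep (triv_subtype X) E.toEqFamily x :=
  TensorProduct.ext' fun v f => by
    change E.act (p.map (isotropy τ).subtype) h
      (f.1 ((intertwiner τ p.g).symm (intertwiner τ p.g v))) = _
    rw [LinearEquiv.symm_apply_apply]
    rfl

/-- The bundle `V_τ ⊗ Hom(V_τ, E)` splits off `E`. -/
def tensorSplit (E : EqBundle α X) : Splitting (tensorHom τ E) E.toEqFamily where
  incl x := gamma A.subtype τ.toProjRep (triv_subtype X) E.toEqFamily x
  ret x := delta A.subtype (triv_subtype X) E.isBundle τ x
  ret_incl x v := delta_gamma A.subtype (triv_subtype X) E.isBundle τ x v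
  continuous_incl := by
    have h0 : ∀ (φ : Module.Dual ℂ τ.V) (v : τ.V), Continuous fun t : (tensorHom τ E).Tot =>
        (⟨t.base, (TensorProduct.lid ℂ _ (φ.rTensor _ t.vec) : HomA τ E t.base).1 v⟩ :
          E.toEqFamily.Tot) := fun φ v => by
      have h : Continuous fun (t : (tensorHom τ E).Tot) (a : Module.Dual ℂ τ.V × τ.V) =>
          (⟨t.base, (TensorProduct.lid ℂ _ (a.1.rTensor _ t.vec) : HomA τ E t.base).1 a.2⟩ :
            E.toEqFamily.Tot) := continuous_induced_dom
      exact continuous_pi_iff.1 h (φ, v)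
    -- The choice `φ = 0`, `v = 0` serves only to show that the projection of `tensorHom` to the
    -- base is continuous.
    have h1 := E.isBundle.continuous_sum Finset.univ (E.isBundle.continuous_proj.comp (h0 0 0))
      (fun _ => continuous_const (y := (1 : ℂ)))
      (fun i => h0 ((Module.finBasis ℂ τ.V).coord i) (Module.finBasis ℂ τ.V i))
    simp only [one_smul] at h1
    exact h1.congr fun t => congrArg (FamTot.mk t.base) (sum_lid_rTensor τ E t.base t.vec)
  continuous_ret := by
    refine continuous_induced_rng.2 (continuous_pi fun q => ?_)
    have h1 := (E.isBundle.continuous_sum Finset.univ E.isBundle.continuous_proj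
      (fun a : A => continuous_const (y := τ.factor * q.1 (τ.inv a q.2))) fun a =>
        E.isBundle.continuous_act_const (⟨a, 1⟩ : TwistedGroup α)
          (fun t : E.toEqFamily.Tot => X.triv a a.2 t.base) continuous_id).comp
            (continuous_isoProj τ.cls E.isBundle)
    exact h1.congr fun t =>
      congrArg (FamTot.mk t.base) (lid_rTensor_delta τ E t.base q.1 q.2 t.vec).symm
  incl_act p x y h t := LinearMap.congr_fun (gamma_act τ E p h) t

/-- By this identity, later statements about `tensorHom` reduce to comparisons with the isotypic
projector. -/
lemma tensorSplit_idem (E : EqBundle α X) (x : X) (w : E.fib x) :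
    (tensorSplit τ E).idem x w = isoProj τ.cls E.toEqFamily x w :=
  gamma_delta A.subtype (triv_subtype X) E.isBundle τ x w

lemma isBundle_tensorHom (E : EqBundle α X) : (tensorHom τ E).IsBundle :=
  (tensorSplit τ E).isBundle E.isBundle

lemma isotypic_iff {F : EqFamily (α.comap (isotropy τ).subtype) X} (hF : F.IsBundle) :
    IsIsotypic (α := α.comap (isotropy τ).subtype) (inclIsotropy τ) τ.toProjRep (isotropy_triv τ X)
      F ↔ ∀ x w, proj τ.coef (opI τ F x) w = w :=
  isIsotypic_iff (α := α.comap (isotropy τ).subtype) (inclIsotropy τ) (isotropy_triv τ X) hF τ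

/-- The `((G̃_[τ])_α, τ)`-equivariant bundle `V_τ ⊗ Hom(V_τ, E)`. -/
def tensorBundle (E : EqBundle α X) : IsotypicBundle τ X where
  toEqFamily := tensorHom τ E
  isBundle := isBundle_tensorHom τ E
  isotypic := (isotypic_iff τ (isBundle_tensorHom τ E)).2 fun x w =>
    (tensorSplit τ E).injective x <| by
      rw [((tensorSplit τ E).intertwines x).proj, ← IrrRep.coef_cls, ← tensorSplit_idem,
        Splitting.idem_incl]

variable {τ}

/-- A family splitting off `E` with the isotypic projector is isomorphic to
`V_τ ⊗ Hom(V_τ, E)`. -/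
lemma iso_tensorHom {F : EqFamily (α.comap (isotropy τ).subtype) X} (E : EqBundle α X)
    (s : Splitting F E.toEqFamily) (h : ∀ x w, s.idem x w = isoProj τ.cls E.toEqFamily x w) :
    F.Iso (tensorHom τ E) :=
  s.iso (tensorSplit τ E) fun x w => (h x w).trans (tensorSplit_idem τ E x w).symm

/-- The class of an isotypic bundle in the monoid `VectT`. -/
def IsotypicBundle.clsT (F : IsotypicBundle τ X) : VectT τ X :=
  ⟨F.toEqBundle.cls, F.toEqBundle, F.isotypic, rfl⟩

omit [Fintype A] in
lemma IsotypicBundle.clsT_eq_iff {F F' : IsotypicBundle τ X} :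
    F.clsT = F'.clsT ↔ F.toEqFamily.Iso F'.toEqFamily :=
  ⟨fun h => Quotient.exact (s := EqBundle.setoid _ X) (congrArg Subtype.val h),
    fun h => Subtype.ext (EqBundle.cls_eq h)⟩

omit [Fintype A] in
lemma VectT.exists_rep (c : VectT τ X) : ∃ F : IsotypicBundle τ X, F.clsT = c := by
  obtain ⟨_, E, hE, rfl⟩ := c
  exact ⟨⟨E, hE⟩, rfl⟩

variable (τ)

/-- The family with zero fibres splits off itself. -/
def zeroSplit (S : Subgroup G) :
    Splitting (EqFamily.zero (α.comap S.subtype) X) (EqFamily.zero α X) where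
  incl _ := LinearMap.id
  ret _ := LinearMap.id
  ret_incl _ _ := rfl
  continuous_incl := continuous_id
  continuous_ret := continuous_id
  incl_act _ _ _ _ _ := rfl

/-- The homomorphism `[E] ↦ [V_τ ⊗ Hom(V_τ, E)]` of monoids of isomorphism classes. -/
def tensorMap (X : GSpace.{u, v} G A) : Vect α X →+ VectT τ X where
  toFun := Quotient.lift (s := EqBundle.setoid α X) (fun E => (tensorBundle τ E).clsT) <| by
    rintro E E' ⟨e, h1, h2, h3⟩
    -- Along `e` the bundle `tensorHom τ E` also splits off `E'`; the projector is the isotypic one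
    -- because `e` commutes with the operators of `A`.
    refine IsotypicBundle.clsT_eq_iff.2 (iso_tensorHom E' ((tensorSplit τ E).congr e h1 h2 h3) ?_)
    intro x w
    change e x ((tensorSplit τ E).idem x ((e x).symm w)) = _
    have hi : Intertwines (opA E.toEqFamily x) (opA E'.toEqFamily x) (e x).toLinearMap :=
      fun a v => h3 _ x x _ v
    rw [tensorSplit_idem]
    exact (hi.proj _ _).trans (congrArg _ ((e x).apply_symm_apply w))
  map_zero' := by
    refine Subtype.ext (EqBundle.cls_eq (EqFamily.Iso.symm
      (iso_tensorHom ⟨EqFamily.zero α X, EqFamily.isBundle_zero⟩ (zeroSplit (isotropy τ)) ?_)))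
    exact fun x w => rfl
  map_add' a b := by
    induction a using Vect.ind with | _ E =>
    induction b using Vect.ind with | _ E' =>
    refine Subtype.ext (EqBundle.cls_eq (EqFamily.Iso.symm
      (iso_tensorHom (E.sum E') ((tensorSplit τ E).sum (tensorSplit τ E')) ?_)))
    intro x w
    have h1 : Intertwines (opA (E.sum E').toEqFamily x) (opA E.toEqFamily x)
      (LinearMap.fst ℂ (E.fib x) (E'.fib x)) := fun a v => rfl
    have h2 : Intertwines (opA (E.sum E').toEqFamily x) (opA E'.toEqFamily x)
      (LinearMap.snd ℂ (E.fib x) (E'.fib x)) := fun a v => rfl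
    refine Prod.ext ?_ ?_
    · exact (tensorSplit_idem τ E x w.1).trans (h1.proj _ w).symm
    · exact (tensorSplit_idem τ E' x w.2).trans (h2.proj _ w).symm

/-- The pulled back splitting has the right projector, since `E.pull f` at `y` has the fibre and the
operators of `A` of `E` at the image of `y`. -/
lemma tensorMap_pull (f : EqMap G Y X) (c : Vect α X) :
    tensorMap τ Y (Vect.pull f c) =
      VectIso.pull (α := α.comap (isotropy τ).subtype) (inclIsotropy τ) τ.toProjRep
        (isotropy_triv τ X) (isotropy_triv τ Y) (f.res (isotropy τ)) (tensorMap τ X c) := by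
  induction c using Vect.ind with | _ E =>
  refine Subtype.ext (EqBundle.cls_eq (EqFamily.Iso.symm
    (iso_tensorHom (E.pull f) ((tensorSplit τ E).pull f) ?_)))
  exact fun y w => tensorSplit_idem τ E _ w

end TensorHom

/-! ### Conjugates of families of linear maps -/

section Conjugates

variable {G : Type v} [Group G] {α : Cocycle G} {X : Type u} [MulAction G X] [TopologicalSpace X]

lemma EqFamily.IsBundle.act_act_inv {E : EqFamily α X} (hE : E.IsBundle) (p : TwistedGroup α)
    {x y : X} (h : p.g • x = y) (h' : p⁻¹.g • y = x) (w : E.fib y) :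
    E.act p h (E.act p⁻¹ h' w) = w := by
  have h1 : (p * p⁻¹).g • y = y := by rw [mul_inv_cancel]; exact one_smul G y
  rw [← hE.act_mul p p⁻¹ y x y h' h h1]
  exact (E.act_congr (mul_inv_cancel p) h1 (one_smul G y) w).trans (hE.act_one y _ w)

lemma EqFamily.IsBundle.act_inv_act {E : EqFamily α X} (hE : E.IsBundle) (p : TwistedGroup α)
    {x y : X} (h : p.g • x = y) (h' : p⁻¹.g • y = x) (w : E.fib x) :
    E.act p⁻¹ h' (E.act p h w) = w := by
  have h1 : (p⁻¹ * p).g • x = x := by rw [inv_mul_cancel]; exact one_smul G x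
  rw [← hE.act_mul p⁻¹ p x y x h h' h1]
  exact (E.act_congr (inv_mul_cancel p) h1 (one_smul G x) w).trans (hE.act_one x _ w)

/-- The conjugate `g φ g⁻¹` of a family of linear maps. -/
def conjMap {E E' : EqFamily α X} (φ : ∀ x, E.fib x →ₗ[ℂ] E'.fib x) (g : G) (x : X) :
    E.fib x →ₗ[ℂ] E'.fib x :=
  E'.act (⟨g, 1⟩ : TwistedGroup α) (smul_inv_smul g x) ∘ₗ φ (g⁻¹ • x) ∘ₗ
    E.act (⟨g, 1⟩ : TwistedGroup α)⁻¹ rfl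

variable {E E' : EqFamily α X} (hE : E.IsBundle) (hE' : E'.IsBundle)
  (φ : ∀ x, E.fib x →ₗ[ℂ] E'.fib x)

include hE hE'

/-- Conjugation by any lift of `g` to the extension gives the same map: the circle acts by scalars
on both bundles and these cancel. Hence conjugation is an honest action of `G`, free of cocycle
factors. -/
lemma conjMap_eq (p : TwistedGroup α) {x z : X} (h : p.g • z = x) (h' : p⁻¹.g • x = z)
    (w : E.fib x) : conjMap φ p.g x w = E'.act p h (φ z (E.act p⁻¹ h' w)) := by
  obtain ⟨g, c⟩ := p
  obtain rfl : g⁻¹ • x = z := h'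
  have h1 : E.act (⟨g, c⟩ : TwistedGroup α)⁻¹ rfl w =
      (c⁻¹ : ℂ) • E.act (⟨g, 1⟩ : TwistedGroup α)⁻¹ rfl w := by
    refine (hE.act_eq_smul g⁻¹ (α g⁻¹ g * c)⁻¹ rfl w).trans ?_
    rw [← Circle.coe_inv, mul_inv, mul_comm, Circle.coe_mul, mul_smul]
    refine congrArg _ ((hE.act_eq_smul g⁻¹ (α g⁻¹ g * 1)⁻¹ rfl w).trans ?_).symm
    rw [mul_one]
  rw [h1, map_smul, map_smul, hE'.act_eq_smul g c, smul_smul,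
    inv_mul_cancel₀ (Circle.coe_ne_zero c), one_smul]
  rfl

lemma conjMap_act (p : TwistedGroup α) {x y : X} (h : p.g • x = y) (g : G) (w : E.fib x) :
    conjMap φ (p.g * g) y (E.act p h w) = E'.act p h (conjMap φ g x w) := by
  have h1 : (p * ⟨g, 1⟩ : TwistedGroup α).g • (g⁻¹ • x) = y := by
    rw [← h, TwistedGroup.mul_g, mul_smul, smul_inv_smul]
  have h2 : (p * ⟨g, 1⟩ : TwistedGroup α)⁻¹.g • y = g⁻¹ • x := by
    rw [TwistedGroup.inv_g, inv_smul_eq_iff, h1]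
  refine (conjMap_eq hE hE' φ (p * ⟨g, 1⟩) h1 h2 _).trans ?_
  rw [hE'.act_mul _ _ _ x _ (smul_inv_smul g x) h]
  have h3 : ((p * ⟨g, 1⟩)⁻¹ * p : TwistedGroup α) = (⟨g, 1⟩ : TwistedGroup α)⁻¹ := by group
  have h4 : ((p * ⟨g, 1⟩)⁻¹ * p : TwistedGroup α).g • x = g⁻¹ • x := by rw [h3]; rfl
  rw [← hE.act_mul _ _ _ _ _ h h2 h4, E.act_congr h3 h4 rfl]
  rfl

omit hE in
lemma continuous_conjMap (hE : E.IsBundle)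
    (hφ : Continuous fun t : E.Tot => (⟨t.base, φ t.base t.vec⟩ : E'.Tot)) (g : G) :
    Continuous fun t : E.Tot => (⟨t.base, conjMap φ g t.base t.vec⟩ : E'.Tot) :=
  hE'.continuous_act_const _ _ (hφ.comp
    (hE.continuous_act_const (⟨g, 1⟩ : TwistedGroup α)⁻¹ (fun _ => rfl) continuous_id))

end Conjugates

/-! ### Recovering a bundle from the components of orbit representatives -/

section Gluing

variable {G : Type v} [Group G] {A : Subgroup G} [A.Normal] {α : Cocycle G} [Fintype A]
  {X : GSpace.{u, v} G A}

/-- The group acts on the isotypic components through its action on `Irr^α(A)`. -/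
lemma act_isoProj {E : EqFamily α X} (hE : E.IsBundle) (p : TwistedGroup α) {x y : X}
    (h : p.g • x = y) (c : Irr (α.comap A.subtype)) (w : E.fib x) :
    E.act p h (isoProj c E x w) = isoProj (p.g • c) E y (E.act p h w) := by
  -- This is the commutation rule `kappa_conj'` for `a` and `p` in the extension; by `Irr.proj_smul`
  -- the projector of `p.g • c` for the conjugate operators is that of `c`.
  have hi : Intertwines (conjOp α p.g (opA E x)) (opA E y) (E.act p h) := fun a v => by
    change E.act p h ((kappa α p.g a : ℂ) • E.act ⟨(conjInv p.g a : G), 1⟩ _ v) =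
      E.act ⟨(a : G), 1⟩ _ (E.act p h v)
    have h0 : (p.g⁻¹ * a * p.g : G) • x = x := X.triv _ (conjInv p.g a).2 x
    have e1 := kappa_conj' α p.g a 1 p.z
    rw [mul_one] at e1
    have h1 : ((⟨a, 1⟩ : TwistedGroup α) * p).g • x = y := by
      rw [TwistedGroup.mul_g, mul_smul, h]; exact X.triv a a.2 y
    have h2 : (p * (⟨p.g⁻¹ * a * p.g, kappa α p.g a⟩ : TwistedGroup α)).g • x = y := e1 ▸ h1
    rw [← hE.act_mul _ p x y y h (X.triv a a.2 y) h1]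
    refine Eq.trans ?_ (E.act_congr e1 h1 h2 v).symm
    rw [hE.act_mul p _ x x y h0 h h2, hE.act_eq_smul _ (kappa α p.g a)]
    rfl
  rw [← hi.proj, Irr.proj_smul]

omit [A.Normal] in
lemma isoProj_isoProj [DecidableEq (Irr (α.comap A.subtype))] {E : EqFamily α X}
    (hE : E.IsBundle) (c d : Irr (α.comap A.subtype)) (x : X) (w : E.fib x) :
    isoProj c E x (isoProj d E x w) = if c = d then isoProj d E x w else 0 :=
  proj_comp_proj (hE.isRep_fibOp A.subtype (triv_subtype X) x) c d w

/-- The isotropy group fixes `[τ]`, so its extension commutes with the isotypic projector; this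
makes the retraction equivariant although that is not part of a splitting. -/
lemma Splitting.ret_act {τ : IrrRep (α.comap A.subtype)} {E : EqFamily α X}
    {F : EqFamily (α.comap (isotropy τ).subtype) X} (s : Splitting F E) (hE : E.IsBundle)
    (hs : ∀ x w, s.idem x w = isoProj τ.cls E x w)
    (p : TwistedGroup (α.comap (isotropy τ).subtype)) {x y : X} (h : p.g • x = y) (w : E.fib x) :
    s.ret y (E.act (p.map (isotropy τ).subtype) h w) = F.act p h (s.ret x w) := by
  apply s.injective
  rw [← s.idem_apply, hs, s.incl_act, ← s.idem_apply, hs]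
  have h1 := act_isoProj hE (p.map (isotropy τ).subtype) h τ.cls w
  have h2 : (p.map (isotropy τ).subtype).g • τ.cls = τ.cls := p.g.2
  rw [h2] at h1
  exact h1.symm

section Transfer

variable {τ : IrrRep (α.comap A.subtype)} {E E' : EqBundle α X}

/-- The map `E → E'` given by maps of the isotypic components of `τ`. -/
def transfer (e : ∀ x, (tensorHom τ E).fib x →ₗ[ℂ] (tensorHom τ E').fib x) (x : X) :
    E.fib x →ₗ[ℂ] E'.fib x :=
  (tensorSplit τ E').incl x ∘ₗ e x ∘ₗ (tensorSplit τ E).ret x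

variable (e : ∀ x, (tensorHom τ E).fib x →ₗ[ℂ] (tensorHom τ E').fib x)

/-- The map `transfer e` factors through the retraction to the component of `τ`, hence kills all
other components by orthogonality. -/
lemma transfer_isoProj [DecidableEq (Irr (α.comap A.subtype))] (c : Irr (α.comap A.subtype))
    (x : X) (w : E.fib x) :
    transfer e x (isoProj c E.toEqFamily x w) = if c = τ.cls then transfer e x w else 0 := by
  have h : ∀ w, transfer e x w = transfer e x (isoProj τ.cls E.toEqFamily x w) := fun w => by
    rw [← tensorSplit_idem]
    simp only [transfer, LinearMap.comp_apply, Splitting.ret_idem]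
  rw [h, isoProj_isoProj E.isBundle]
  split_ifs with h1 h2 h2
  · rw [h w, h1]
  · exact absurd h1.symm h2
  · exact absurd h2.symm h1
  · rw [map_zero]

lemma isoProj_transfer (x : X) (w : E.fib x) :
    isoProj τ.cls E'.toEqFamily x (transfer e x w) = transfer e x w := by
  rw [← tensorSplit_idem]
  exact Splitting.idem_incl _ _ _

lemma transfer_transfer (e' : ∀ x, (tensorHom τ E').fib x →ₗ[ℂ] (tensorHom τ E).fib x)
    (he : ∀ x t, e' x (e x t) = t) (x : X) (w : E.fib x) :
    transfer e' x (transfer e x w) = isoProj τ.cls E.toEqFamily x w := by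
  rw [← tensorSplit_idem]
  simp only [transfer, LinearMap.comp_apply, Splitting.ret_incl, he, Splitting.idem_apply]

lemma transfer_act (he : ∀ (p : TwistedGroup (α.comap (isotropy τ).subtype)) (x y : X)
      (h : p.g • x = y) (t : (tensorHom τ E).fib x),
      e y ((tensorHom τ E).act p h t) = (tensorHom τ E').act p h (e x t))
    (p : TwistedGroup (α.comap (isotropy τ).subtype)) {x y : X} (h : p.g • x = y) (w : E.fib x) :
    transfer e y (E.act (p.map (isotropy τ).subtype) h w) =
      E'.act (p.map (isotropy τ).subtype) h (transfer e x w) := by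
  simp only [transfer, LinearMap.comp_apply]
  rw [(tensorSplit τ E).ret_act E.isBundle (tensorSplit_idem τ E) p h, he, Splitting.incl_act]

lemma continuous_transfer (he : Continuous fun t : (tensorHom τ E).Tot =>
      (⟨t.base, e t.base t.vec⟩ : (tensorHom τ E').Tot)) :
    Continuous fun t : E.toEqFamily.Tot => (⟨t.base, transfer e t.base t.vec⟩ :
      E'.toEqFamily.Tot) :=
  (tensorSplit τ E').continuous_incl.comp (he.comp (tensorSplit τ E).continuous_ret)

end Transfer

variable [Fintype G] {O : Type*} [Fintype O] (τ : O → IrrRep (α.comap A.subtype))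
  {E E' : EqBundle α X}

/-- The equivariant map `E → E'` that extends maps of the isotypic components of
representatives of the orbits. -/
def glue (e : ∀ o x, (tensorHom (τ o) E).fib x →ₗ[ℂ] (tensorHom (τ o) E').fib x) (x : X) :
    E.fib x →ₗ[ℂ] E'.fib x :=
  ∑ q : O × G, (Nat.card (isotropy (τ q.1)) : ℂ)⁻¹ •
    conjMap (E := E.toEqFamily) (E' := E'.toEqFamily) (transfer (e q.1)) q.2 x

variable (e : ∀ o x, (tensorHom (τ o) E).fib x →ₗ[ℂ] (tensorHom (τ o) E').fib x)

lemma glue_apply (x : X) (w : E.fib x) : glue τ e x w =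
    ∑ q : O × G, (Nat.card (isotropy (τ q.1)) : ℂ)⁻¹ •
      conjMap (E := E.toEqFamily) (E' := E'.toEqFamily) (transfer (e q.1)) q.2 x w := by
  simp [glue]

/-- Acting by `p` permutes the summands through left translation of `G`. -/
lemma glue_act (p : TwistedGroup α) {x y : X} (h : p.g • x = y) (w : E.fib x) :
    glue τ e y (E.act p h w) = E'.act p h (glue τ e x w) := by
  rw [glue_apply, glue_apply, map_sum,
    ← Equiv.sum_comp ((Equiv.refl O).prodCongr (Equiv.mulLeft p.g))]
  refine Finset.sum_congr rfl fun q _ => ?_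
  rw [map_smul, ← conjMap_act E.isBundle E'.isBundle]
  rfl

lemma continuous_glue (he : ∀ o, Continuous fun t : (tensorHom (τ o) E).Tot =>
      (⟨t.base, e o t.base t.vec⟩ : (tensorHom (τ o) E').Tot)) :
    Continuous fun t : E.toEqFamily.Tot => (⟨t.base, glue τ e t.base t.vec⟩ :
      E'.toEqFamily.Tot) := by
  simp only [glue_apply]
  exact E'.isBundle.continuous_sum _ E.isBundle.continuous_proj (fun _ => continuous_const)
    fun q => continuous_conjMap E'.isBundle _ E.isBundle (continuous_transfer _ (he q.1)) q.2

variable (hτ : ∀ o o' (g : G), g • (τ o').cls = (τ o).cls → o' = o)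

include hτ in
-- The summand of `(o', g)` sees the component of `g⁻¹ • [τ o]`, and vanishes unless this is `[τ
-- o']`, that is, unless `o' = o` and `g` lies in the isotropy group. By equivariance of `e o` each
-- surviving summand equals `transfer (e o)`. There are as many as the isotropy group has elements,
-- which explains the weights in `glue`.
lemma glue_isoProj (he : ∀ o, ∀ (p : TwistedGroup (α.comap (isotropy (τ o)).subtype)) (x y : X)
      (h : p.g • x = y) (t : (tensorHom (τ o) E).fib x),
      e o y ((tensorHom (τ o) E).act p h t) = (tensorHom (τ o) E').act p h (e o x t))
    (o : O) (x : X) (w : E.fib x) :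
    glue τ e x (isoProj (τ o).cls E.toEqFamily x w) = transfer (e o) x w := by
  classical
  have hterm : ∀ o' g, conjMap (E := E.toEqFamily) (E' := E'.toEqFamily) (transfer (e o')) g x
      (isoProj (τ o).cls E.toEqFamily x w) =
      if o' = o then if g ∈ isotropy (τ o) then transfer (e o) x w else 0 else 0 := by
    intro o' g
    have h1 : conjMap (E := E.toEqFamily) (E' := E'.toEqFamily) (transfer (e o')) g x
        (isoProj (τ o).cls E.toEqFamily x w) =
        if g⁻¹ • (τ o).cls = (τ o').cls then
          conjMap (E := E.toEqFamily) (E' := E'.toEqFamily) (transfer (e o')) g x w else 0 := by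
      simp only [conjMap, LinearMap.comp_apply]
      rw [act_isoProj E.isBundle, transfer_isoProj]
      split_ifs with h2 h3 h3
      · rfl
      · exact absurd h2 h3
      · exact absurd h3 h2
      · rw [map_zero]
    rw [h1]
    by_cases ho : o' = o
    · subst ho
      rw [if_pos rfl]
      by_cases hg : g ∈ isotropy (τ o')
      · rw [if_pos hg, if_pos (MulAction.mem_stabilizer_iff.1 (inv_mem hg))]
        have h2 := transfer_act (e o') (he o') ⟨⟨g, hg⟩, 1⟩ (x := g⁻¹ • x) (y := x)
          (smul_inv_smul g x) (E.act (⟨g, 1⟩ : TwistedGroup α)⁻¹ rfl w)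
        refine h2.symm.trans (congrArg _ ?_)
        exact E.isBundle.act_act_inv _ _ _ w
      · rw [if_neg hg,
            if_neg fun h => hg ((inv_mem_iff (x := g)).1 (MulAction.mem_stabilizer_iff.2 h))]
    · rw [if_neg ho, if_neg fun h => ho (hτ o o' g (by rw [← h, smul_inv_smul]))]
  rw [glue_apply, Fintype.sum_prod_type, Finset.sum_eq_single o]
  · have h0 : (Nat.card (isotropy (τ o)) : ℂ) ≠ 0 := Nat.cast_ne_zero.2 Nat.card_pos.ne'
    simp only [hterm, if_true]
    rw [← Finset.smul_sum, ← Finset.sum_filter, Finset.sum_const, ← Fintype.card_subtype,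
      ← Nat.card_eq_fintype_card, ← Nat.cast_smul_eq_nsmul ℂ, smul_smul]
    exact (congrArg (· • _) (inv_mul_cancel₀ h0)).trans (one_smul _ _)
  · intro o' _ ho
    exact Finset.sum_eq_zero fun g _ => by rw [hterm, if_neg ho, smul_zero]
  · exact fun h => absurd (Finset.mem_univ o) h

omit [Fintype G] [Fintype O] in
/-- A map commuting with the group that is the identity on the isotypic components of
representatives of the orbits is the identity. -/
lemma eq_self_of_isoProj (hsurj : ∀ c : Irr (α.comap A.subtype), ∃ o, ∃ g : G, g • (τ o).cls = c)
    (f : ∀ x, E.fib x →ₗ[ℂ] E.fib x)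
    (hf : ∀ (p : TwistedGroup α) (x y : X) (h : p.g • x = y) (w : E.fib x),
      f y (E.act p h w) = E.act p h (f x w))
    (h1 : ∀ o x w, f x (isoProj (τ o).cls E.toEqFamily x w) = isoProj (τ o).cls E.toEqFamily x w)
    (x : X) (w : E.fib x) : f x w = w := by
  have := Fintype.ofFinite (Irr (α.comap A.subtype))
  have := E.isBundle.finiteDimensional x
  have hsum := (E.isBundle.isRep_fibOp A.subtype (triv_subtype X) x).sum_proj w
  -- Each component is the translate by some `g` of a component of a representative at `g⁻¹ • x`,
  -- and `f` commutes with `g`.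
  have hc : ∀ c, f x (isoProj c E.toEqFamily x w) = isoProj c E.toEqFamily x w := fun c => by
    obtain ⟨o, g, rfl⟩ := hsurj c
    have h2 := act_isoProj E.isBundle (⟨g, 1⟩ : TwistedGroup α) (smul_inv_smul g x) (τ o).cls
      (E.act (⟨g, 1⟩ : TwistedGroup α)⁻¹ rfl w)
    rw [E.isBundle.act_act_inv] at h2
    change E.act _ _ _ = isoProj (g • (τ o).cls) E.toEqFamily x w at h2
    rw [← h2, hf, h1]
  conv_lhs => rw [← hsum]
  rw [map_sum]
  exact (Finset.sum_congr rfl fun c _ => hc c).trans hsum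

include hτ in
-- It suffices to look at the components of the representatives. There both glued maps are
-- transfers, and their composite is the isotypic projector.
lemma glue_glue (hsurj : ∀ c : Irr (α.comap A.subtype), ∃ o, ∃ g : G, g • (τ o).cls = c)
    (he : ∀ o, ∀ (p : TwistedGroup (α.comap (isotropy (τ o)).subtype)) (x y : X)
      (h : p.g • x = y) (t : (tensorHom (τ o) E).fib x),
      e o y ((tensorHom (τ o) E).act p h t) = (tensorHom (τ o) E').act p h (e o x t))
    (e' : ∀ o x, (tensorHom (τ o) E').fib x →ₗ[ℂ] (tensorHom (τ o) E).fib x)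
    (he' : ∀ o, ∀ (p : TwistedGroup (α.comap (isotropy (τ o)).subtype)) (x y : X)
      (h : p.g • x = y) (t : (tensorHom (τ o) E').fib x),
      e' o y ((tensorHom (τ o) E').act p h t) = (tensorHom (τ o) E).act p h (e' o x t))
    (hee : ∀ o x t, e' o x (e o x t) = t) (x : X) (w : E.fib x) :
    glue τ e' x (glue τ e x w) = w := by
  refine eq_self_of_isoProj τ (E := E) hsurj (fun x => glue τ e' x ∘ₗ glue τ e x) ?_ ?_ x w
  · intro p x y h w
    rw [LinearMap.comp_apply, LinearMap.comp_apply, glue_act, glue_act]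
  · intro o x w
    rw [LinearMap.comp_apply, glue_isoProj τ e hτ he, ← isoProj_transfer,
      glue_isoProj τ e' hτ he']
    exact transfer_transfer _ _ (hee o) x w

include hτ in
/-- Bundles with isomorphic isotypic components are isomorphic. -/
lemma iso_of_tensorHom_iso
    (hsurj : ∀ c : Irr (α.comap A.subtype), ∃ o, ∃ g : G, g • (τ o).cls = c)
    (h : ∀ o, (tensorHom (τ o) E).Iso (tensorHom (τ o) E')) : E.toEqFamily.Iso E'.toEqFamily := by
  choose e h1 h2 h3 using h
  let e₁ : ∀ o x, (tensorHom (τ o) E).fib x →ₗ[ℂ] (tensorHom (τ o) E').fib x :=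
    fun o x => (e o x).toLinearMap
  let e₂ : ∀ o x, (tensorHom (τ o) E').fib x →ₗ[ℂ] (tensorHom (τ o) E).fib x :=
    fun o x => (e o x).symm.toLinearMap
  have h3' : ∀ o, ∀ (p : TwistedGroup (α.comap (isotropy (τ o)).subtype)) (x y : X)
      (h : p.g • x = y) (t : (tensorHom (τ o) E').fib x),
      e₂ o y ((tensorHom (τ o) E').act p h t) =
        (tensorHom (τ o) E).act p h (e₂ o x t) := fun o p x y h t =>
    (LinearEquiv.symm_apply_eq _).2 <| by
      rw [h3]
      exact congrArg _ ((e o x).apply_symm_apply t).symm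
  have hf := glue_glue τ e₁ hτ hsurj h3 e₂ h3' fun o x t => (e o x).symm_apply_apply t
  have hf' := glue_glue τ e₂ hτ hsurj h3' e₁ h3 fun o x t => (e o x).apply_symm_apply t
  let f : ∀ x, E.fib x ≃ₗ[ℂ] E'.fib x := fun x =>
    LinearEquiv.ofLinearMap (glue τ e₁ x) (glue τ e₂ x) (LinearMap.ext (hf' x))
      (LinearMap.ext (hf x))
  exact ⟨f, continuous_glue τ e₁ h1, continuous_glue τ e₂ h2, fun p x y h w => glue_act τ e₁ p h w⟩

end Gluing

/-! ### Induction of equivariant families from a subgroup -/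

section Cosets

variable {G : Type v} [Group G] [Finite G] (S : Subgroup G)

/-- A copy of `G ⧸ S` in the lowest universe. -/
def CosetIdx : Type := Fin (Nat.card (G ⧸ S))

namespace CosetIdx

/-- The bijection with `G ⧸ S`. -/
def equiv : CosetIdx S ≃ G ⧸ S := (Finite.equivFin (G ⧸ S)).symm

instance : Fintype (CosetIdx S) := inferInstanceAs (Fintype (Fin _))

instance : DecidableEq (CosetIdx S) := inferInstanceAs (DecidableEq (Fin _))

instance : MulAction G (CosetIdx S) := (equiv S).mulAction G

variable {S}

/-- A representative of a coset. -/
def rep (c : CosetIdx S) : G := (equiv S c).out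

lemma rep_spec (c : CosetIdx S) : ((rep c : G) : G ⧸ S) = equiv S c := QuotientGroup.out_eq' _

lemma equiv_smul (g : G) (c : CosetIdx S) : equiv S (g • c) = g • equiv S c :=
  (equiv S).apply_symm_apply _

lemma smul_eq_iff (g : G) (c c' : CosetIdx S) : g • c' = c ↔ (rep c)⁻¹ * g * rep c' ∈ S := by
  rw [mul_assoc, ← QuotientGroup.eq, ← (equiv S).injective.eq_iff, equiv_smul, ← rep_spec c,
    ← rep_spec c', MulAction.Quotient.smul_coe, smul_eq_mul, eq_comm]

variable (S) in
/-- The trivial coset. -/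
def one : CosetIdx S := (equiv S).symm ((1 : G) : G ⧸ S)

/-- The representative of the trivial coset is some element of `S`, not necessarily `1`; the element
`oneRep` corrects for this later. -/
lemma eq_one_iff (c : CosetIdx S) : c = one S ↔ rep c ∈ S := by
  rw [one, Equiv.eq_symm_apply, ← rep_spec, eq_comm, QuotientGroup.eq, inv_one, one_mul]

lemma smul_one_eq {g : G} (hg : g ∈ S) : g • one S = one S := by
  have h : rep (one S) ∈ S := (eq_one_iff _).1 rfl
  exact (smul_eq_iff _ _ _).2 (S.mul_mem (S.mul_mem (S.inv_mem h) hg) h)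

end CosetIdx

variable {S} {α : Cocycle G}

omit [Finite G] in
-- Identities between transition elements can thus be checked in the extension of `G`, where they
-- are group identities.
lemma TwistedGroup.map_injective {p q : TwistedGroup (α.comap S.subtype)}
    (h : p.map S.subtype = q.map S.subtype) : p = q :=
  TwistedGroup.ext (Subtype.ext (congrArg (fun r : TwistedGroup α => r.g) h))
    (congrArg (fun r : TwistedGroup α => r.z) h)

/-- The element `g_c⁻¹ p g_{c'}` of the extension of `S`, where `p` maps the coset `c'` to `c`. -/
def transition (p : TwistedGroup α) {c' c : CosetIdx S} (h : p.g • c' = c) :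
    TwistedGroup (α.comap S.subtype) :=
  ⟨⟨c.rep⁻¹ * p.g * c'.rep, (CosetIdx.smul_eq_iff _ _ _).1 h⟩,
    ((⟨c.rep, 1⟩ : TwistedGroup α)⁻¹ * p * ⟨c'.rep, 1⟩).z⟩

lemma transition_map (p : TwistedGroup α) {c' c : CosetIdx S} (h : p.g • c' = c) :
    (transition p h).map S.subtype = (⟨c.rep, 1⟩ : TwistedGroup α)⁻¹ * p * ⟨c'.rep, 1⟩ := rfl

lemma transition_mul (p q : TwistedGroup α) {c c' c'' : CosetIdx S} (hq : q.g • c'' = c')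
    (hp : p.g • c' = c) (hpq : (p * q).g • c'' = c) :
    transition (p * q) hpq = transition p hp * transition q hq := by
  apply TwistedGroup.map_injective
  change _ = (transition p hp).map S.subtype * (transition q hq).map S.subtype
  rw [transition_map, transition_map, transition_map]
  group

lemma transition_one {c : CosetIdx S} (h : (1 : TwistedGroup α).g • c = c) :
    transition 1 h = 1 := by
  apply TwistedGroup.map_injective
  rw [transition_map]
  change _ = (1 : TwistedGroup α)
  group

lemma transition_circle (z : Circle) {c : CosetIdx S}
    (h : (⟨1, z⟩ : TwistedGroup α).g • c = c) : transition ⟨1, z⟩ h = ⟨1, z⟩ := by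
  apply TwistedGroup.map_injective
  rw [transition_map]
  change _ = (⟨1, z⟩ : TwistedGroup α)
  have h1 : (⟨1, z⟩ : TwistedGroup α) * ⟨c.rep, 1⟩ = ⟨c.rep, 1⟩ * ⟨1, z⟩ := by
    ext1 <;> simp [α.left_one, α.right_one]
  rw [mul_assoc, h1, inv_mul_cancel_left]

variable {X : Type u} [MulAction G X]

lemma transition_smul (p : TwistedGroup α) {c' c : CosetIdx S} (h : p.g • c' = c) {x y : X}
    (hxy : p.g • x = y) : (transition p h).g • (c'.rep⁻¹ • x) = c.rep⁻¹ • y := by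
  change (c.rep⁻¹ * p.g * c'.rep) • (c'.rep⁻¹ • x) = c.rep⁻¹ • y
  rw [← hxy, mul_smul, mul_smul, smul_inv_smul]

variable [TopologicalSpace X]

/-- The family induced from a subgroup, with fibre `∏_c F_{g_c⁻¹ x}` at `x`, where the elements
`g_c` represent the cosets `c` of `S`. -/
def indFamily (F : EqFamily (α.comap S.subtype) X) : EqFamily α X where
  -- Fibres must lie in `Type`, so the product runs over `CosetIdx S` and not over the quotient
  -- itself.
  fib x := ∀ c : CosetIdx S, F.fib (c.rep⁻¹ • x)
  top := .induced (fun t => (t.base, fun c : CosetIdx S =>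
    (⟨c.rep⁻¹ • t.base, t.vec c⟩ : F.Tot))) inferInstance
  act p _ _ h := LinearMap.pi fun c =>
    F.act (transition p (smul_inv_smul p.g c)) (transition_smul p _ h) ∘ₗ
      LinearMap.proj (p.g⁻¹ • c)

variable {F : EqFamily (α.comap S.subtype) X}

/-- The source coset is a free variable `c'` here, which avoids casts between fibres over `p.g⁻¹ •
c` and over equal cosets. -/
lemma indFamily_act_apply (p : TwistedGroup α) {x y : X} (h : p.g • x = y)
    (s : (indFamily F).fib x) {c' c : CosetIdx S} (hc : p.g • c' = c) :
    (indFamily F).act p h s c = F.act (transition p hc) (transition_smul p hc h) (s c') := by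
  obtain rfl : p.g⁻¹ • c = c' := by rw [← hc, inv_smul_smul]
  rfl

lemma indFamily_base : Continuous fun t : (indFamily F).Tot => t.base := by
  have h : Continuous fun t : (indFamily F).Tot => (t.base, fun c : CosetIdx S =>
    (⟨c.rep⁻¹ • t.base, t.vec c⟩ : F.Tot)) := continuous_induced_dom
  exact continuous_fst.comp h

lemma indFamily_component (c : CosetIdx S) : Continuous fun t : (indFamily F).Tot =>
    (⟨c.rep⁻¹ • t.base, t.vec c⟩ : F.Tot) := by
  have h : Continuous fun t : (indFamily F).Tot => (t.base, fun c : CosetIdx S =>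
    (⟨c.rep⁻¹ • t.base, t.vec c⟩ : F.Tot)) := continuous_induced_dom
  exact continuous_pi_iff.1 (continuous_snd.comp h) c

lemma indFamily_mk {T : Type*} [TopologicalSpace T] {f : T → (indFamily F).Tot}
    (hb : Continuous fun t => (f t).base)
    (hf : ∀ c : CosetIdx S, Continuous fun t => (⟨c.rep⁻¹ • (f t).base, (f t).vec c⟩ : F.Tot)) :
    Continuous f :=
  continuous_induced_rng.2 (hb.prodMk (continuous_pi hf))

lemma continuous_transition (g : G) {c' c : CosetIdx S} (h : g • c' = c) :
    Continuous fun z : Circle => transition (⟨g, z⟩ : TwistedGroup α) h := by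
  have h1 : Continuous fun z : Circle =>
      ((⟨c.rep, 1⟩ : TwistedGroup α)⁻¹ * ⟨g, z⟩ * ⟨c'.rep, 1⟩ : TwistedGroup α).z := by
    simp only [TwistedGroup.mul_z, TwistedGroup.mul_g, TwistedGroup.inv_g]
    fun_prop
  exact (TwistedGroup.continuous_mk (α := α.comap S.subtype)
    ⟨c.rep⁻¹ * g * c'.rep, (CosetIdx.smul_eq_iff _ _ _).1 h⟩).comp h1

variable [ContinuousConstSMul G X]

lemma isBundle_indFamily (hF : F.IsBundle) : (indFamily F).IsBundle where
  continuous_proj := indFamily_base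
  loc_triv x₀ := by
    choose U hU hx ι hι e he1 he2 using fun c : CosetIdx S => hF.loc_triv (c.rep⁻¹ • x₀)
    -- On this finite intersection all factors of the fibre are trivialized at once.
    let V : Set X := ⋂ c : CosetIdx S, (fun x => c.rep⁻¹ • x) ⁻¹' U c
    have hV : IsOpen V := isOpen_iInter_of_finite fun c => (hU c).preimage (continuous_const_smul _)
    have hVU : ∀ (x : V) (c : CosetIdx S), c.rep⁻¹ • (x : X) ∈ U c := fun x c =>
      Set.mem_iInter.1 x.2 c
    let E₁ : ∀ x : V, (indFamily F).fib x ≃ₗ[ℂ] (∀ c : CosetIdx S, ι c → ℂ) := fun x =>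
      LinearEquiv.piCongrRight fun c => e c ⟨_, hVU x c⟩
    let E₂ : (∀ c : CosetIdx S, ι c → ℂ) ≃ₗ[ℂ] ((Σ c : CosetIdx S, ι c) → ℂ) :=
      { toFun := fun f q => f q.1 q.2
        invFun := fun f c i => f ⟨c, i⟩
        map_add' := fun _ _ => rfl
        map_smul' := fun _ _ => rfl }
    refine ⟨V, hV, Set.mem_iInter.2 hx, Σ c : CosetIdx S, ι c, inferInstance,
      fun x => (E₁ x).trans E₂, ?_, ?_⟩
    · refine continuous_pi fun q => ?_
      have hc : Continuous fun t : {t : (indFamily F).Tot // t.base ∈ V} =>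
          (⟨⟨q.1.rep⁻¹ • t.1.base, t.1.vec q.1⟩, hVU ⟨_, t.2⟩ q.1⟩ :
            {t : F.Tot // t.base ∈ U q.1}) :=
        ((indFamily_component q.1).comp continuous_subtype_val).subtype_mk _
      exact (continuous_apply q.2).comp ((he1 q.1).comp hc)
    · refine indFamily_mk (continuous_subtype_val.comp continuous_fst) fun c => ?_
      have h1 : Continuous fun q : V × ((Σ c : CosetIdx S, ι c) → ℂ) =>
          (⟨c.rep⁻¹ • (q.1 : X), hVU q.1 c⟩ : U c) :=
        ((continuous_subtype_val.comp continuous_fst).const_smul _).subtype_mk _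
      have h2 : Continuous fun q : V × ((Σ c : CosetIdx S, ι c) → ℂ) => fun i => q.2 ⟨c, i⟩ := by
        fun_prop
      exact (he2 c).comp (h1.prodMk h2)
  act_one x h s := funext fun c => by
    have hc : (1 : TwistedGroup α).g • c = c := one_smul G c
    rw [indFamily_act_apply 1 h s hc]
    exact (F.act_congr (transition_one hc) _ (one_smul S _) _).trans (hF.act_one _ _ _)
  act_mul p q x y z hq hp hpq s := funext fun c => by
    have h1 : q.g • q.g⁻¹ • p.g⁻¹ • c = p.g⁻¹ • c := smul_inv_smul _ _
    have h2 : p.g • p.g⁻¹ • c = c := smul_inv_smul _ _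
    have h3 : (p * q).g • q.g⁻¹ • p.g⁻¹ • c = c := by
      rw [TwistedGroup.mul_g, mul_smul, h1, h2]
    rw [indFamily_act_apply (p * q) hpq s h3, indFamily_act_apply p hp _ h2,
      indFamily_act_apply q hq s h1]
    have h4 := transition_mul p q h1 h2 h3
    have h5 := h4 ▸ transition_smul (p * q) h3 hpq
    exact (F.act_congr h4 _ h5 _).trans (hF.act_mul _ _ _ _ _ _ _ h5 _)
  act_circle z x h s := funext fun c => by
    have hc : (⟨1, z⟩ : TwistedGroup α).g • c = c := one_smul G c
    rw [indFamily_act_apply _ h s hc]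
    exact (F.act_congr (transition_circle z hc) _ (one_smul S _) _).trans (hF.act_circle z _ _ _)
  continuous_act := by
    refine indFamily_mk (EqFamily.continuous_base_act.comp
      (continuous_fst.prodMk (indFamily_base.comp continuous_snd))) fun c => ?_
    -- For fixed `g` the permutation of the cosets is constant, and only the circle coordinate of
    -- the transition element varies.
    refine TwistedGroup.continuous_prod fun g => ?_
    have h1 := hF.continuous_act.comp
      (((continuous_transition (α := α) g (smul_inv_smul g c)).comp continuous_fst).prodMk
      ((indFamily_component (F := F) (g⁻¹ • c)).comp continuous_snd))
    exact h1.congr fun q => EqFamily.tot_ext _ _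

end Cosets

/-! ### Isotypic components of induced bundles -/

section Induced

variable {G : Type v} [Group G] [Finite G] {A : Subgroup G} [A.Normal] {α : Cocycle G}
  {τ : IrrRep (α.comap A.subtype)} {X : GSpace.{u, v} G A}

/-- The bundle induced from an isotypic bundle. -/
def IsotypicBundle.ind (F : IsotypicBundle τ X) : EqBundle α X where
  toEqFamily := indFamily F.toEqFamily
  isBundle := isBundle_indFamily F.isBundle

omit [Finite G] in
-- Being isotypic means that the projector of `τ` is the identity; orthogonality then annihilates
-- the other projectors.
lemma proj_opI [Fintype A] [DecidableEq (Irr (α.comap A.subtype))] (F : IsotypicBundle τ X)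
    (c : Irr (α.comap A.subtype)) (x : X) (w : F.fib x) :
    proj c.coef (opI τ F.toEqFamily x) w = if c = τ.cls then w else 0 := by
  have h1 := (isotypic_iff τ F.isBundle).1 F.isotypic x w
  have hr : IsRep (α.comap A.subtype) (opI τ F.toEqFamily x) :=
    F.isBundle.isRep_fibOp (inclIsotropy τ) (isotropy_triv τ X) x
  have h2 := proj_comp_proj hr c τ.cls w
  rw [IrrRep.coef_cls, h1] at h2
  exact h2

/-- By normality the conjugate of `a` by the representative stays in `A`, which lies in the isotropy
group. So `A` preserves each factor of the induced fibre. -/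
lemma CosetIdx.smul_of_mem {a : G} (ha : a ∈ A) (c : CosetIdx (isotropy τ)) : a • c = c :=
  (CosetIdx.smul_eq_iff _ _ _).2 (le_isotropy τ (conjInv c.rep ⟨a, ha⟩).2)

/-- On the factor of `c` the group `A` acts by the operators of `F` conjugated by `c.rep`, so this
factor is isotypic of type `c.rep • [τ]`. Different cosets of the isotropy group give different
types. -/
lemma intertwines_component (F : IsotypicBundle τ X) (x : X) (c : CosetIdx (isotropy τ)) :
    Intertwines (opA F.ind.toEqFamily x) (conjOp α c.rep (opI τ F.toEqFamily (c.rep⁻¹ • x)))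
      (LinearMap.proj c : (∀ c : CosetIdx (isotropy τ), F.fib (c.rep⁻¹ • x)) →ₗ[ℂ] _) := by
  intro a s
  have hc : (⟨a, 1⟩ : TwistedGroup α).g • c = c := CosetIdx.smul_of_mem a.2 c
  refine (indFamily_act_apply (F := F.toEqFamily) ⟨a, 1⟩ (X.triv a a.2 x) s hc).trans ?_
  have h1 : transition (⟨a, 1⟩ : TwistedGroup α) hc =
      ⟨inclIsotropy τ (conjInv c.rep a), kappa α c.rep a⟩ := by
    apply TwistedGroup.map_injective
    rw [transition_map, mul_assoc, kappa_conj, inv_mul_cancel_left, mul_one]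
    rfl
  have h2 : inclIsotropy τ (conjInv c.rep a) • (c.rep⁻¹ • x) = c.rep⁻¹ • x :=
    isotropy_triv τ X _ _
  exact (F.act_congr h1 _ h2 _).trans (F.isBundle.act_eq_smul _ _ h2 _)

lemma isoProj_ind [Fintype A] [DecidableEq (Irr (α.comap A.subtype))] (F : IsotypicBundle τ X)
    (d : Irr (α.comap A.subtype)) (x : X) (s : F.ind.fib x) (c : CosetIdx (isotropy τ)) :
    (isoProj d F.ind.toEqFamily x s : ∀ c : CosetIdx (isotropy τ), F.fib (c.rep⁻¹ • x)) c =
      if c.rep⁻¹ • d = τ.cls then (s : ∀ c : CosetIdx (isotropy τ), F.fib (c.rep⁻¹ • x)) c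
      else 0 := by
  refine ((intertwines_component F x c).proj d.coef s).trans ?_
  conv_lhs => rw [← smul_inv_smul c.rep d, Irr.proj_smul]
  exact proj_opI F _ _ _

lemma rep_inv_smul_cls (c : CosetIdx (isotropy τ)) :
    c.rep⁻¹ • τ.cls = τ.cls ↔ c = CosetIdx.one (isotropy τ) := by
  rw [CosetIdx.eq_one_iff, ← inv_mem_iff]
  exact Iff.rfl

/-- The representative of the trivial coset, as an element of the extension of the isotropy
group. -/
def oneRep (τ : IrrRep (α.comap A.subtype)) : TwistedGroup (α.comap (isotropy τ).subtype) :=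
  ⟨⟨(CosetIdx.one (isotropy τ)).rep, (CosetIdx.eq_one_iff _).1 rfl⟩, 1⟩

/-- The inclusion of an isotypic bundle into the induced bundle. -/
def indIncl (F : IsotypicBundle τ X) (x : X) :
    F.fib x →ₗ[ℂ] ∀ c : CosetIdx (isotropy τ), F.fib (c.rep⁻¹ • x) :=
  LinearMap.single ℂ (fun c : CosetIdx (isotropy τ) => F.fib (c.rep⁻¹ • x)) (CosetIdx.one _) ∘ₗ
    F.act (oneRep τ)⁻¹ rfl

lemma indIncl_one (F : IsotypicBundle τ X) {x : X} (v : F.fib x)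
    (h : (oneRep τ)⁻¹.g • x = (CosetIdx.one (isotropy τ)).rep⁻¹ • x) :
    indIncl F x v (CosetIdx.one _) = F.act (oneRep τ)⁻¹ h v :=
  Pi.single_eq_same (M := fun c : CosetIdx (isotropy τ) => F.fib (c.rep⁻¹ • x)) _ _

lemma indIncl_ne (F : IsotypicBundle τ X) {x : X} (v : F.fib x) {c : CosetIdx (isotropy τ)}
    (hc : c ≠ CosetIdx.one _) : indIncl F x v c = 0 :=
  Pi.single_eq_of_ne (M := fun c : CosetIdx (isotropy τ) => F.fib (c.rep⁻¹ • x)) hc _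

lemma oneRep_smul (x : X) : (oneRep τ).g • (CosetIdx.one (isotropy τ)).rep⁻¹ • x = x :=
  smul_inv_smul (CosetIdx.one (isotropy τ)).rep x

/-- The projection of the induced bundle to an isotypic bundle. -/
def indRet (F : IsotypicBundle τ X) (x : X) :
    (∀ c : CosetIdx (isotropy τ), F.fib (c.rep⁻¹ • x)) →ₗ[ℂ] F.fib x :=
  F.act (oneRep τ) (oneRep_smul x) ∘ₗ LinearMap.proj (CosetIdx.one _)

lemma indRet_indIncl (F : IsotypicBundle τ X) (x : X) (v : F.fib x) :
    indRet F x (indIncl F x v) = v := by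
  change F.act (oneRep τ) (oneRep_smul x) (indIncl F x v (CosetIdx.one _)) = v
  rw [indIncl_one F v rfl]
  exact F.isBundle.act_act_inv _ _ _ v

/-- The idempotent of `indSplit` is the coordinate projection to the trivial coset; the two
occurrences of `oneRep` cancel. -/
lemma indIncl_indRet (F : IsotypicBundle τ X) (x : X)
    (s : ∀ c : CosetIdx (isotropy τ), F.fib (c.rep⁻¹ • x)) (c : CosetIdx (isotropy τ)) :
    indIncl F x (indRet F x s) c = if c = CosetIdx.one _ then s c else 0 := by
  split_ifs with hc
  · subst hc
    rw [indIncl_one F _ rfl]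
    exact F.isBundle.act_inv_act _ _ _ _
  · exact indIncl_ne F _ hc

/-- The zero section is an empty linear combination. -/
lemma continuous_zero_section {H : Type v} [Group H] {β : Cocycle H} {Z : Type u} [MulAction H Z]
    [TopologicalSpace Z] {E : EqFamily β Z} (hE : E.IsBundle) {T : Type*} [TopologicalSpace T]
    {b : T → Z} (hb : Continuous b) : Continuous fun t => (⟨b t, 0⟩ : E.Tot) :=
  hE.continuous_sum (ι := Empty) ∅ hb (c := fun i => i.elim) (fun i => i.elim)
    (f := fun i => i.elim) (fun i => i.elim)

lemma indIncl_act (F : IsotypicBundle τ X) (p : TwistedGroup (α.comap (isotropy τ).subtype))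
    {x y : X} (h : p.g • x = y) (v : F.fib x) :
    indIncl F y (F.act p h v) = F.ind.act (p.map (isotropy τ).subtype) h (indIncl F x v) := by
  refine funext fun c => ?_
  have h1 : (p.map (isotropy τ).subtype).g • CosetIdx.one (isotropy τ) = CosetIdx.one _ :=
    CosetIdx.smul_one_eq p.g.2
  by_cases hc : c = CosetIdx.one _
  · subst hc
    refine Eq.trans ?_ (indFamily_act_apply (F := F.toEqFamily) _ h _ h1).symm
    rw [indIncl_one F _ rfl, indIncl_one F _ rfl]
    -- On the factor of the trivial coset the isotropy group acts by its conjugate under `oneRep`,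
    -- which the definition of `indIncl` undoes.
    have h2 : transition (p.map (isotropy τ).subtype) h1 = (oneRep τ)⁻¹ * p * oneRep τ :=
      TwistedGroup.map_injective rfl
    have h3 : transition (p.map (isotropy τ).subtype) h1 * (oneRep τ)⁻¹ = (oneRep τ)⁻¹ * p := by
      rw [h2, mul_inv_cancel_right]
    have h4 : ((oneRep τ)⁻¹ * p).g • x = (oneRep τ)⁻¹.g • y := by
      rw [← h, TwistedGroup.mul_g, mul_smul]
    refine (F.isBundle.act_mul _ _ x y _ h rfl h4 v).symm.trans ?_
    exact (F.act_congr h3.symm h4 (h3 ▸ h4) v).trans (F.isBundle.act_mul _ _ x _ _ rfl _ _ v)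
  · rw [indIncl_ne F _ hc]
    have h2 : (p.map (isotropy τ).subtype).g⁻¹ • c ≠ CosetIdx.one _ := fun h3 =>
      hc (by rw [← h1, ← h3, smul_inv_smul])
    refine Eq.symm ((indFamily_act_apply (F := F.toEqFamily) _ h _ (smul_inv_smul _ c)).trans ?_)
    rw [indIncl_ne F v h2, map_zero]

/-- An isotypic bundle splits off the bundle induced from it. -/
def indSplit (F : IsotypicBundle τ X) : Splitting F.toEqFamily F.ind.toEqFamily where
  incl x := indIncl F x
  ret x := indRet F x
  ret_incl x v := indRet_indIncl F x v
  continuous_incl := by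
    refine indFamily_mk F.isBundle.continuous_proj fun c => ?_
    by_cases hc : c = CosetIdx.one _
    · subst hc
      have h1 := F.isBundle.continuous_act_const (oneRep τ)⁻¹ (fun _ => rfl)
        (continuous_id (X := F.toEqFamily.Tot))
      exact h1.congr fun t => congrArg (FamTot.mk _) (indIncl_one F t.vec rfl).symm
    · have h1 := continuous_zero_section F.isBundle
        (F.isBundle.continuous_proj.const_smul c.rep⁻¹)
      exact h1.congr fun t => congrArg (FamTot.mk _) (indIncl_ne F t.vec hc).symm
  continuous_ret := F.isBundle.continuous_act_const (oneRep τ) 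
    (fun t : F.ind.toEqFamily.Tot => oneRep_smul t.base)
    (indFamily_component _)
  incl_act p _ _ h v := indIncl_act F p h v

variable [Fintype A]

/-- Only the factor of the trivial coset has type `[τ]`, so the isotypic projector agrees with the
projector of `indSplit F`. -/
lemma tensorMap_ind (F : IsotypicBundle τ X) : tensorMap τ X F.ind.cls = F.clsT := by
  classical
  refine Subtype.ext (EqBundle.cls_eq (EqFamily.Iso.symm (iso_tensorHom F.ind (indSplit F) ?_)))
  intro x s
  refine funext fun c => ?_
  have h1 := indIncl_indRet F x s c
  have h2 := isoProj_ind F τ.cls x s c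
  by_cases hc : c = CosetIdx.one _
  · rw [if_pos hc] at h1
    rw [if_pos ((rep_inv_smul_cls c).2 hc)] at h2
    exact h1.trans h2.symm
  · rw [if_neg hc] at h1
    rw [if_neg fun h => hc ((rep_inv_smul_cls c).1 h)] at h2
    exact h1.trans h2.symm

/-- The empty splitting. -/
def botSplit (S : Subgroup G) {E : EqFamily α X} (hE : E.IsBundle) :
    Splitting (EqFamily.zero (α.comap S.subtype) X) E where
  incl _ := 0
  ret _ := 0
  ret_incl _ _ := rfl
  continuous_incl := continuous_zero_section hE (EqFamily.zero_proj _ _)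
  continuous_ret := EqFamily.zero_mk hE.continuous_proj
  incl_act p _ _ h _ := (map_zero (E.act (p.map S.subtype) h)).symm

/-- All factors of the induced fibre have types in the orbit of `[τ]`, so the projector of `σ`
vanishes and the zero family splits off with it. -/
lemma tensorMap_ind_of_ne (F : IsotypicBundle τ X) (σ : IrrRep (α.comap A.subtype))
    (h : ∀ g : G, g • τ.cls ≠ σ.cls) : tensorMap σ X F.ind.cls = 0 := by
  classical
  refine Subtype.ext (EqBundle.cls_eq (EqFamily.Iso.symm
    (iso_tensorHom F.ind (botSplit (isotropy σ) F.ind.isBundle) ?_)))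
  intro x s
  refine funext fun c => Eq.trans ?_ (isoProj_ind F σ.cls x s c).symm
  rw [if_neg fun hc => h c.rep (by rw [← hc, smul_inv_smul])]
  rfl

end Induced

/-! ### Grothendieck groups of finite products -/

section Grothendieck

variable {M : Type*} [AddCommMonoid M]

lemma grMap_id (c : Algebra.GrothendieckAddGroup M) : grMap (AddMonoidHom.id M) c = c := by
  suffices grMap (AddMonoidHom.id M) = AddMonoidHom.id _ from DFunLike.congr_fun this c
  apply Algebra.GrothendieckAddGroup.lift.symm.injective
  ext m
  exact grMap_of _ m

lemma grMap_zero {N : Type*} [AddCommMonoid N] (c : Algebra.GrothendieckAddGroup M) :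
    grMap (0 : M →+ N) c = 0 := by
  suffices grMap (0 : M →+ N) = 0 from DFunLike.congr_fun this c
  apply Algebra.GrothendieckAddGroup.lift.symm.injective
  ext m
  exact (grMap_of _ m).trans (map_zero _)

/-- The Grothendieck group of a finite product is the product of the Grothendieck groups. -/
lemma bijective_grMap_pi {O : Type*} [Fintype O] [DecidableEq O] {N : O → Type*}
    [∀ o, AddCommMonoid (N o)] (φ : ∀ o, M →+ N o)
    (hφ : Function.Bijective fun m o => φ o m) :
    Function.Bijective fun c o => grMap (φ o) c := by
  let e : M ≃+ ∀ o, N o := AddEquiv.ofBijective (AddMonoidHom.pi φ) hφ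
  -- These are the inclusions of the factors. The inverse sums their images; each identity is one
  -- between homomorphisms of monoids, extended by the universal property.
  let ψ : ∀ o, N o →+ M := fun o => e.symm.toAddMonoidHom.comp (AddMonoidHom.single N o)
  have hψ : ∀ o o' n, φ o (ψ o' n) = Pi.single (M := N) o' n o := fun o o' n =>
    congrFun (e.apply_symm_apply (Pi.single o' n)) o
  refine Function.bijective_iff_has_inverse.2 ⟨fun f => ∑ o, grMap (ψ o) (f o), ?_, ?_⟩
  · intro c
    suffices ∑ o, (grMap (ψ o)).comp (grMap (φ o)) = AddMonoidHom.id _ by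
      simpa using DFunLike.congr_fun this c
    apply Algebra.GrothendieckAddGroup.lift.symm.injective
    ext m
    change (∑ o, (grMap (ψ o)).comp (grMap (φ o))) (Algebra.GrothendieckAddGroup.of m) =
      Algebra.GrothendieckAddGroup.of m
    simp only [AddMonoidHom.finsetSum_apply, AddMonoidHom.comp_apply, grMap_of]
    rw [← map_sum]
    congr 1
    change ∑ o, e.symm (Pi.single o (e m o)) = m
    rw [← map_sum, Finset.univ_sum_single, e.symm_apply_apply]
  · intro f
    funext o
    change grMap (φ o) (∑ o', grMap (ψ o') (f o')) = f o
    rw [map_sum, Finset.sum_eq_single o]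
    · rw [grMap_comp (ψ o) (φ o) (AddMonoidHom.id _) fun m => by simp [hψ], grMap_id]
    · intro o' _ ho
      rw [grMap_comp (ψ o') (φ o) 0 fun m => by
        rw [hψ, Pi.single_eq_of_ne ho.symm]; rfl, grMap_zero]
    · exact fun h => absurd (Finset.mem_univ o) h

end Grothendieck

/-! ### The decomposition of K-theory in all degrees -/

section Decomposition

variable {G : Type v} [Group G] {A : Subgroup G} [A.Normal] {α : Cocycle G}

section

variable [Fintype A] (τ : IrrRep (α.comap A.subtype))

/-- The homomorphism `[E] ↦ [V_τ ⊗ Hom(V_τ, E)]` in K-theory. -/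
def kMap (X : GSpace.{u, v} G A) : K0 α X →+ KT0 τ X := grMap (tensorMap τ X)

lemma kMap_cls {X : GSpace.{u, v} G A} (E : EqBundle α X) :
    kMap τ X (K0.cls E) = KT0.cls (tensorBundle τ E) := grMap_of _ _

lemma kMap_pull {X Y : GSpace.{u, v} G A} (f : EqMap G Y X) (c : K0 α X) :
    kMap τ Y (K0.pull α f c) = KT0.pull τ f (kMap τ X c) :=
  (grMap_comp _ _ ((tensorMap τ Y).comp (Vect.pull f)) (fun _ => rfl) c).trans
    (grMap_comp _ _ _ (fun m => (tensorMap_pull τ f m).symm) c).symm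

/-- The homomorphism `[E] ↦ [V_τ ⊗ Hom(V_τ, E)]` in degree `n`. -/
def kMapDeg (X : GSpace.{u, v} G A) (n : ℕ) : KGroup α X n →+ KTGroup τ X n :=
  ((kMap τ (X.deg n)).comp (KGroup α X n).subtype).codRestrict (KTGroup τ X n) <| by
    rintro ⟨c, hc⟩
    cases n with
    | zero => trivial
    | succ n =>
      refine AddMonoidHom.mem_ker.2 ((kMap_pull τ (X.base (n + 1)) c).symm.trans ?_)
      exact (congrArg _ (AddMonoidHom.mem_ker.1 hc)).trans (map_zero _)

lemma coe_kMapDeg (X : GSpace.{u, v} G A) (n : ℕ) (c : KGroup α X n) :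
    (kMapDeg τ X n c : KT0 τ (X.deg n)) = kMap τ (X.deg n) c := rfl

lemma kMapDeg_map {X Y : GSpace.{u, v} G A} (f : EqMap G Y X) (n : ℕ) (c : KGroup α X n) :
    kMapDeg τ Y n (KGroup.map α f n c) = KTGroup.map τ f n (kMapDeg τ X n c) :=
  Subtype.ext (kMap_pull τ (GSpace.degMap f n) c)

end

variable [Finite G] [Fintype A] {O : Type*} [Fintype O] (τ : O → IrrRep (α.comap A.subtype))
  (hinj : ∀ o o' (g : G), g • (τ o').cls = (τ o).cls → o' = o)
  (hsurj : ∀ c : Irr (α.comap A.subtype), ∃ o, ∃ g : G, g • (τ o).cls = c)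

include hinj hsurj

/-- Injectivity is gluing. For surjectivity, a preimage is the sum of the bundles induced from the
given isotypic bundles: each contributes only to its own orbit. -/
lemma bijective_tensorMap (X : GSpace.{u, v} G A) :
    Function.Bijective fun (c : Vect α X) o => tensorMap (τ o) X c := by
  cases nonempty_fintype G
  constructor
  · intro a b h
    induction a using Vect.ind with | _ E =>
    induction b using Vect.ind with | _ E' =>
    exact EqBundle.cls_eq (iso_of_tensorHom_iso τ hinj hsurj fun o =>
      IsotypicBundle.clsT_eq_iff.1 (congrFun h o))
  · intro f
    choose F hF using fun o => VectT.exists_rep (f o)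
    refine ⟨∑ o, (F o).ind.cls, funext fun o => ?_⟩
    change tensorMap (τ o) X (∑ o', (F o').ind.cls) = f o
    rw [map_sum, Finset.sum_eq_single o]
    · rw [tensorMap_ind, hF]
    · exact fun o' _ ho => tensorMap_ind_of_ne _ _ fun g hg => ho (hinj o o' g hg)
    · exact fun h => absurd (Finset.mem_univ o) h

lemma bijective_kMap (X : GSpace.{u, v} G A) :
    Function.Bijective fun (c : K0 α X) o => kMap (τ o) X c := by
  classical
  exact bijective_grMap_pi _ (bijective_tensorMap τ hinj hsurj X)

lemma bijective_kMapDeg (X : GSpace.{u, v} G A) (n : ℕ) :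
    Function.Bijective fun (c : KGroup α X n) o => kMapDeg (τ o) X n c := by
  constructor
  · intro a b h
    exact Subtype.ext ((bijective_kMap τ hinj hsurj (X.deg n)).1
      (funext fun o => congrArg Subtype.val (congrFun h o)))
  · intro f
    obtain ⟨c, hc⟩ := (bijective_kMap τ hinj hsurj (X.deg n)).2 fun o => (f o).1
    have hmem : c ∈ KGroup α X n := by
      cases n with
      | zero => trivial
      | succ n =>
        -- By naturality the restriction of `c` to the base point has zero components, hence is zero
        -- by injectivity over the point.
        refine AddMonoidHom.mem_ker.2 ((bijective_kMap τ hinj hsurj (GSpace.pt.{u} G A)).1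
          (funext fun o => ?_))
        change kMap (τ o) _ (K0.pull α (X.base (n + 1)) c) = kMap (τ o) _ 0
        refine (kMap_pull (τ o) (X.base (n + 1)) c).trans (Eq.trans ?_ (map_zero _).symm)
        exact (congrArg _ (congrFun hc o)).trans (AddMonoidHom.mem_ker.1 (f o).2)
    exact ⟨⟨c, hmem⟩, funext fun o => Subtype.ext (congrFun hc o)⟩

/-- The decomposition of twisted equivariant K-theory. -/
def kEquiv (X : GSpace.{u, v} G A) (n : ℕ) : KGroup α X n ≃+ ⨁ o, KTGroup (τ o) X n :=
  (AddEquiv.ofBijective (AddMonoidHom.pi fun o => kMapDeg (τ o) X n)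
    (bijective_kMapDeg τ hinj hsurj X n)).trans
    (DirectSum.addEquivProd fun o => KTGroup (τ o) X n).symm

lemma kEquiv_apply (X : GSpace.{u, v} G A) (n : ℕ) (c : KGroup α X n) (o : O) :
    kEquiv τ hinj hsurj X n c o = kMapDeg (τ o) X n c :=
  congrFun ((DirectSum.addEquivProd fun o => KTGroup (τ o) X n).apply_symm_apply
    fun o => kMapDeg (τ o) X n c) o

end Decomposition

end TwK

end

/-! ### The decomposition theorem -/

theorem theorem3p6 {G : Type v} [Group G] [Finite G] (A : Subgroup G) [A.Normal]
    (α : TwK.Cocycle G)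
    (τ : MulAction.orbitRel.Quotient G (TwK.Irr (α.comap A.subtype)) →
      TwK.IrrRep (α.comap A.subtype))
    (hτ : ∀ o, (Quotient.mk _ (τ o).cls :
      MulAction.orbitRel.Quotient G (TwK.Irr (α.comap A.subtype))) = o) :
    ∃ Ψ : ∀ (X : TwK.GSpace.{u, v} G A) [CompactSpace X] [T2Space X] (n : ℕ),
        TwK.KGroup α X n ≃+ ⨁ o, TwK.KTGroup (τ o) X n,
      -- `[E] ↦ ⨁ [V_τ ⊗ Hom(V_τ, E)]`; here `X.deg 0` is `X`, and `KGroup α X 0` is all of `K0 α X`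
      (∀ (X : TwK.GSpace.{u, v} G A) [CompactSpace X] [T2Space X] (n : ℕ)
        (E : TwK.EqBundle α (X.deg n)) (c : TwK.KGroup α X n),
          (c : TwK.K0 α (X.deg n)) = TwK.K0.cls E → ∀ o,
            ∃ F : TwK.IsotypicBundle (τ o) (X.deg n),
              F.toEqFamily = TwK.tensorHom (τ o) E ∧
              ((Ψ X n c o : TwK.KTGroup (τ o) X n) : TwK.KT0 (τ o) (X.deg n)) = TwK.KT0.cls F) ∧
      -- `[E] - [E'] ↦ ⨁ ([V_τ ⊗ Hom(V_τ, E)] - [V_τ ⊗ Hom(V_τ, E')])` in every degree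
      (∀ (X : TwK.GSpace.{u, v} G A) [CompactSpace X] [T2Space X] (n : ℕ)
        (E E' : TwK.EqBundle α (X.deg n)) (c : TwK.KGroup α X n),
          (c : TwK.K0 α (X.deg n)) = TwK.K0.cls E - TwK.K0.cls E' → ∀ o,
            ∃ F F' : TwK.IsotypicBundle (τ o) (X.deg n),
              F.toEqFamily = TwK.tensorHom (τ o) E ∧
              F'.toEqFamily = TwK.tensorHom (τ o) E' ∧
              ((Ψ X n c o : TwK.KTGroup (τ o) X n) : TwK.KT0 (τ o) (X.deg n)) =
                TwK.KT0.cls F - TwK.KT0.cls F') ∧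
      -- functoriality
      (∀ (X Y : TwK.GSpace.{u, v} G A) [CompactSpace X] [T2Space X] [CompactSpace Y] [T2Space Y]
        (f : TwK.EqMap G Y X) (n : ℕ) (c : TwK.KGroup α X n) (o),
          Ψ Y n (TwK.KGroup.map α f n c) o = TwK.KTGroup.map (τ o) f n (Ψ X n c o)) := by
  have := Fintype.ofFinite A
  have := Fintype.ofFinite (MulAction.orbitRel.Quotient G (TwK.Irr (α.comap A.subtype)))
  -- With `hsurj`, this restates in terms of elements of `G` that `τ` picks exactly one
  -- representative from each orbit.
  have hinj : ∀ o o' (g : G), g • (τ o').cls = (τ o).cls → o' = o := fun o o' g h => by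
    rw [← hτ o, ← hτ o']
    exact (Quotient.sound (s := MulAction.orbitRel G _) ⟨g, h⟩).symm
  have hsurj : ∀ c : TwK.Irr (α.comap A.subtype), ∃ o, ∃ g : G, g • (τ o).cls = c := fun c =>
    ⟨Quotient.mk _ c, Quotient.exact (s := MulAction.orbitRel G _) (hτ (Quotient.mk _ c)).symm⟩
  refine ⟨fun X _ _ n => TwK.kEquiv τ hinj hsurj X n, ?_, ?_, ?_⟩
  · intro X _ _ n E c hc o
    refine ⟨TwK.tensorBundle (τ o) E, rfl, ?_⟩
    rw [TwK.kEquiv_apply, TwK.coe_kMapDeg, hc, TwK.kMap_cls]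
  · intro X _ _ n E E' c hc o
    refine ⟨TwK.tensorBundle (τ o) E, TwK.tensorBundle (τ o) E', rfl, rfl, ?_⟩
    rw [TwK.kEquiv_apply, TwK.coe_kMapDeg, hc, map_sub, TwK.kMap_cls, TwK.kMap_cls]
  · intro X Y _ _ _ _ f n c o
    rw [TwK.kEquiv_apply, TwK.kEquiv_apply, TwK.kMapDeg_map]
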